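/- **Setting.** An interval is a bounded interval of $\mathbb R$ of positive length, with length $\ell_I=|I|$ and center $c_I$. A dyadic grid $\mathcal D$ is a collection of intervals such that, for some $\rho=\rho_{\mathcal D}\in(\frac12,2)$: (a) all lengths belong to $\rho 2^{\mathbb Z}$; (b) for each $k\in\mathbb Z$ the elements of length $\rho2^k$ cover $\mathbb R$ up to a null set; (c) $I\cap J\in\{\varnothing,I,J\}$ for $I,J\in\mathcal D$; and no two distinct elements of $\mathcal D$ have the same endpoints. The parent $I^{\mathsf p}$ of $I\in\mathcal D$ is the element of $\mathcal D$ of length $2\ell_I$ containing $I$, and the sibling $I^{\mathsf b}$ is the other element of $\mathcal D$ of length $\ell_I$ contained in $I^{\mathsf p}$. Let $\mathcal D,\mathcal D'$ be dual dyadic grids, $\rho_{\mathcal D}\rho_{\mathcal D'}=1$. A tile is $P=I_P\times\omega_P\in\mathcal D\times\mathcal D'$ with $\ell_{I_P}\ell_{\omega_P}=1$; $\mathbb S$ is the set of all tiles, and $\mathbb S^J=\{P\in\mathbb S: I_P\subset J\}$ for $J\in\mathcal D$. **Modified wave packet transform.** Let $\langle x\rangle=\sqrt{1+|x|^2}$ and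 $\widehat f(\xi)=\frac1{\sqrt{2\pi}}\int f(x)e^{-ix\xi}\,dx$. For $M\in\mathbb N$, $\Phi^M(P)$ is the set of functions $\varphi(x)=e^{ic_{\omega_P}x}\,\ell_{I_P}^{-1}\,\theta\big(\ell_{I_P}^{-1}(x-c_{I_P})\big)$ with $\operatorname{supp}\widehat\varphi\subset\omega_P$, where $\theta\in \mathcal C^M(\mathbb R;\mathbb C)$ and $\langle x\rangle^M|\theta^{(\alpha)}(x)|\le1$ for all $x\in\mathbb R$, $0\le\alpha\le M$. $\Psi^M(P)$ is the set of $\psi\in \mathcal C^M(\mathbb R\times\mathbb R;\mathbb C)$ with $\psi(\cdot,\nu)\in\Phi^M(P)$ and $\ell_{I_P}^{-1}\partial_\nu\psi(\cdot,\nu)\in\Phi^M(P)$ for all $\nu\in\mathbb R$. For a measurable $N:\mathbb R\to\mathbb R$, $$A[f](P)=\sup_{\psi\in\Psi^M(P)}\left|\int_{\mathbb R} f(x)\,\overline{\psi(x,N(x))}\,\mathbf 1_{\omega_P^{\mathsf b}}(N(x))\,dx\right|,\qquad P\in\mathbb S.$$ **Outer norms.** A tree is a set $T\subset\mathbb S$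 with top data $(I_T,\xi_T)\in\mathcal D\times\mathbb R$ such that $I_P\subset I_T$ and $\xi_T\in\omega_P^{\mathsf p}$ for all $P\in T$. Put $T^{\mathsf{ov}}=\{P\in T:\xi_T\in\omega_P\}$, $T^{\mathsf{lac}}=T\setminus T^{\mathsf{ov}}$. For $F:\mathbb S^J\to\mathbb C$ and a tree $T\subset\mathbb S^J$ let $$\mathsf{size}_{\mathsf C}(F,T)=\Big(\frac1{|I_T|}\sum_{P\in T^{\mathsf{lac}}}|I_P||F(P)|^2\Big)^{1/2}+\frac1{|I_T|}\sum_{P\in T^{\mathsf{ov}}}|I_P||F(P)|,$$ and $\|F\|_{L^\infty(J)}=\|F\|_{L^{\infty,\infty}(J)}=\sup_{T\subset\mathbb S^J}\mathsf{size}_{\mathsf C}(F,T)$. For $A\subset\mathbb S^J$ let $\mu^J(A)$ be the infimum of $\frac1{|J|}\sum_{T\in\mathcal T}|I_T|$ over all collections $\mathcal T$ of trees contained in $\mathbb S^J$ whose union covers $A$. For $t>0$ let $$F^*(t)=\inf\big\{\tau\in[0,\infty):\ \inf\{\mu^J(A):A\subset\mathbb S^J,\ \|F\mathbf 1_{\mathbb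 S^J\setminus A}\|_{L^\infty(J)}\le\tau\}\le t\big\},$$ and, for $1\le p<\infty$, $\|F\|_{L^{p,\infty}(J)}=\sup_{t>0}t^{1/p}F^*(t)$. For $1\le p\le\infty$ let $\|F\|_{Y^{p,\infty}(J)}=\max\{\|F\|_{L^{p,\infty}(J)},\|F\|_{L^\infty(J)}\}$. Finally, let $\mathrm Mf(x)=\sup_{I\ni x}\frac1{|I|}\int_I|f|$, the supremum being over all intervals $I$ containing $x$, and $[f]_{1,\mathbb P}=\sup_{P\in\mathbb P}\inf_{I_P}\mathrm Mf$ for $\mathbb P\subset\mathbb S$. **Proposition.** There is an absolute constant $C$ such that, for every integer $M\ge10\cdot2^9$, every pair of dual dyadic grids $\mathcal D,\mathcal D'$, every measurable $N:\mathbb R\to\mathbb R$, every bounded, compactly supported, measurable $f:\mathbb R\to\mathbb C$, every finite $\mathbb P\subset\mathbb S$, every $J\in\mathcal D$ and every $1\le p\le\infty$, $$\big\|A[f]\mathbf 1_{\mathbb P}\big\|_{L^{p,\infty}(J)}\le C\,[f]_{1,\mathbb P}\qquad\text{and}\qquad \big\|A[f]\mathbf 1_{\mathbb P}\big\|_{Y^{p,\infty}(J)}\le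 C\,[f]_{1,\mathbb P}.$$ -/

import Mathlib

open MeasureTheory Set
open scoped ENNReal NNReal ComplexConjugate

noncomputable section

namespace WavePacket

/-! ### Intervals -/

/-- Bounded intervals of positive length (endpoints included or not). -/
def IsBoundedInterval (I : Set ℝ) : Prop :=
  ∃ a b : ℝ, a < b ∧ Ioo a b ⊆ I ∧ I ⊆ Icc a b

/-- The length `ℓ_I` of an interval. -/
def len (I : Set ℝ) : ℝ := volume.real I

/-- The center `c_I` of an interval. -/
def center (I : Set ℝ) : ℝ := (sInf I + sSup I) / 2

/-! ### Dyadic grids and tiles -/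

/-- A dyadic grid. The last field says that an interval is listed with only one choice of its
endpoints; this is what makes parents and siblings unique. -/
structure DyadicGrid where
  intervals : Set (Set ℝ)
  rho : ℝ
  half_lt_rho : 1 / 2 < rho
  rho_lt_two : rho < 2
  isBoundedInterval : ∀ I ∈ intervals, IsBoundedInterval I
  length_mem : ∀ I ∈ intervals, ∃ k : ℤ, len I = rho * 2 ^ k
  covering : ∀ k : ℤ, volume (⋃₀ {I ∈ intervals | len I = rho * 2 ^ k})ᶜ = 0
  grid : ∀ I ∈ intervals, ∀ J ∈ intervals, I ∩ J = ∅ ∨ I ∩ J = I ∨ I ∩ J = J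
  eq_of_closure_eq : ∀ I ∈ intervals, ∀ J ∈ intervals, closure I = closure J → I = J

/-- The `κ`-th parent of `I`: the element of the grid of length `2 ^ κ * ℓ_I` that contains `I`
(the union is over a one-element family). -/
def DyadicGrid.parent (D : DyadicGrid) (κ : ℕ) (I : Set ℝ) : Set ℝ :=
  ⋃₀ {Q ∈ D.intervals | len Q = 2 ^ κ * len I ∧ I ⊆ Q}

/-- The sibling of `I`: the other element of the grid of length `ℓ_I` inside the first parent of `I`
(the union is over a one-element family). -/
def DyadicGrid.sibling (D : DyadicGrid) (I : Set ℝ) : Set ℝ :=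
  ⋃₀ {J ∈ D.intervals | J ≠ I ∧ len J = len I ∧ J ⊆ D.parent 1 I}

/-- Two grids are dual. -/
def DyadicGrid.Dual (D D' : DyadicGrid) : Prop := D.rho * D'.rho = 1

/-- The tiles `P = I_P × ω_P` of `D × D'`. -/
structure Tile (D D' : DyadicGrid) where
  space : Set ℝ
  freq : Set ℝ
  space_mem : space ∈ D.intervals
  freq_mem : freq ∈ D'.intervals
  area : len space * len freq = 1

/-- The spatial scale of a tile. -/
def Tile.scl {D D' : DyadicGrid} (P : Tile D D') : ℝ := len P.space

/-! ### Wave packets -/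

/-- The Fourier transform, normalized by `(2π)^{-1/2} ∫ f(x) e^{-ixξ} dx`. -/
def fourierT (f : ℝ → ℂ) (ξ : ℝ) : ℂ :=
  ((1 / Real.sqrt (2 * Real.pi) : ℝ) : ℂ) *
    ∫ x : ℝ, f x * Complex.exp (-(Complex.I * (x : ℂ) * (ξ : ℂ)))

/-- Translation. -/
def Tr (a : ℝ) (f : ℝ → ℂ) : ℝ → ℂ := fun x => f (x - a)

/-- Modulation. -/
def Mod (a : ℝ) (f : ℝ → ℂ) : ℝ → ℂ := fun x => Complex.exp (Complex.I * (a : ℂ) * (x : ℂ)) * f x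

/-- The `L¹`-normalized dilation. -/
def Dil (b : ℝ) (f : ℝ → ℂ) : ℝ → ℂ := fun x => ((b⁻¹ : ℝ) : ℂ) * f (b⁻¹ * x)

/-- The Japanese bracket. -/
def japaneseBracket (x : ℝ) : ℝ := Real.sqrt (1 + |x| ^ 2)

/-- The unit ball of the space of `C^M` functions with norm
`sup_{0 ≤ α ≤ M} sup_x ⟨x⟩^M |D^α θ(x)|`. -/
def Theta (M : ℕ) : Set (ℝ → ℂ) :=
  {θ | ContDiff ℝ M θ ∧
    ∀ α : ℕ, α ≤ M → ∀ x : ℝ, japaneseBracket x ^ M * ‖iteratedDeriv α θ x‖ ≤ 1}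

/-- The `L¹`-adapted wave packets of order `M` of the tile `P`. -/
def Phi {D D' : DyadicGrid} (M : ℕ) (P : Tile D D') : Set (ℝ → ℂ) :=
  {φ | (∃ θ ∈ Theta M, φ = Mod (center P.freq) (Tr (center P.space) (Dil P.scl θ))) ∧
    tsupport (fourierT φ) ⊆ P.freq}

/-- The modified class of functions `ψ(x, ν)`. -/
def Psi {D D' : DyadicGrid} (M : ℕ) (P : Tile D D') : Set (ℝ → ℝ → ℂ) :=
  {ψ | ContDiff ℝ M (fun z : ℝ × ℝ => ψ z.1 z.2) ∧
    ∀ ν : ℝ, (fun x => ψ x ν) ∈ Phi M P ∧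
      (fun x => ((P.scl⁻¹ : ℝ) : ℂ) * deriv (fun s : ℝ => ψ x s) ν) ∈ Phi M P}

/-- The modified wave packet transform `A[f](P)` of order `M` with frequency function `N`. -/
def modifiedTransform {D D' : DyadicGrid} (M : ℕ) (N : ℝ → ℝ) (f : ℝ → ℂ) (P : Tile D D') :
    ℝ≥0∞ :=
  ⨆ ψ ∈ Psi M P,
    ‖∫ x : ℝ, f x * conj ((N ⁻¹' D'.sibling P.freq).indicator (fun y => ψ y (N y)) x)‖ₑ

/-! ### Local averages and the maximal function -/

/-- The average `⟨f⟩_{1,I}`. -/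
def localAverage (f : ℝ → ℂ) (I : Set ℝ) : ℝ≥0∞ := (∫⁻ x in I, ‖f x‖ₑ) / volume I

/-- The (uncentered) Hardy-Littlewood maximal function. -/
def maximalFunction (f : ℝ → ℂ) (x : ℝ) : ℝ≥0∞ :=
  ⨆ (I : Set ℝ) (_ : IsBoundedInterval I) (_ : x ∈ I), localAverage f I

/-- The quantity `[f]_{1,ℙ} = sup_{P ∈ ℙ} inf_{I_P} M f`. -/
def tileNorm {D D' : DyadicGrid} (f : ℝ → ℂ) (ℙ : Set (Tile D D')) : ℝ≥0∞ :=
  ⨆ P ∈ ℙ, ⨅ x ∈ P.space, maximalFunction f x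

/-- Essentially bounded functions with (essentially) bounded support. -/
def MemLinftyZero (f : ℝ → ℂ) : Prop :=
  MemLp f ∞ volume ∧ ∃ R : ℝ, ∀ᵐ x : ℝ, R < |x| → f x = 0

/-! ### Trees and outer `L^p` norms -/

/-- A `κ`-tree, together with its top data `(I_T, ξ_T)`. -/
structure Tree (D D' : DyadicGrid) (κ : ℕ) where
  tiles : Set (Tile D D')
  top : Set ℝ
  top_mem : top ∈ D.intervals
  topFreq : ℝ
  space_subset : ∀ P ∈ tiles, P.space ⊆ top
  topFreq_mem : ∀ P ∈ tiles, topFreq ∈ D'.parent κ P.freq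

/-- The subtree with the same top data formed by the tiles satisfying `p`. -/
def Tree.restrict {D D' : DyadicGrid} {κ : ℕ} (T : Tree D D' κ) (p : Tile D D' → Prop) :
    Tree D D' κ where
  tiles := {P ∈ T.tiles | p P}
  top := T.top
  top_mem := T.top_mem
  topFreq := T.topFreq
  space_subset := fun P hP => T.space_subset P hP.1
  topFreq_mem := fun P hP => T.topFreq_mem P hP.1

/-- The overlapping part of a tree. -/
def Tree.ov {D D' : DyadicGrid} {κ : ℕ} (T : Tree D D' κ) : Tree D D' κ :=
  T.restrict fun P => T.topFreq ∈ P.freq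

/-- The lacunary part of a tree. -/
def Tree.lac {D D' : DyadicGrid} {κ : ℕ} (T : Tree D D' κ) : Tree D D' κ :=
  T.restrict fun P => T.topFreq ∉ P.freq

/-- The collection `𝕊^J` of the tiles with spatial support in `J`. -/
def localTiles (D D' : DyadicGrid) (J : Set ℝ) : Set (Tile D D') := {P | P.space ⊆ J}

/-- The collection of the `κ`-trees contained in `𝕊^J`. -/
def localTrees (D D' : DyadicGrid) (κ : ℕ) (J : Set ℝ) : Set (Tree D D' κ) :=
  {T | T.tiles ⊆ localTiles D D' J}

/-- The outer measure `μ^{J,κ}`. -/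
def outerMu {D D' : DyadicGrid} (κ : ℕ) (J : Set ℝ) (A : Set (Tile D D')) : ℝ≥0∞ :=
  ⨅ (𝒯 : Set (Tree D D' κ)) (_ : 𝒯 ⊆ localTrees D D' κ J) (_ : A ⊆ ⋃ T ∈ 𝒯, T.tiles),
    (∑' T : 𝒯, volume (T : Tree D D' κ).top) / volume J

/-- `size_p(F, T)` for `0 < p < ∞`; only `|F|` matters, so `F` takes values in `[0, ∞]`. -/
def sizeP {D D' : DyadicGrid} {κ : ℕ} (p : ℝ) (F : Tile D D' → ℝ≥0∞) (T : Tree D D' κ) : ℝ≥0∞ :=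
  (∑' P : T.tiles, volume (P : Tile D D').space * F P ^ p) ^ (1 / p) / volume T.top ^ (1 / p)

/-- The Carleson size. -/
def sizeC {D D' : DyadicGrid} (F : Tile D D' → ℝ≥0∞) (T : Tree D D' 1) : ℝ≥0∞ :=
  sizeP 2 F T.lac + sizeP 1 F T.ov

section Outer

variable {D D' : DyadicGrid} (κ : ℕ) (J : Set ℝ) (s : (Tile D D' → ℝ≥0∞) → Tree D D' κ → ℝ≥0∞)

/-- The outer essential supremum, that is, the outer `L^∞` norm. -/
def outSup (F : Tile D D' → ℝ≥0∞) : ℝ≥0∞ := ⨆ T ∈ localTrees D D' κ J, s F T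

/-- The super level measure. -/
def superLevel (F : Tile D D' → ℝ≥0∞) (τ : ℝ≥0) : ℝ≥0∞ :=
  ⨅ (A : Set (Tile D D')) (_ : A ⊆ localTiles D D' J)
    (_ : outSup κ J s ((localTiles D D' J \ A).indicator F) ≤ τ), outerMu κ J A

/-- The rearrangement `F^{*,s}`. -/
def rearrangement (F : Tile D D' → ℝ≥0∞) (t : ℝ≥0) : ℝ≥0∞ :=
  ⨅ (τ : ℝ≥0) (_ : superLevel κ J s F τ ≤ t), (τ : ℝ≥0∞)

/-- The outer `L^{p,∞}` quasinorm; `L^{∞,∞}` is the outer `L^∞` norm. -/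
def outerWeakNorm (p : ℝ≥0∞) (F : Tile D D' → ℝ≥0∞) : ℝ≥0∞ :=
  if p = ∞ then outSup κ J s F
  else ⨆ (t : ℝ≥0) (_ : 0 < t), (t : ℝ≥0∞) ^ (1 / p.toReal) * rearrangement κ J s F t

/-- The `Y^{p,∞}` quasinorm. -/
def outerYNorm (p : ℝ≥0∞) (F : Tile D D' → ℝ≥0∞) : ℝ≥0∞ :=
  max (outerWeakNorm κ J s p F) (outSup κ J s F)

end Outer

end WavePacket

end

namespace WavePacket

/-! ### Intervals -/

/-! Everything runs through a density. For rectangles `I × Q` of area two with `I_P ⊆ I ⊆ J` and `Q`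
inside the parent of `ω_P`, it measures the mass of `|f|` on the points `x` of the `2^k`-dilate of
`I` with `N x ∈ Q`, relative to `|I|` and with a factor `2^{4k}` tolerated (`DensityLE`). Two facts
carry the theorem. If all tiles have density at most `λ`, every tree has size `≲ λ` (`sizeC_le`).
The tiles of density above `λ` are covered by trees of total top length `≲ λ⁻¹ ∫ |f| w_J`
(`outerMu_le_of_density`), where `w_J` is a decaying weight adapted to `J`. With `κ = [f]_{1,ℙ}`,
maximal averages bound the integral by a multiple of `κ |J|` and every density by `2κ`. Hence `F*(t)
≲ κ min(1, 1/t)`, which controls `t^{1/p} F*(t)` for all `1 ≤ p < ∞` at once, and the outer `L^∞`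
norm as well.

Covering. Each tile of large density lies below a rectangle witnessing it. The maximal witnesses are
pairwise disjoint, and each is the top of one tree. For fixed `k`, a Vitali selection among the
dilated rectangles leaves a family for which the sets of `x` with `(x, N x)` in the dilate are
disjoint; the tolerated `2^{4k}` beats the overlap and leaves a convergent sum over `k`.

Size. Let `d(x)` be the minimum of `ℓ_P + |x - c_P|` over the tiles of the tree (`tileDist`). Where
`ℓ_P < 4 d(x)`, absolute values suffice: the weights `d / ℓ_P` times a decaying factor sum
geometrically over scales. Where some tile seeing `x` has `ℓ_P ≥ 4 d(x)` (`starSet`), the averages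
of `|f|` at the variable scale `d` are at most a multiple of `λ` (`IsFamily.star_average_le`),
because all such tiles see `x` through one rectangle. In the overlapping part the sets `N⁻¹(ω_P^b)`
are disjoint for different scales, so only one scale acts at each point.

In the lacunary part these sets are nested, decreasing as `ℓ_P` grows. Freezing `N x` at the top
frequency `ξ` costs `|N x - ξ| ℓ_P`, summable in the scale, and demodulation by `ξ` turns packets
into mean zero molecules. What remains is a square function estimate for functions cut off by sets
that change with the scale. After splitting the demodulated `f` into four nonnegative parts and
averaging at scale `d`, one has bounded functions decreasing in the scale. One-sided exponential
averages satisfy an exact energy identity (`integral_sq_expAvg_half`) and preserve order, so the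
energies of consecutive differences telescope even though the function changes at each step
(`sum_integral_sq_expDiff_le`); molecules see only these differences
(`IsMolecule.enorm_integral_mul_le`). -/

theorem IsBoundedInterval.volume_len_center {I : Set ℝ} {a b : ℝ} (hab : a < b)
    (h1 : Ioo a b ⊆ I) (h2 : I ⊆ Icc a b) :
    volume I = ENNReal.ofReal (b - a) ∧ len I = b - a ∧ center I = (a + b) / 2 := by
  have hv : volume I = ENNReal.ofReal (b - a) := by
    apply le_antisymm
    · exact (measure_mono h2).trans (by simp)
    · exact le_trans (by simp) (measure_mono h1)
  refine ⟨hv, ?_, ?_⟩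
  · rw [len, Measure.real, hv, ENNReal.toReal_ofReal (by linarith)]
  · have hne : (Ioo a b).Nonempty := nonempty_Ioo.2 hab
    have hi : sInf I = a := by
      apply le_antisymm
      · rw [← csInf_Ioo hab]
        exact csInf_le_csInf (bddBelow_Icc.mono h2) hne h1
      · exact le_csInf (hne.mono h1) fun x hx => (h2 hx).1
    have hs : sSup I = b := by
      apply le_antisymm
      · exact csSup_le (hne.mono h1) fun x hx => (h2 hx).2
      · rw [← csSup_Ioo hab]
        exact csSup_le_csSup (bddAbove_Icc.mono h2) hne h1
    rw [center, hi, hs]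

section Interval
variable {I J : Set ℝ}

theorem IsBoundedInterval.len_pos (h : IsBoundedInterval I) : 0 < len I := by
  obtain ⟨a, b, hab, h1, h2⟩ := h
  rw [(volume_len_center hab h1 h2).2.1]; linarith

theorem IsBoundedInterval.volume_eq (h : IsBoundedInterval I) :
    volume I = ENNReal.ofReal (len I) := by
  obtain ⟨a, b, hab, h1, h2⟩ := h
  rw [(volume_len_center hab h1 h2).2.1, (volume_len_center hab h1 h2).1]

theorem IsBoundedInterval.Ioo_subset (h : IsBoundedInterval I) :
    Ioo (center I - len I / 2) (center I + len I / 2) ⊆ I := by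
  obtain ⟨a, b, hab, h1, h2⟩ := h
  rw [(volume_len_center hab h1 h2).2.1, (volume_len_center hab h1 h2).2.2]
  convert h1 using 2 <;> ring

theorem IsBoundedInterval.subset_Icc (h : IsBoundedInterval I) :
    I ⊆ Icc (center I - len I / 2) (center I + len I / 2) := by
  obtain ⟨a, b, hab, h1, h2⟩ := h
  rw [(volume_len_center hab h1 h2).2.1, (volume_len_center hab h1 h2).2.2]
  convert h2 using 2 <;> ring

theorem IsBoundedInterval.abs_sub_center_le (h : IsBoundedInterval I) {x : ℝ} (hx : x ∈ I) :
    |x - center I| ≤ len I / 2 := by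
  have := h.subset_Icc hx
  rw [abs_le]; constructor <;> linarith [this.1, this.2]

theorem IsBoundedInterval.center_mem (h : IsBoundedInterval I) : center I ∈ I := by
  have := h.len_pos
  exact h.Ioo_subset ⟨by linarith, by linarith⟩

theorem IsBoundedInterval.nonempty (h : IsBoundedInterval I) : I.Nonempty := ⟨_, h.center_mem⟩

theorem IsBoundedInterval.closure_eq (h : IsBoundedInterval I) :
    closure I = Icc (center I - len I / 2) (center I + len I / 2) := by
  have := h.len_pos
  apply Subset.antisymm
  · exact closure_minimal h.subset_Icc isClosed_Icc
  · rw [← closure_Ioo (by linarith)]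
    exact closure_mono h.Ioo_subset

theorem IsBoundedInterval.measurableSet (h : IsBoundedInterval I) : MeasurableSet I := by
  obtain ⟨a, b, hab, h1, h2⟩ := h
  have : I = Ioo a b ∪ (I ∩ {a, b}) := by
    apply Subset.antisymm
    · intro x hx
      have := h2 hx
      by_cases ha : x = a
      · right; exact ⟨hx, by simp [ha]⟩
      by_cases hb : x = b
      · right; exact ⟨hx, by simp [hb]⟩
      left
      exact ⟨lt_of_le_of_ne this.1 (Ne.symm ha), lt_of_le_of_ne this.2 hb⟩
    · exact union_subset h1 inter_subset_left
  rw [this]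
  exact measurableSet_Ioo.union
    (((Set.toFinite {a, b}).subset inter_subset_right).measurableSet)

theorem IsBoundedInterval.len_le (hI : IsBoundedInterval I) (hJ : IsBoundedInterval J)
    (h : I ⊆ J) : len I ≤ len J := by
  have := measure_mono (μ := volume) h
  rwa [hI.volume_eq, hJ.volume_eq, ENNReal.ofReal_le_ofReal_iff hJ.len_pos.le] at this

/-- An interval contained in another one: the ends are contained as well. -/
theorem IsBoundedInterval.abs_center_sub_le (hI : IsBoundedInterval I) (hJ : IsBoundedInterval J)
    (h : I ⊆ J) : |center I - center J| ≤ (len J - len I) / 2 := by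
  have h0 : closure I ⊆ closure J := closure_mono h
  have hp := hI.len_pos
  rw [hI.closure_eq, hJ.closure_eq, Icc_subset_Icc_iff (by linarith)] at h0
  rw [abs_le]; constructor <;> linarith [h0.1, h0.2]

theorem IsBoundedInterval.closure_eq_closure (hI : IsBoundedInterval I) (hJ : IsBoundedInterval J)
    (h : I ⊆ J) (hl : len J ≤ len I) : closure I = closure J := by
  have h1 := hI.abs_center_sub_le hJ h
  have h2 := le_antisymm hl (hI.len_le hJ h)
  have h3 : center I = center J := by
    have : |center I - center J| ≤ 0 := by rw [h2] at h1; simpa using h1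
    linarith [abs_nonpos_iff.1 this]
  rw [hI.closure_eq, hJ.closure_eq, h3, h2]

theorem IsBoundedInterval.len_le_abs_center_sub (hI : IsBoundedInterval I)
    (hJ : IsBoundedInterval J) (hd : Disjoint I J) (hl : len I = len J) :
    len I ≤ |center I - center J| := by
  by_contra hcon
  push Not at hcon
  rw [abs_lt] at hcon
  have hp := hI.len_pos
  have h1 : (center I + center J) / 2 ∈ I :=
    hI.Ioo_subset ⟨by linarith [hcon.1, hcon.2], by linarith [hcon.1, hcon.2]⟩
  have h2 : (center I + center J) / 2 ∈ J :=
    hJ.Ioo_subset ⟨by linarith [hcon.1, hcon.2], by linarith [hcon.1, hcon.2]⟩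
  exact Set.disjoint_left.1 hd h1 h2

end Interval

/-! ### Dyadic grids -/

namespace DyadicGrid
variable (D : DyadicGrid) {I J K : Set ℝ}

theorem rho_pos : 0 < D.rho := by linarith [D.half_lt_rho]

/-- If instead `J ⊆ I`, the length condition forces equal closures, and the grid lists each interval
with only one choice of endpoints. -/
theorem subset_of_nonempty (hI : I ∈ D.intervals) (hJ : J ∈ D.intervals)
    (h : (I ∩ J).Nonempty) (hl : len I ≤ len J) : I ⊆ J := by
  rcases D.grid I hI J hJ with h' | h' | h'
  · simp [h'] at h
  · exact inter_eq_left.1 h'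
  · have hs := inter_eq_right.1 h'
    have := (D.isBoundedInterval J hJ).closure_eq_closure (D.isBoundedInterval I hI) hs hl
    rw [D.eq_of_closure_eq J hJ I hI this]

theorem eq_of_nonempty (hI : I ∈ D.intervals) (hJ : J ∈ D.intervals)
    (h : (I ∩ J).Nonempty) (hl : len I = len J) : I = J :=
  Subset.antisymm (D.subset_of_nonempty hI hJ h hl.le)
    (D.subset_of_nonempty hJ hI (by rwa [inter_comm]) hl.ge)

theorem disjoint_of_ne (hI : I ∈ D.intervals) (hJ : J ∈ D.intervals)
    (h : I ≠ J) (hl : len I = len J) : Disjoint I J := by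
  rw [Set.disjoint_iff_inter_eq_empty, ← Set.not_nonempty_iff_eq_empty]
  exact fun h' => h (D.eq_of_nonempty hI hJ h' hl)

/-- The intervals of one length cover only up to a null set, but `I` has positive measure. -/
theorem exists_nonempty_inter (hI : I ∈ D.intervals) (k : ℤ) :
    ∃ Q ∈ D.intervals, len Q = D.rho * 2 ^ k ∧ (I ∩ Q).Nonempty := by
  by_contra hcon
  push Not at hcon
  have hsub : I ⊆ (⋃₀ {I ∈ D.intervals | len I = D.rho * 2 ^ k})ᶜ := by
    rintro x hx ⟨Q, ⟨hQ, hl⟩, hxQ⟩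
    have := hcon Q hQ hl
    exact (Set.eq_empty_iff_forall_notMem.1 this) x ⟨hx, hxQ⟩
  have h0 := measure_mono_null hsub (D.covering k)
  rw [(D.isBoundedInterval I hI).volume_eq, ENNReal.ofReal_eq_zero] at h0
  linarith [(D.isBoundedInterval I hI).len_pos]

/-- Every interval of the grid has ancestors of all larger lengths. -/
theorem exists_ancestor (hI : I ∈ D.intervals) (k : ℤ) (hk : len I ≤ D.rho * 2 ^ k) :
    ∃ Q ∈ D.intervals, len Q = D.rho * 2 ^ k ∧ I ⊆ Q := by
  obtain ⟨Q, hQ, hl, hn⟩ := D.exists_nonempty_inter hI k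
  exact ⟨Q, hQ, hl, D.subset_of_nonempty hI hQ hn (by rw [hl]; exact hk)⟩

theorem parent_spec (hI : I ∈ D.intervals) :
    D.parent 1 I ∈ D.intervals ∧ len (D.parent 1 I) = 2 * len I ∧ I ⊆ D.parent 1 I := by
  obtain ⟨k, hk⟩ := D.length_mem I hI
  have hpos := (D.isBoundedInterval I hI).len_pos
  obtain ⟨Q, hQ, hl, hs⟩ := D.exists_ancestor hI (k + 1)
    (by rw [hk, zpow_add₀ (by norm_num)]; linarith)
  have hl2 : len Q = 2 * len I := by
    rw [hl, hk, zpow_add₀ (by norm_num)]; ring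
  have : D.parent 1 I = Q := by
    rw [parent]
    have : {Q ∈ D.intervals | len Q = 2 ^ 1 * len I ∧ I ⊆ Q} = {Q} := by
      ext Q'
      simp only [mem_ofPred_eq, mem_singleton_iff]
      constructor
      · rintro ⟨hQ', hl', hs'⟩
        obtain ⟨x, hx⟩ := (D.isBoundedInterval I hI).nonempty
        exact D.eq_of_nonempty hQ' hQ ⟨x, hs' hx, hs hx⟩ (by rw [hl', hl2]; ring)
      · rintro rfl
        exact ⟨hQ, by rw [hl2]; ring, hs⟩
    rw [this, sUnion_singleton]
  rw [this]
  exact ⟨hQ, hl2, hs⟩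

theorem parent_mem (hI : I ∈ D.intervals) : D.parent 1 I ∈ D.intervals := (D.parent_spec hI).1
theorem len_parent (hI : I ∈ D.intervals) : len (D.parent 1 I) = 2 * len I := (D.parent_spec hI).2.1
theorem subset_parent (hI : I ∈ D.intervals) : I ⊆ D.parent 1 I := (D.parent_spec hI).2.2

/-- At most two intervals of half the length fit into an interval. -/
theorem eq_or_eq_of_subset {Q A B E : Set ℝ} (hQ : Q ∈ D.intervals) (hA : A ∈ D.intervals)
    (hB : B ∈ D.intervals) (hE : E ∈ D.intervals) (hAQ : A ⊆ Q) (hBQ : B ⊆ Q) (hEQ : E ⊆ Q)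
    (lA : len Q = 2 * len A) (lB : len Q = 2 * len B) (lE : len Q = 2 * len E) (hAB : A ≠ B) :
    E = A ∨ E = B := by
  by_contra hcon
  push Not at hcon
  have d1 := D.disjoint_of_ne hA hB hAB (by linarith)
  have d2 := D.disjoint_of_ne hE hA hcon.1 (by linarith)
  have d3 := D.disjoint_of_ne hE hB hcon.2 (by linarith)
  have iA := D.isBoundedInterval A hA
  have iB := D.isBoundedInterval B hB
  have iE := D.isBoundedInterval E hE
  have iQ := D.isBoundedInterval Q hQ
  have hv : volume (E ∪ (A ∪ B)) ≤ volume Q :=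
    measure_mono (union_subset hEQ (union_subset hAQ hBQ))
  rw [measure_union (disjoint_union_right.2 ⟨d2, d3⟩) (iA.measurableSet.union iB.measurableSet),
    measure_union d1 iB.measurableSet, iA.volume_eq, iB.volume_eq, iE.volume_eq, iQ.volume_eq,
    ← ENNReal.ofReal_add iA.len_pos.le iB.len_pos.le,
    ← ENNReal.ofReal_add iE.len_pos.le (add_pos iA.len_pos iB.len_pos).le,
    ENNReal.ofReal_le_ofReal_iff iQ.len_pos.le] at hv
  linarith [iA.len_pos]

theorem mem_sibling_iff {x : ℝ} : x ∈ D.sibling I ↔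
    ∃ J ∈ D.intervals, J ≠ I ∧ len J = len I ∧ J ⊆ D.parent 1 I ∧ x ∈ J := by
  constructor
  · rintro ⟨J, ⟨h1, h2, h3, h4⟩, h5⟩
    exact ⟨J, h1, h2, h3, h4, h5⟩
  · rintro ⟨J, h1, h2, h3, h4, h5⟩
    exact ⟨J, ⟨h1, h2, h3, h4⟩, h5⟩

theorem sibling_subset_parent : D.sibling I ⊆ D.parent 1 I := by
  intro x hx
  obtain ⟨J, -, -, -, h, hx⟩ := D.mem_sibling_iff.1 hx
  exact h hx

theorem disjoint_sibling (hI : I ∈ D.intervals) : Disjoint I (D.sibling I) := by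
  rw [Set.disjoint_left]
  intro x hx hx'
  obtain ⟨J, hJ, hne, hl, -, hx'⟩ := D.mem_sibling_iff.1 hx'
  exact hne (D.eq_of_nonempty hJ hI ⟨x, hx', hx⟩ hl)

theorem sibling_eq (hI : I ∈ D.intervals) (hJ : J ∈ D.intervals) (hne : J ≠ I)
    (hl : len J = len I) (hs : J ⊆ D.parent 1 I) : D.sibling I = J := by
  ext x
  rw [D.mem_sibling_iff]
  constructor
  · rintro ⟨K, hK, hne', hl', hs', hx⟩
    have h2 := D.len_parent hI
    rcases D.eq_or_eq_of_subset (D.parent_mem hI) hI hJ hK (D.subset_parent hI) hs hs' h2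
      (by rw [hl, h2]) (by rw [hl', h2]) hne.symm with h | h
    · exact absurd h hne'
    · rwa [← h]
  · intro hx
    exact ⟨J, hJ, hne, hl, hs, hx⟩

theorem measurableSet_sibling (hI : I ∈ D.intervals) : MeasurableSet (D.sibling I) := by
  rcases (D.sibling I).eq_empty_or_nonempty with h | ⟨x, hx⟩
  · rw [h]; exact MeasurableSet.empty
  · obtain ⟨J, hJ, hne, hl, hs, -⟩ := D.mem_sibling_iff.1 hx
    rw [D.sibling_eq hI hJ hne hl hs]
    exact (D.isBoundedInterval J hJ).measurableSet

/-- Lengths lie in `ρ 2^ℤ`, so an inequality that loses less than a factor two costs nothing. -/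
theorem len_le_of_lt_two_mul (hI : I ∈ D.intervals) (hJ : J ∈ D.intervals)
    (h : len I < 2 * len J) : len I ≤ len J := by
  obtain ⟨m, hm⟩ := D.length_mem I hI
  obtain ⟨n, hn⟩ := D.length_mem J hJ
  have hr := D.rho_pos
  rw [hm, hn] at h
  rw [hm, hn]
  have h1 : (2 : ℝ) ^ m < 2 ^ (n + 1) := by
    rw [zpow_add₀ (by norm_num)]
    have : D.rho * 2 ^ m < D.rho * (2 ^ n * 2 ^ (1 : ℤ)) := by rw [zpow_one]; linarith
    exact lt_of_mul_lt_mul_left this hr.le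
  have h2 : m < n + 1 := (zpow_lt_zpow_iff_right₀ (by norm_num)).1 h1
  gcongr
  · norm_num
  · omega

/-- If the parent of `I` contains `ξ` and `I'` is shorter than `I`, and its parent also contains
`ξ`, then that parent lies in `I` or in the sibling of `I`. -/
theorem parent_subset_sibling {I I' : Set ℝ} {ξ : ℝ} (hI : I ∈ D.intervals)
    (hI' : I' ∈ D.intervals) (hξ : ξ ∈ D.parent 1 I) (hξ' : ξ ∈ D.parent 1 I')
    (hn : ξ ∉ I) (hl : len I' < len I) : D.parent 1 I' ⊆ D.sibling I := by
  have p := D.parent_spec hI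
  have p' := D.parent_spec hI'
  have hlen : len (D.parent 1 I') ≤ len I := by
    by_contra hcon
    push Not at hcon
    rw [p'.2.1] at hcon
    linarith [D.len_le_of_lt_two_mul hI hI' hcon]
  have hQQ : D.parent 1 I' ⊆ D.parent 1 I :=
    D.subset_of_nonempty p'.1 p.1 ⟨ξ, hξ', hξ⟩ (by rw [p.2.1, p'.2.1]; linarith)
  -- Meeting `I` would put the whole parent of `I'`, hence `ξ`, inside `I`. So its ancestor of
  -- length `len I` is the other half of the parent of `I`.
  have hdisj : ¬ (D.parent 1 I' ∩ I).Nonempty := fun h =>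
    hn (D.subset_of_nonempty p'.1 hI h hlen hξ')
  obtain ⟨k, hk⟩ := D.length_mem I hI
  obtain ⟨J, hJ, hJl, hJs⟩ := D.exists_ancestor p'.1 k (by rw [← hk]; exact hlen)
  obtain ⟨x, hx⟩ := (D.isBoundedInterval _ p'.1).nonempty
  have hJQ : J ⊆ D.parent 1 I :=
    D.subset_of_nonempty hJ p.1 ⟨x, hJs hx, hQQ hx⟩
      (by rw [p.2.1, hJl, ← hk]; linarith [(D.isBoundedInterval _ hI).len_pos])
  have hne : J ≠ I := by
    rintro rfl
    exact hdisj ⟨x, hx, hJs hx⟩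
  exact fun y hy => D.mem_sibling_iff.2 ⟨J, hJ, hne, by rw [hJl, hk], hJQ, hJs hy⟩

/-- Overlapping counterpart of `parent_subset_sibling`: both intervals contain `ξ`, and the parent
of the strictly shorter one is still no longer than `I`. -/
theorem parent_subset_of_mem {I I' : Set ℝ} {ξ : ℝ} (hI : I ∈ D.intervals)
    (hI' : I' ∈ D.intervals) (hξ : ξ ∈ I) (hξ' : ξ ∈ D.parent 1 I')
    (hl : len I' < len I) : D.parent 1 I' ⊆ I := by
  have p' := D.parent_spec hI'
  apply D.subset_of_nonempty p'.1 hI ⟨ξ, hξ', hξ⟩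
  by_contra hcon
  push Not at hcon
  rw [p'.2.1] at hcon
  linarith [D.len_le_of_lt_two_mul hI hI' hcon]

end DyadicGrid

/-! ### Polynomially decaying weights -/

/-- The bracket `1 + |x - c| / ℓ`. -/
noncomputable def bracket (c l x : ℝ) : ℝ := 1 + |x - c| / l

/-- The weight `(1 + |x - c| / ℓ) ^ (-n)`. -/
noncomputable def wt (c l : ℝ) (n : ℕ) (x : ℝ) : ℝ≥0∞ := ENNReal.ofReal ((bracket c l x ^ n)⁻¹)

section Weights
variable {c l x : ℝ}

theorem one_le_bracket (hl : 0 < l) : 1 ≤ bracket c l x := by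
  have : 0 ≤ |x - c| / l := by positivity
  rw [bracket]; linarith

theorem bracket_pos (hl : 0 < l) : 0 < bracket c l x := by linarith [one_le_bracket (c := c) (x := x) hl]

theorem mul_bracket (hl : 0 < l) : l * bracket c l x = l + |x - c| := by
  rw [bracket]; field_simp

@[fun_prop]
theorem continuous_bracket : Continuous (bracket c l) := by
  unfold bracket; fun_prop

@[fun_prop]
theorem measurable_wt {n : ℕ} : Measurable (wt c l n) := by
  unfold wt
  exact (((continuous_bracket.measurable).pow_const n).inv).ennreal_ofReal

theorem wt_le_mul {c' l' y K : ℝ} (hl : 0 < l) (hl' : 0 < l') (hK : 0 ≤ K) (n : ℕ)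
    (h : bracket c' l' y ≤ K * bracket c l x) :
    wt c l n x ≤ ENNReal.ofReal (K ^ n) * wt c' l' n y := by
  have h1 := bracket_pos (c := c) (x := x) hl
  have h2 := bracket_pos (c := c') (x := y) hl'
  rw [wt, wt, ← ENNReal.ofReal_mul (by positivity)]
  apply ENNReal.ofReal_le_ofReal
  have h3 : bracket c' l' y ^ n ≤ K ^ n * bracket c l x ^ n := by
    rw [← mul_pow]; exact pow_le_pow_left₀ h2.le h n
  rw [inv_le_iff_one_le_mul₀ (by positivity)]
  have : (1 : ℝ) = (bracket c' l' y ^ n)⁻¹ * bracket c' l' y ^ n := by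
    field_simp
  rw [this]
  calc _ ≤ (bracket c' l' y ^ n)⁻¹ * (K ^ n * bracket c l x ^ n) := by gcongr
    _ = _ := by ring

theorem wt_anti (hl : 0 < l) {m n : ℕ} (h : m ≤ n) : wt c l n x ≤ wt c l m x := by
  apply ENNReal.ofReal_le_ofReal
  have := bracket_pos (c := c) (x := x) hl
  gcongr
  exact one_le_bracket hl

theorem wt_le_one (hl : 0 < l) {n : ℕ} : wt c l n x ≤ 1 := by
  have := wt_anti (c := c) (x := x) hl (Nat.zero_le n)
  simpa [wt] using this

theorem wt_add (hl : 0 < l) (m n : ℕ) : wt c l (m + n) x = wt c l m x * wt c l n x := by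
  have := bracket_pos (c := c) (x := x) hl
  rw [wt, wt, wt, ← ENNReal.ofReal_mul (by positivity), pow_add, mul_inv]

theorem wt_ne_top {n : ℕ} : wt c l n x ≠ ∞ := ENNReal.ofReal_ne_top

/-- Since `(1 + r)² ≥ 1 + r²` for `r ≥ 0`, the integral is at most `π l`. -/
theorem lintegral_wt_two (hl : 0 < l) : ∫⁻ x, wt c l 2 x ≤ ENNReal.ofReal (4 * l) := by
  have hint : Integrable (fun x : ℝ => (1 + ((x - c) / l) ^ 2)⁻¹) := by
    have h1 := (integrable_inv_one_add_sq).comp_div hl.ne'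
    exact h1.comp_sub_right c
  have hval : ∫ x : ℝ, (1 + ((x - c) / l) ^ 2)⁻¹ = l * Real.pi := by
    rw [integral_sub_right_eq_self (fun x : ℝ => (1 + (x / l) ^ 2)⁻¹) c,
      Measure.integral_comp_div (fun x : ℝ => (1 + x ^ 2)⁻¹) l, integral_univ_inv_one_add_sq,
      abs_of_pos hl, smul_eq_mul]
  calc ∫⁻ x, wt c l 2 x ≤ ∫⁻ x, ENNReal.ofReal ((1 + ((x - c) / l) ^ 2)⁻¹) := by
        apply lintegral_mono
        intro x
        apply ENNReal.ofReal_le_ofReal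
        apply inv_anti₀ (by positivity)
        rw [bracket]
        have h0 : 0 ≤ |x - c| / l := by positivity
        have : ((x - c) / l) ^ 2 = (|x - c| / l) ^ 2 := by
          rw [div_pow, div_pow, sq_abs]
        rw [this]; nlinarith
    _ = ENNReal.ofReal (l * Real.pi) := by
        rw [← ofReal_integral_eq_lintegral_ofReal hint, hval]
        exact Filter.Eventually.of_forall fun x => by positivity
    _ ≤ _ := by
        apply ENNReal.ofReal_le_ofReal
        nlinarith [Real.pi_le_four]

theorem lintegral_wt (hl : 0 < l) {n : ℕ} (hn : 2 ≤ n) :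
    ∫⁻ x, wt c l n x ≤ ENNReal.ofReal (4 * l) :=
  (lintegral_mono fun _ => wt_anti hl hn).trans (lintegral_wt_two hl)

end Weights

/-! ### Sums of weights -/

/-- The weight is symmetric in center and point. Each term is at most `9/4` times an average of the
weight centered at `x` over the interval of length `t` around `c i`. Separation makes these
intervals disjoint, and the whole weight has integral at most `4 t`. -/
theorem sum_wt_le {ι : Type*} (s : Finset ι) (c : ι → ℝ) {t : ℝ} (ht : 0 < t)
    (hsep : ∀ i ∈ s, ∀ j ∈ s, i ≠ j → t ≤ |c i - c j|) (x : ℝ) :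
    ∑ i ∈ s, wt (c i) t 2 x ≤ 9 := by
  have hpt : ∀ i ∈ s, wt (c i) t 2 x ≤ ENNReal.ofReal (9 / 4 / t) *
      ∫⁻ y in Ioo (c i - t / 2) (c i + t / 2), wt x t 2 y := by
    intro i _
    have h1 : ∀ y ∈ Ioo (c i - t / 2) (c i + t / 2), wt (c i) t 2 x * ENNReal.ofReal (4 / 9)
        ≤ wt x t 2 y := by
      intro y hy
      have hb : bracket x t y ≤ 3 / 2 * bracket (c i) t x := by
        have hy' : |y - c i| ≤ t / 2 := by
          rw [abs_le]; constructor <;> linarith [hy.1, hy.2]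
        have : |y - x| ≤ |x - c i| + t / 2 := by
          calc |y - x| = |(y - c i) - (x - c i)| := by ring_nf
            _ ≤ |y - c i| + |x - c i| := abs_sub _ _
            _ ≤ _ := by linarith
        have h3 : |y - x| / t ≤ |x - c i| / t + 1 / 2 := by
          rw [div_le_iff₀ ht]
          calc _ ≤ _ := this
            _ = _ := by field_simp
        have : 0 ≤ |x - c i| / t := by positivity
        rw [bracket, bracket]; linarith
      have := wt_le_mul (c := c i) (x := x) ht ht (by norm_num) 2 hb
      calc _ ≤ (ENNReal.ofReal ((3 / 2) ^ 2) * wt x t 2 y) * ENNReal.ofReal (4 / 9) := by gcongr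
        _ = (ENNReal.ofReal ((3 / 2) ^ 2) * ENNReal.ofReal (4 / 9)) * wt x t 2 y := by ring
        _ = wt x t 2 y := by
          rw [← ENNReal.ofReal_mul (by positivity)]; norm_num
    calc wt (c i) t 2 x = ENNReal.ofReal (9 / 4 / t) *
          ∫⁻ y in Ioo (c i - t / 2) (c i + t / 2), wt (c i) t 2 x * ENNReal.ofReal (4 / 9) := by
          rw [setLIntegral_const, Real.volume_Ioo, mul_assoc, mul_left_comm,
            ← ENNReal.ofReal_mul (by norm_num), ← ENNReal.ofReal_mul (by positivity)]
          have : 9 / 4 / t * (4 / 9 * (c i + t / 2 - (c i - t / 2))) = 1 := by field_simp; ring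
          rw [this]; simp
      _ ≤ _ := by
          gcongr 1
          exact setLIntegral_mono measurable_wt h1
  calc ∑ i ∈ s, wt (c i) t 2 x ≤ ∑ i ∈ s, ENNReal.ofReal (9 / 4 / t) *
      ∫⁻ y in Ioo (c i - t / 2) (c i + t / 2), wt x t 2 y := Finset.sum_le_sum hpt
    _ = ENNReal.ofReal (9 / 4 / t) *
        ∫⁻ y in ⋃ i ∈ s, Ioo (c i - t / 2) (c i + t / 2), wt x t 2 y := by
        rw [← Finset.mul_sum, lintegral_biUnion_finset]
        · intro i hi j hj hij
          rw [Function.onFun, Set.disjoint_left]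
          intro y hy hy'
          have h := hsep i hi j hj hij
          rw [le_abs] at h
          rcases h with h | h <;> linarith [hy.1, hy.2, hy'.1, hy'.2]
        · exact fun i _ => measurableSet_Ioo
    _ ≤ ENNReal.ofReal (9 / 4 / t) * ENNReal.ofReal (4 * t) := by
        gcongr
        exact (setLIntegral_le_lintegral _ _).trans (lintegral_wt_two ht)
    _ = 9 := by
        rw [← ENNReal.ofReal_mul (by positivity)]
        have : 9 / 4 / t * (4 * t) = 9 := by field_simp
        rw [this]; norm_num

theorem sum_half_pow_natAbs_le (F : Finset ℤ) (m : ℤ) :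
    ∑ k ∈ F, ((1 / 2 : ℝ) ^ (k + m).natAbs) ≤ 4 := by
  have aux : ∀ G : Finset ℤ, Set.InjOn (fun k : ℤ => (k + m).natAbs) G →
      ∑ k ∈ G, ((1 / 2 : ℝ) ^ (k + m).natAbs) ≤ 2 := by
    intro G hG
    rw [← Finset.sum_image (f := fun n : ℕ => (1 / 2 : ℝ) ^ n) hG]
    exact (summable_geometric_two.sum_le_tsum _ fun _ _ => by positivity).trans
      tsum_geometric_two.le
  rw [← Finset.sum_filter_add_sum_filter_not F (fun k => 0 ≤ k + m)]
  have h1 := aux (F.filter (fun k => 0 ≤ k + m)) (by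
    intro a ha b hb hab
    simp only [Finset.coe_filter, mem_ofPred_eq] at ha hb hab
    omega)
  have h2 := aux (F.filter (fun k => ¬ 0 ≤ k + m)) (by
    intro a ha b hb hab
    simp only [Finset.coe_filter, mem_ofPred_eq] at ha hb hab
    omega)
  linarith

/-- With `2^m ≤ a < 2^(m+1)`, each term is at most `2 · 2^{-|k+m|}`: a two-sided geometric series.
-/
theorem sum_min_zpow_le (F : Finset ℤ) {a : ℝ} (ha : 0 < a) :
    ∑ k ∈ F, min (a * 2 ^ k) (a * 2 ^ k)⁻¹ ≤ 8 := by
  obtain ⟨m, hm1, hm2⟩ := exists_mem_Ico_zpow ha (one_lt_two (α := ℝ))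
  calc ∑ k ∈ F, min (a * 2 ^ k) (a * 2 ^ k)⁻¹ ≤ ∑ k ∈ F, 2 * (1 / 2 : ℝ) ^ (k + m).natAbs := by
        apply Finset.sum_le_sum
        intro k _
        rcases le_or_gt 0 (k + m) with h | h
        · apply (min_le_right _ _).trans
          have : ((1 / 2 : ℝ) ^ (k + m).natAbs) = (2 ^ (k + m))⁻¹ := by
            obtain ⟨n, hn⟩ := Int.eq_ofNat_of_zero_le h
            rw [hn]; simp
          rw [this]
          have h2 : (2 : ℝ) ^ (k + m) ≤ a * 2 ^ k := by
            rw [zpow_add₀ (by norm_num), mul_comm]; gcongr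
          have h3 : (0 : ℝ) < 2 ^ (k + m) := by positivity
          have := inv_anti₀ h3 h2
          have h4 : (0 : ℝ) < (2 ^ (k + m))⁻¹ := by positivity
          linarith
        · apply (min_le_left _ _).trans
          have : ((1 / 2 : ℝ) ^ (k + m).natAbs) = 2 ^ (k + m) := by
            obtain ⟨n, hn⟩ := Int.eq_ofNat_of_zero_le (a := -(k + m)) (by omega)
            have h5 : k + m = - (n : ℤ) := by omega
            rw [h5]; simp
          rw [this]
          calc a * 2 ^ k ≤ 2 ^ (m + 1) * 2 ^ k := by gcongr
            _ = 2 * 2 ^ (k + m) := by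
              rw [zpow_add₀ (by norm_num), zpow_add₀ (by norm_num), zpow_one]; ring
    _ ≤ 8 := by
        rw [← Finset.mul_sum]
        linarith [sum_half_pow_natAbs_le F m]

/-- Weights of a separated family of dyadic scales, damped away from one scale, sum up. -/
theorem sum_min_mul_wt_le {ι : Type*} (s : Finset ι) (c l : ι → ℝ) {ρ : ℝ} (hρ : 0 < ρ)
    (hl : ∀ i ∈ s, ∃ k : ℤ, l i = ρ * 2 ^ k)
    (hsep : ∀ i ∈ s, ∀ j ∈ s, i ≠ j → l i = l j → l i ≤ |c i - c j|) {r : ℝ} (hr : 0 < r)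
    (x : ℝ) :
    ∑ i ∈ s, ENNReal.ofReal (min (r * l i) (r * l i)⁻¹) * wt (c i) (l i) 2 x ≤ 72 := by
  classical
  choose! k hk using hl
  rw [← Finset.sum_fiberwise_of_maps_to (g := k) (t := s.image k)
    (fun i hi => Finset.mem_image_of_mem k hi)]
  calc _ ≤ ∑ m ∈ s.image k, ENNReal.ofReal (min (r * ρ * 2 ^ m) (r * ρ * 2 ^ m)⁻¹) * 9 := by
        apply Finset.sum_le_sum
        intro m _
        have : ∀ i ∈ s.filter (fun i => k i = m),
            ENNReal.ofReal (min (r * l i) (r * l i)⁻¹) * wt (c i) (l i) 2 x =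
            ENNReal.ofReal (min (r * ρ * 2 ^ m) (r * ρ * 2 ^ m)⁻¹) * wt (c i) (ρ * 2 ^ m) 2 x := by
          intro i hi
          rw [Finset.mem_filter] at hi
          rw [hk i hi.1, hi.2, mul_assoc r]
        rw [Finset.sum_congr rfl this, ← Finset.mul_sum]
        gcongr
        apply sum_wt_le _ _ (by positivity)
        intro i hi j hj hij
        rw [Finset.mem_filter] at hi hj
        have h := hsep i hi.1 j hj.1 hij (by rw [hk i hi.1, hk j hj.1, hi.2, hj.2])
        rwa [hk i hi.1, hi.2] at h
    _ ≤ ENNReal.ofReal 8 * 9 := by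
        rw [← Finset.sum_mul, ← ENNReal.ofReal_sum_of_nonneg (fun i _ => by positivity)]
        gcongr
        exact sum_min_zpow_le _ (by positivity)
    _ = 72 := by norm_num

/-! ### Averaging at a variable scale -/

/-- A function with Lipschitz constant one is essentially constant on a ball whose radius is a
quarter of its own value at the center. -/
theorem ofReal_Lip_pos_bounds {d : ℝ → ℝ} (hLip : ∀ x y, d x ≤ d y + |x - y|) {x y : ℝ}
    (h : |y - x| ≤ d x / 4) : d x ≤ 4 / 3 * d y ∧ 4 / 5 * d y ≤ d x := by
  have h1 := hLip x y
  have h2 := hLip y x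
  rw [abs_sub_comm] at h1
  constructor <;> linarith

/-- If a weight is essentially constant at the scale `d x`, then only the averages of `H` at this
scale enter into `∫ H W`. -/
theorem lintegral_mul_le_of_average {d : ℝ → ℝ} (hd : ∀ x, 0 < d x)
    (hLip : ∀ x y, d x ≤ d y + |x - y|) {H W : ℝ → ℝ≥0∞} (hH : Measurable H) (hW : Measurable W)
    {K : ℝ≥0} (hWK : ∀ x y, |y - x| ≤ d x / 4 → W x ≤ K * W y)
    {A : ℝ → ℝ≥0∞}
    (hA : ∀ y, ∫⁻ x in Icc (y - d y / 2) (y + d y / 2), H x ≤ A y * ENNReal.ofReal (d y)) :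
    ∫⁻ x, H x * W x ≤ 3 * K * ∫⁻ y, A y * W y := by
  have hdm : Measurable d := by
    have : LipschitzWith 1 d := LipschitzWith.of_le_add fun x y => by
      rw [Real.dist_eq]; exact hLip x y
    exact this.continuous.measurable
  set S : Set (ℝ × ℝ) := {p | |p.2 - p.1| ≤ d p.1 / 4} with hS
  have hSm : MeasurableSet S := by
    apply measurableSet_le
    · exact (measurable_snd.sub measurable_fst).abs
    · exact (hdm.comp measurable_fst).div_const 4
  -- A kernel of mass one in `y`. Inserting it, moving `W` from `x` to `y` and exchanging the
  -- integrals produces the averages of `H` at scale `d y`. There `2 / d x ≤ (5/2) / d y`, and `5/2`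
  -- is rounded up to `3`.
  set κ : ℝ → ℝ → ℝ≥0∞ := fun x y => S.indicator (fun p => ENNReal.ofReal (2 / d p.1)) (x, y)
    with hκ
  have hκm : Measurable (fun p : ℝ × ℝ => κ p.1 p.2) := by
    apply Measurable.indicator _ hSm
    exact ((measurable_const.div (hdm.comp measurable_fst))).ennreal_ofReal
  have hκ1 : ∀ x, ∫⁻ y, κ x y = 1 := by
    intro x
    have : ∀ y, κ x y = (Icc (x - d x / 4) (x + d x / 4)).indicator
        (fun _ => ENNReal.ofReal (2 / d x)) y := by
      intro y
      simp only [hκ, hS, Set.indicator_apply, mem_ofPred_eq, mem_Icc, abs_le]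
      congr 1
      apply propext
      constructor <;> rintro ⟨h1, h2⟩ <;> constructor <;> linarith
    simp_rw [this]
    rw [lintegral_indicator measurableSet_Icc, setLIntegral_const, Real.volume_Icc,
      ← ENNReal.ofReal_mul (by have := hd x; positivity)]
    have h2 : 2 / d x * (x + d x / 4 - (x - d x / 4)) = 1 := by
      have := (hd x).ne'
      field_simp; ring
    rw [h2]; simp
  calc ∫⁻ x, H x * W x = ∫⁻ x, ∫⁻ y, H x * W x * κ x y := by
        congr 1 with x
        have hm : Measurable (κ x) := hκm.comp (measurable_const.prodMk measurable_id)
        rw [lintegral_const_mul _ hm, hκ1, mul_one]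
    _ ≤ ∫⁻ x, ∫⁻ y, H x * (K * W y) * κ x y := by
        apply lintegral_mono; intro x; apply lintegral_mono; intro y
        by_cases h : |y - x| ≤ d x / 4
        · dsimp only
          gcongr
          exact hWK x y h
        · have : κ x y = 0 := by
            simp [hκ, hS, h]
          simp [this]
    _ = ∫⁻ y, ∫⁻ x, H x * (K * W y) * κ x y := by
        apply lintegral_lintegral_swap
        apply Measurable.aemeasurable
        exact ((hH.comp measurable_fst).mul ((hW.comp measurable_snd).const_mul K)).mul hκm
    _ ≤ ∫⁻ y, 3 * K * (A y * W y) := by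
        apply lintegral_mono; intro y
        have hle : ∀ x, H x * (K * W y) * κ x y ≤ (K * W y * ENNReal.ofReal (5 / 2 / d y)) *
            (Icc (y - d y / 2) (y + d y / 2)).indicator H x := by
          intro x
          by_cases h : |y - x| ≤ d x / 4
          · have hb := ofReal_Lip_pos_bounds hLip h
            have hx : x ∈ Icc (y - d y / 2) (y + d y / 2) := by
              rw [abs_le] at h
              constructor <;> linarith [hd y]
            have hk : κ x y ≤ ENNReal.ofReal (5 / 2 / d y) := by
              have hm : (x, y) ∈ S := h
              simp only [hκ, Set.indicator_of_mem hm]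
              apply ENNReal.ofReal_le_ofReal
              rw [div_le_div_iff₀ (hd x) (hd y)]
              linarith
            rw [Set.indicator_of_mem hx]
            calc _ ≤ H x * (K * W y) * ENNReal.ofReal (5 / 2 / d y) := by gcongr
              _ = _ := by ring
          · have : κ x y = 0 := by
              simp [hκ, hS, h]
            simp [this]
        calc _ ≤ ∫⁻ x, (K * W y * ENNReal.ofReal (5 / 2 / d y)) *
            (Icc (y - d y / 2) (y + d y / 2)).indicator H x := lintegral_mono hle
          _ = (K * W y * ENNReal.ofReal (5 / 2 / d y)) *
              ∫⁻ x in Icc (y - d y / 2) (y + d y / 2), H x := by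
              rw [lintegral_const_mul _ (hH.indicator measurableSet_Icc),
                lintegral_indicator measurableSet_Icc]
          _ ≤ (K * W y * ENNReal.ofReal (5 / 2 / d y)) * (A y * ENNReal.ofReal (d y)) := by
              gcongr; exact hA y
          _ = (ENNReal.ofReal (5 / 2 / d y) * ENNReal.ofReal (d y)) * (K * (A y * W y)) := by ring
          _ ≤ 3 * (K * (A y * W y)) := by
              gcongr
              rw [← ENNReal.ofReal_mul (by have := hd y; positivity)]
              have := (hd y).ne'
              have h2 : 5 / 2 / d y * d y = 5 / 2 := by field_simp
              rw [h2]
              calc ENNReal.ofReal (5 / 2) ≤ ENNReal.ofReal 3 :=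
                    ENNReal.ofReal_le_ofReal (by norm_num)
                _ = 3 := by norm_num
          _ = _ := by ring
    _ ≤ _ := by
        rw [lintegral_const_mul' _ _ (ENNReal.mul_ne_top (by norm_num) ENNReal.coe_ne_top)]

/-! ### One-sided exponential averages -/

/-- The exponential average `t⁻¹ ∫_{y < x} e^{-(x - y) / t} g(y) dy` of a function that vanishes on
the left of `a`. -/
noncomputable def expAvg (a t : ℝ) (g : ℝ → ℝ) (x : ℝ) : ℝ :=
  t⁻¹ * Real.exp (-(x / t)) * ∫ y in a..x, Real.exp (y / t) * g y

/-- Bounded, integrable, continuous nonnegative functions vanishing on the left of `a`. -/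
structure Admissible (a : ℝ) (g : ℝ → ℝ) : Prop where
  cont : Continuous g
  nonneg : ∀ x, 0 ≤ g x
  zero : ∀ x ≤ a, g x = 0
  integrable : Integrable g
  bdd : ∃ B, ∀ x, g x ≤ B

section ExpAvg
variable {a t : ℝ} {g h : ℝ → ℝ}

/-- The average `u` solves `t u' + u = g`. All identities below follow from this equation. -/
theorem hasDerivAt_expAvg (ht : 0 < t) (hg : Continuous g) (x : ℝ) :
    HasDerivAt (expAvg a t g) ((g x - expAvg a t g x) / t) x := by
  have hc : Continuous fun y => Real.exp (y / t) * g y := by fun_prop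
  have h1 : HasDerivAt (fun x => ∫ y in a..x, Real.exp (y / t) * g y)
      (Real.exp (x / t) * g x) x :=
    intervalIntegral.integral_hasDerivAt_right (hc.intervalIntegrable _ _)
      (hc.stronglyMeasurableAtFilter _ _) hc.continuousAt
  have h2 : HasDerivAt (fun x => t⁻¹ * Real.exp (-(x / t)))
      (t⁻¹ * (Real.exp (-(x / t)) * (-(1 / t)))) x :=
    ((((hasDerivAt_id x).div_const t).neg).exp).const_mul _
  refine (h2.mul h1).congr_deriv ?_
  rw [expAvg, Real.exp_neg]
  have := (Real.exp_pos (x / t)).ne'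
  field_simp
  ring

theorem continuous_expAvg (ht : 0 < t) (hg : Continuous g) : Continuous (expAvg a t g) :=
  continuous_iff_continuousAt.2 fun x => (hasDerivAt_expAvg ht hg x).continuousAt

theorem expAvg_of_le (hz : ∀ x ≤ a, g x = 0) {x : ℝ} (hx : x ≤ a) : expAvg a t g x = 0 := by
  rw [expAvg]
  have : ∫ y in a..x, Real.exp (y / t) * g y = ∫ y in a..x, (0 : ℝ) := by
    apply intervalIntegral.integral_congr
    intro y hy
    rw [uIcc_of_ge hx] at hy
    simp [hz y hy.2]
  rw [this]; simp

/-- The kernel is positive. This order preservation lets the energies telescope when the function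
changes with the scale. -/
theorem expAvg_mono (ht : 0 < t) (hg : Admissible a g) (hh : Admissible a h)
    (hgh : ∀ x, g x ≤ h x) (x : ℝ) : expAvg a t g x ≤ expAvg a t h x := by
  rcases le_total x a with hx | hx
  · rw [expAvg_of_le hg.zero hx, expAvg_of_le hh.zero hx]
  · have hcg := hg.cont
    have hch := hh.cont
    rw [expAvg, expAvg]
    gcongr
    apply intervalIntegral.integral_mono_on hx
    · exact Continuous.intervalIntegrable (by fun_prop) _ _
    · exact Continuous.intervalIntegrable (by fun_prop) _ _
    · intro y _
      gcongr
      exact hgh y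

theorem expAvg_nonneg (ht : 0 < t) (hg : Admissible a g) (x : ℝ) : 0 ≤ expAvg a t g x := by
  rcases le_total x a with hx | hx
  · rw [expAvg_of_le hg.zero hx]
  · rw [expAvg]
    apply mul_nonneg (by positivity)
    apply intervalIntegral.integral_nonneg hx
    intro y _
    exact mul_nonneg (Real.exp_pos _).le (hg.nonneg y)

theorem expAvg_le (ht : 0 < t) (hg : Admissible a g) {B : ℝ} (hB : ∀ x, g x ≤ B) (x : ℝ) :
    expAvg a t g x ≤ B := by
  have hB0 : 0 ≤ B := (hg.nonneg 0).trans (hB 0)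
  rcases le_total x a with hx | hx
  · rw [expAvg_of_le hg.zero hx]; exact hB0
  · have hc := hg.cont
    have h1 : ∫ y in a..x, Real.exp (y / t) * g y ≤ ∫ y in a..x, Real.exp (y / t) * B := by
      apply intervalIntegral.integral_mono_on hx
      · exact Continuous.intervalIntegrable (by fun_prop) _ _
      · exact Continuous.intervalIntegrable (by fun_prop) _ _
      · intro y _
        gcongr
        exact hB y
    have h2 : ∫ y in a..x, Real.exp (y / t) * B =
        t * Real.exp (x / t) * B - t * Real.exp (a / t) * B := by
      apply intervalIntegral.integral_eq_sub_of_hasDerivAt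
        (f := fun y => t * Real.exp (y / t) * B)
      · intro y _
        have := ((((hasDerivAt_id y).div_const t).exp).const_mul t).mul_const B
        refine this.congr_deriv ?_
        simp only [id]
        field_simp
      · exact Continuous.intervalIntegrable (by fun_prop) _ _
    have h3 : ∫ y in a..x, Real.exp (y / t) * g y ≤ t * Real.exp (x / t) * B := by
      have : 0 ≤ t * Real.exp (a / t) * B := by positivity
      linarith
    rw [expAvg]
    calc _ ≤ t⁻¹ * Real.exp (-(x / t)) * (t * Real.exp (x / t) * B) := by gcongr
      _ = B := by
        rw [Real.exp_neg]
        have := (Real.exp_pos (x / t)).ne'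
        field_simp

/-- Integrating `t u' = g - u` over `[a, X]` gives `∫ u = ∫ g - t u(X)` there, which is at most `∫
g` over the line. -/
theorem integrable_expAvg (ht : 0 < t) (hg : Admissible a g) : Integrable (expAvg a t g) := by
  have hc := continuous_expAvg (a := a) ht hg.cont
  have hIoi : IntegrableOn (expAvg a t g) (Ioi a) := by
    apply integrableOn_Ioi_of_intervalIntegral_norm_bounded (∫ x, g x) a
      (l := Filter.atTop) (b := id) (fun i => hc.integrableOn_Ioc) Filter.tendsto_id
    filter_upwards [Filter.eventually_ge_atTop a] with X hX
    simp only [id]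
    have h1 : ∫ x in a..X, (g x - expAvg a t g x) / t = expAvg a t g X - expAvg a t g a := by
      apply intervalIntegral.integral_eq_sub_of_hasDerivAt
      · exact fun x _ => hasDerivAt_expAvg ht hg.cont x
      · exact Continuous.intervalIntegrable (by have := hg.cont; fun_prop) _ _
    rw [intervalIntegral.integral_div, intervalIntegral.integral_sub
      (hg.cont.intervalIntegrable _ _) (hc.intervalIntegrable _ _), expAvg_of_le hg.zero le_rfl,
      div_eq_iff ht.ne'] at h1
    have h2 : ∫ x in a..X, ‖expAvg a t g x‖ = ∫ x in a..X, expAvg a t g x := by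
      congr 1 with x
      exact Real.norm_of_nonneg (expAvg_nonneg ht hg x)
    have h3 : ∫ x in a..X, g x ≤ ∫ x, g x := by
      rw [intervalIntegral.integral_of_le hX]
      exact setIntegral_le_integral hg.integrable (Filter.Eventually.of_forall hg.nonneg)
    have h4 : 0 ≤ expAvg a t g X * t := mul_nonneg (expAvg_nonneg ht hg X) ht.le
    rw [h2]
    linarith
  rw [← integrableOn_univ, ← Iic_union_Ioi (a := a)]
  refine IntegrableOn.union ?_ hIoi
  apply (integrableOn_zero (ε' := ℝ)).congr_fun _ measurableSet_Iic
  intro x hx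
  exact (expAvg_of_le hg.zero hx).symm

theorem admissible_expAvg (ht : 0 < t) (hg : Admissible a g) : Admissible a (expAvg a t g) where
  cont := continuous_expAvg ht hg.cont
  nonneg := expAvg_nonneg ht hg
  zero := fun _ hx => expAvg_of_le hg.zero hx
  integrable := integrable_expAvg ht hg
  bdd := by
    obtain ⟨B, hB⟩ := hg.bdd
    exact ⟨B, expAvg_le ht hg hB⟩

theorem integral_expAvg (ht : 0 < t) (hg : Admissible a g) :
    ∫ x, expAvg a t g x = ∫ x, g x := by
  have h := integral_eq_zero_of_hasDerivAt_of_integrable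
    (fun x => hasDerivAt_expAvg (a := a) ht hg.cont x)
    ((hg.integrable.sub (integrable_expAvg ht hg)).div_const t) (integrable_expAvg ht hg)
  rw [integral_div, integral_sub hg.integrable (integrable_expAvg ht hg)] at h
  have := (div_eq_zero_iff.1 h).resolve_right ht.ne'
  linarith

theorem Admissible.integrable_mul (hg : Admissible a g) (hh : Admissible a h) :
    Integrable fun x => g x * h x := by
  obtain ⟨B, hB⟩ := hh.bdd
  apply (hg.integrable.mul_const B).mono' (hg.cont.mul hh.cont).aestronglyMeasurable
  refine Filter.Eventually.of_forall fun x => ?_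
  rw [Pi.mul_apply, Real.norm_of_nonneg (mul_nonneg (hg.nonneg x) (hh.nonneg x))]
  exact mul_le_mul_of_nonneg_left (hB x) (hg.nonneg x)

/-- The difference of two consecutive averages. -/
noncomputable def expDiff (a t : ℝ) (g : ℝ → ℝ) (x : ℝ) : ℝ :=
  expAvg a (t / 2) g x - expAvg a t g x

theorem continuous_expDiff (ht : 0 < t) (hg : Continuous g) : Continuous (expDiff a t g) :=
  (continuous_expAvg (half_pos ht) hg).sub (continuous_expAvg ht hg)

theorem integrable_expDiff (ht : 0 < t) (hg : Admissible a g) : Integrable (expDiff a t g) :=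
  (integrable_expAvg (half_pos ht) hg).sub (integrable_expAvg ht hg)

theorem hasDerivAt_expDiff (ht : 0 < t) (hg : Continuous g) (x : ℝ) :
    HasDerivAt (expDiff a t g)
      ((g x - 2 * expAvg a (t / 2) g x + expAvg a t g x) / t) x := by
  refine ((hasDerivAt_expAvg (half_pos ht) hg x).sub (hasDerivAt_expAvg ht hg x)).congr_deriv ?_
  field_simp
  ring

/-- Eliminating `g` from the equations at scales `t` and `t / 2` exhibits the difference of the
averages as a derivative. This is used both for the energy identity and for pairing with the
primitive of a molecule. -/
theorem hasDerivAt_expCorr (ht : 0 < t) (hg : Continuous g) (x : ℝ) :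
    HasDerivAt (fun x => 2 * expAvg a t g x - expAvg a (t / 2) g x)
      (2 / t * expDiff a t g x) x := by
  refine (((hasDerivAt_expAvg ht hg x).const_mul 2).sub
    (hasDerivAt_expAvg (half_pos ht) hg x)).congr_deriv ?_
  rw [expDiff]
  field_simp
  ring

theorem integrable_sq_expDiff (ht : 0 < t) (hg : Admissible a g) :
    Integrable fun x => expDiff a t g x ^ 2 := by
  have a1 := admissible_expAvg (half_pos ht) hg
  have a2 := admissible_expAvg ht hg
  have := ((a1.integrable_mul a1).sub ((a1.integrable_mul a2).const_mul 2)).add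
    (a2.integrable_mul a2)
  apply this.congr
  refine Filter.Eventually.of_forall fun x => ?_
  simp only [Pi.add_apply, Pi.sub_apply, expDiff]
  ring

/-- On the Fourier side, with `s = tξ`, this is `1/(1+s²/4) - 1/(1+s²) = 3 ·
(s²/4)/((1+s²/4)(1+s²))`. The proof instead integrates the derivative of the square of `2 expAvg a t
g - expAvg a (t / 2) g`. -/
theorem integral_sq_expAvg_half (ht : 0 < t) (hg : Admissible a g) :
    ∫ x, expAvg a (t / 2) g x ^ 2 =
      (∫ x, expAvg a t g x ^ 2) + 3 * ∫ x, expDiff a t g x ^ 2 := by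
  have a1 := admissible_expAvg (half_pos ht) hg
  have a2 := admissible_expAvg ht hg
  have i1 : Integrable fun x => expAvg a (t / 2) g x ^ 2 := by
    simpa only [pow_two] using a1.integrable_mul a1
  have i2 : Integrable fun x => expAvg a t g x ^ 2 := by
    simpa only [pow_two] using a2.integrable_mul a2
  have i3 := integrable_sq_expDiff ht hg
  have hder : ∀ x, HasDerivAt (fun x => (2 * expAvg a t g x - expAvg a (t / 2) g x) ^ 2)
      (2 / t * (expAvg a (t / 2) g x ^ 2 - expAvg a t g x ^ 2 - 3 * expDiff a t g x ^ 2))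
      x := by
    intro x
    refine ((hasDerivAt_expCorr (a := a) ht hg.cont x).pow 2).congr_deriv ?_
    rw [expDiff]
    simp
    field_simp
    ring
  have h := integral_eq_zero_of_hasDerivAt_of_integrable hder
    (((i1.sub i2).sub (i3.const_mul 3)).const_mul (2 / t)) (by
      have := ((i2.const_mul 4).sub ((a1.integrable_mul a2).const_mul 4)).add i1
      apply this.congr
      refine Filter.Eventually.of_forall fun x => ?_
      simp only [Pi.add_apply, Pi.sub_apply]
      ring)
  rw [integral_const_mul,
    integral_sub (f := fun x => expAvg a (t / 2) g x ^ 2 - expAvg a t g x ^ 2) (i1.sub i2)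
      (i3.const_mul 3), integral_sub i1 i2, integral_const_mul] at h
  have h2 : (2 / t) ≠ 0 := by positivity
  have := (mul_eq_zero.1 h).resolve_left h2
  linarith

end ExpAvg

/-- Summing the energies of the differences over the dyadic scales, for a decreasing sequence of
functions. -/
theorem sum_integral_sq_expDiff_le {a t : ℝ} (ht : 0 < t) {g : ℕ → ℝ → ℝ}
    (hg : ∀ n, Admissible a (g n)) (hanti : ∀ n x, g (n + 1) x ≤ g n x) {B : ℝ}
    (hB : ∀ x, g 0 x ≤ B) (n : ℕ) :
    3 * ∑ j ∈ Finset.range n, ∫ x, expDiff a (t * 2 ^ j) (g j) x ^ 2 ≤ B * ∫ x, g 0 x := by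
  have key : 3 * ∑ j ∈ Finset.range n, ∫ x, expDiff a (t * 2 ^ j) (g j) x ^ 2 ≤
      (∫ x, expAvg a (t / 2) (g 0) x ^ 2) - ∫ x, expAvg a (t * 2 ^ n / 2) (g n) x ^ 2 := by
    induction n with
    | zero => simp
    | succ n ih =>
      rw [Finset.sum_range_succ, mul_add]
      have hp : 0 < t * 2 ^ n := by positivity
      have h1 := integral_sq_expAvg_half hp (hg n)
      -- The telescoping step: the finer average at step `n + 1` has the scale of the coarser one at
      -- step `n`, and replacing `g n` by the smaller `g (n + 1)` only decreases it.
      have h2 : ∫ x, expAvg a (t * 2 ^ (n + 1) / 2) (g (n + 1)) x ^ 2 ≤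
          ∫ x, expAvg a (t * 2 ^ n) (g n) x ^ 2 := by
        have he : t * 2 ^ (n + 1) / 2 = t * 2 ^ n := by ring
        rw [he]
        have a1 := admissible_expAvg hp (hg n)
        have a2 := admissible_expAvg hp (hg (n + 1))
        apply integral_mono
        · simpa only [pow_two] using a2.integrable_mul a2
        · simpa only [pow_two] using a1.integrable_mul a1
        · intro x
          exact pow_le_pow_left₀ (a2.nonneg x) (expAvg_mono hp (hg (n + 1)) (hg n) (hanti n) x) 2
      linarith
  have h0 : 0 ≤ ∫ x, expAvg a (t * 2 ^ n / 2) (g n) x ^ 2 := integral_nonneg fun x => sq_nonneg _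
  have a1 := admissible_expAvg (half_pos ht) (hg 0)
  -- One factor is bounded by `B`; averaging preserves the integral of the other.
  have h1 : ∫ x, expAvg a (t / 2) (g 0) x ^ 2 ≤ ∫ x, B * expAvg a (t / 2) (g 0) x := by
    apply integral_mono
    · simpa only [pow_two] using a1.integrable_mul a1
    · exact a1.integrable.const_mul B
    · intro x
      simp only [pow_two]
      exact mul_le_mul_of_nonneg_right (expAvg_le (half_pos ht) (hg 0) hB x) (a1.nonneg x)
  rw [integral_const_mul, integral_expAvg (half_pos ht) (hg 0)] at h1
  linarith

/-! ### Mean zero molecules -/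

/-- A smooth function of mean zero adapted to the interval of center `c` and length `l`. -/
structure IsMolecule (K c l : ℝ) (φ : ℝ → ℂ) : Prop where
  contDiff : ContDiff ℝ 1 φ
  norm_le : ∀ x, ‖φ x‖ ≤ K * (l⁻¹ * (bracket c l x ^ 20)⁻¹)
  norm_deriv_le : ∀ x, ‖deriv φ x‖ ≤ K * (l⁻¹ * (l⁻¹ * (bracket c l x ^ 20)⁻¹))
  integral_eq_zero : ∫ x, φ x = 0

theorem enorm_le_of_norm_le {z : ℂ} {r : ℝ} (h : ‖z‖ ≤ r) : ‖z‖ₑ ≤ ENNReal.ofReal r := by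
  rw [← ofReal_norm]
  exact ENNReal.ofReal_le_ofReal h

section Molecule
variable {K c l : ℝ} {φ : ℝ → ℂ}

theorem lintegral_inv_mul_wt (hl : 0 < l) {n : ℕ} (hn : 2 ≤ n) :
    ∫⁻ x, ENNReal.ofReal l⁻¹ * wt c l n x ≤ 4 := by
  rw [lintegral_const_mul _ measurable_wt]
  calc _ ≤ ENNReal.ofReal l⁻¹ * ENNReal.ofReal (4 * l) := by gcongr; exact lintegral_wt hl hn
    _ = 4 := by
      rw [← ENNReal.ofReal_mul (by positivity)]
      have : l⁻¹ * (4 * l) = 4 := by field_simp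
      rw [this]; norm_num

theorem IsMolecule.enorm_le (hφ : IsMolecule K c l φ) (hK : 0 ≤ K) (hl : 0 < l) (x : ℝ) :
    ‖φ x‖ₑ ≤ ENNReal.ofReal K * (ENNReal.ofReal l⁻¹ * wt c l 20 x) := by
  rw [wt, ← ENNReal.ofReal_mul (by positivity), ← ENNReal.ofReal_mul hK]
  exact enorm_le_of_norm_le (hφ.norm_le x)

theorem IsMolecule.integrable (hφ : IsMolecule K c l φ) (hK : 0 ≤ K) (hl : 0 < l) :
    Integrable φ := by
  refine ⟨hφ.contDiff.continuous.aestronglyMeasurable, ?_⟩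
  calc ∫⁻ x, ‖φ x‖ₑ ≤ ∫⁻ x, ENNReal.ofReal K * (ENNReal.ofReal l⁻¹ * wt c l 20 x) :=
        lintegral_mono (hφ.enorm_le hK hl)
    _ = ENNReal.ofReal K * ∫⁻ x, ENNReal.ofReal l⁻¹ * wt c l 20 x := by
        rw [lintegral_const_mul' _ _ ENNReal.ofReal_ne_top]
    _ ≤ ENNReal.ofReal K * 4 := by gcongr; exact lintegral_inv_mul_wt hl (by norm_num)
    _ < ∞ := by finiteness

/-- The decaying primitive of a molecule. -/
noncomputable def primitive (φ : ℝ → ℂ) (x : ℝ) : ℂ := ∫ y in Iic x, φ y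

theorem IsMolecule.hasDerivAt_primitive (hφ : IsMolecule K c l φ) (hK : 0 ≤ K) (hl : 0 < l)
    (x : ℝ) : HasDerivAt (primitive φ) (φ x) x := by
  have hi := hφ.integrable hK hl
  have hc := hφ.contDiff.continuous
  have : primitive φ = fun x => (∫ y in Iic (0 : ℝ), φ y) + ∫ y in (0 : ℝ)..x, φ y := by
    ext x
    rw [← intervalIntegral.integral_Iic_sub_Iic hi.integrableOn hi.integrableOn, primitive]
    ring
  rw [this]
  apply HasDerivAt.const_add
  exact intervalIntegral.integral_hasDerivAt_right (hc.intervalIntegrable _ _)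
    (hc.stronglyMeasurableAtFilter _ _) hc.continuousAt

/-- Of the twenty powers of decay, two make the integral converge. The other eighteen are evaluated
at `x`, since every point of `S` is at least as far from `c`. -/
theorem IsMolecule.enorm_setIntegral_le (hφ : IsMolecule K c l φ) (hK : 0 ≤ K) (hl : 0 < l)
    (x : ℝ) {S : Set ℝ} (hS : MeasurableSet S) (h : ∀ y ∈ S, |x - c| ≤ |y - c|) :
    ‖∫ y in S, φ y‖ₑ ≤ ENNReal.ofReal K * (4 * wt c l 18 x) := by
  calc ‖∫ y in S, φ y‖ₑ ≤ ∫⁻ y in S, ‖φ y‖ₑ := enorm_integral_le_lintegral_enorm _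
    _ ≤ ∫⁻ y in S, ENNReal.ofReal K * (wt c l 18 x * (ENNReal.ofReal l⁻¹ * wt c l 2 y)) := by
        apply setLIntegral_mono' hS
        intro y hy
        apply (hφ.enorm_le hK hl y).trans
        have h1 : wt c l 18 y ≤ wt c l 18 x := by
          have hb : bracket c l x ≤ 1 * bracket c l y := by
            rw [bracket, bracket, one_mul]
            have := h y hy
            gcongr
          simpa using wt_le_mul hl hl zero_le_one 18 hb
        have h2 : wt c l 20 y = wt c l 18 y * wt c l 2 y := wt_add hl 18 2
        rw [h2]
        calc _ = ENNReal.ofReal K * (wt c l 18 y * (ENNReal.ofReal l⁻¹ * wt c l 2 y)) := by ring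
          _ ≤ _ := by gcongr
    _ ≤ ∫⁻ y, ENNReal.ofReal K * (wt c l 18 x * (ENNReal.ofReal l⁻¹ * wt c l 2 y)) :=
        setLIntegral_le_lintegral _ _
    _ = ENNReal.ofReal K * (wt c l 18 x * ∫⁻ y, (ENNReal.ofReal l⁻¹ * wt c l 2 y)) := by
        rw [lintegral_const_mul' _ _ ENNReal.ofReal_ne_top, lintegral_const_mul' _ _ wt_ne_top]
    _ ≤ ENNReal.ofReal K * (wt c l 18 x * 4) := by
        gcongr; exact lintegral_inv_mul_wt hl le_rfl
    _ = _ := by ring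

theorem IsMolecule.enorm_primitive_le (hφ : IsMolecule K c l φ) (hK : 0 ≤ K) (hl : 0 < l)
    (x : ℝ) : ‖primitive φ x‖ₑ ≤ ENNReal.ofReal K * (4 * wt c l 18 x) := by
  rcases le_total x c with hx | hx
  · apply hφ.enorm_setIntegral_le hK hl x measurableSet_Iic
    intro y hy
    have hy' : y ≤ x := hy
    rw [abs_of_nonpos (by linarith), abs_of_nonpos (by linarith)]
    linarith
  · have hi := hφ.integrable hK hl
    -- Right of `c`, mean zero replaces the left tail by minus the right tail, which lies farther
    -- from `c` than `x`.
    have h1 : primitive φ x = - ∫ y in Ioi x, φ y := by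
      have := intervalIntegral.integral_Iic_add_Ioi (b := x) hi.integrableOn hi.integrableOn
      rw [hφ.integral_eq_zero] at this
      rw [primitive, eq_neg_iff_add_eq_zero, this]
    rw [h1, enorm_neg]
    apply hφ.enorm_setIntegral_le hK hl x measurableSet_Ioi
    intro y hy
    have hy' : x < y := hy
    rw [abs_of_nonneg (by linarith), abs_of_nonneg (by linarith)]
    linarith

theorem integrable_ofReal_mul_of_bdd {u : ℝ → ℝ} {v : ℝ → ℂ} {B : ℝ} (hu : Integrable u)
    (hv : Continuous v) (hB : ∀ x, ‖v x‖ ≤ B) : Integrable fun x => (u x : ℂ) * v x :=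
  hu.ofReal.mul_bdd (c := B) hv.aestronglyMeasurable (Filter.Eventually.of_forall hB)

theorem norm_le_of_enorm_le {z : ℂ} {r : ℝ≥0∞} (hr : r ≠ ∞) (h : ‖z‖ₑ ≤ r) : ‖z‖ ≤ r.toReal := by
  rw [← toReal_enorm]
  exact ENNReal.toReal_mono hr h

/-- The pairing of an admissible function with a molecule only sees the difference of the averages
at the scale of the molecule. -/
theorem IsMolecule.enorm_integral_mul_le (hφ : IsMolecule K c l φ) (hK : 0 ≤ K) (hl : 0 < l)
    {a : ℝ} {g : ℝ → ℝ} (hg : Admissible a g) :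
    ‖∫ x, (g x : ℂ) * φ x‖ₑ ≤ ENNReal.ofReal K *
      (12 * ∫⁻ x, ‖expDiff a l g x‖ₑ * (ENNReal.ofReal l⁻¹ * wt c l 18 x)) := by
  have hφc := hφ.contDiff.continuous
  have hφ'c : Continuous (deriv φ) := hφ.contDiff.continuous_deriv le_rfl
  have hφd : ∀ x, HasDerivAt φ (deriv φ x) x := fun x =>
    (hφ.contDiff.differentiable one_ne_zero x).hasDerivAt
  have hΦd := hφ.hasDerivAt_primitive hK hl
  have hΦc : Continuous (primitive φ) :=
    continuous_iff_continuousAt.2 fun x => (hΦd x).continuousAt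
  have bnd : ∀ x, (bracket c l x ^ 20)⁻¹ ≤ 1 := fun x =>
    inv_le_one_of_one_le₀ (one_le_pow₀ (one_le_bracket hl))
  have bφ : ∀ x, ‖φ x‖ ≤ K * (l⁻¹ * 1) := fun x =>
    (hφ.norm_le x).trans (by gcongr; exact bnd x)
  have bφ' : ∀ x, ‖deriv φ x‖ ≤ K * (l⁻¹ * (l⁻¹ * 1)) := fun x =>
    (hφ.norm_deriv_le x).trans (by gcongr; exact bnd x)
  have bΦ : ∀ x, ‖primitive φ x‖ ≤ (ENNReal.ofReal K * (4 * 1)).toReal := fun x =>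
    norm_le_of_enorm_le (by finiteness)
      ((hφ.enorm_primitive_le hK hl x).trans (by gcongr; exact wt_le_one hl))
  have a1 := admissible_expAvg (half_pos hl) hg
  have a2 := admissible_expAvg hl hg
  set D := expDiff a l g with hD
  set w : ℝ → ℝ := fun x => 2 * expAvg a l g x - expAvg a (l / 2) g x with hw
  have iD : Integrable D := integrable_expDiff hl hg
  have iw : Integrable w := (a2.integrable.const_mul 2).sub a1.integrable
  set D' : ℝ → ℝ := fun x => (g x - 2 * expAvg a (l / 2) g x + expAvg a l g x) / l with hD'
  have iD' : Integrable D' :=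
    ((hg.integrable.sub (a1.integrable.const_mul 2)).add a2.integrable).div_const l
  have e1 : ∫ x, ((D' x : ℂ) * φ x + (D x : ℂ) * deriv φ x) = 0 := by
    apply integral_eq_zero_of_hasDerivAt_of_integrable (f := fun x => (D x : ℂ) * φ x)
    · intro x
      exact ((hasDerivAt_expDiff hl hg.cont x).ofReal_comp).mul (hφd x)
    · exact (integrable_ofReal_mul_of_bdd iD' hφc bφ).add
        (integrable_ofReal_mul_of_bdd iD hφ'c bφ')
    · exact integrable_ofReal_mul_of_bdd iD hφc bφ
  have e2 : ∫ x, (((2 / l * D x : ℝ) : ℂ) * primitive φ x + (w x : ℂ) * φ x) = 0 := by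
    apply integral_eq_zero_of_hasDerivAt_of_integrable (f := fun x => (w x : ℂ) * primitive φ x)
    · intro x
      exact ((hasDerivAt_expCorr hl hg.cont x).ofReal_comp).mul (hΦd x)
    · exact (integrable_ofReal_mul_of_bdd (iD.const_mul _) hΦc bΦ).add
        (integrable_ofReal_mul_of_bdd iw hφc bφ)
    · exact integrable_ofReal_mul_of_bdd iw hΦc bΦ
  have i1 : Integrable fun x => (D' x : ℂ) * φ x + (D x : ℂ) * deriv φ x :=
    (integrable_ofReal_mul_of_bdd iD' hφc bφ).add
        (integrable_ofReal_mul_of_bdd iD hφ'c bφ')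
  have i2 : Integrable fun x => ((2 / l * D x : ℝ) : ℂ) * primitive φ x + (w x : ℂ) * φ x :=
    (integrable_ofReal_mul_of_bdd (iD.const_mul (2 / l)) hΦc bΦ).add
        (integrable_ofReal_mul_of_bdd iw hφc bφ)
  have i3 := integrable_ofReal_mul_of_bdd hg.integrable hφc bφ
  have hl0 : (l : ℂ) ≠ 0 := by exact_mod_cast hl.ne'
  -- The identity is `g = l D' + 3 D + w`. The term `l D'` is integrated by parts against `φ`. The
  -- term `w`, with `w' = (2 / l) D`, is integrated by parts against the decaying primitive, which
  -- exists because `φ` has mean zero.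
  have e3 : ∫ x, (g x : ℂ) * φ x = ∫ x, (D x : ℂ) *
      (3 * φ x - (l : ℂ) * deriv φ x - (2 / l : ℂ) * primitive φ x) := by
    have h0 : ∫ x, ((g x : ℂ) * φ x - ((l : ℂ) * ((D' x : ℂ) * φ x + (D x : ℂ) * deriv φ x) +
        (((2 / l * D x : ℝ) : ℂ) * primitive φ x + (w x : ℂ) * φ x))) = ∫ x, (g x : ℂ) * φ x := by
      have i4 : Integrable fun x => (l : ℂ) * ((D' x : ℂ) * φ x + (D x : ℂ) * deriv φ x) +
        (((2 / l * D x : ℝ) : ℂ) * primitive φ x + (w x : ℂ) * φ x) :=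
        (i1.const_mul (l : ℂ)).add i2
      rw [integral_sub i3 i4,
        integral_add (i1.const_mul (l : ℂ)) i2, integral_const_mul]
      rw [e1, e2]; simp
    rw [← h0]
    congr 1 with x
    simp only [hD', hw, hD, expDiff]
    push_cast
    field_simp
    ring
  rw [e3]
  calc _ ≤ ∫⁻ x, ‖(D x : ℂ) *
      (3 * φ x - (l : ℂ) * deriv φ x - (2 / l : ℂ) * primitive φ x)‖ₑ :=
        enorm_integral_le_lintegral_enorm _
    _ ≤ ∫⁻ x, (ENNReal.ofReal K * 12) *
        (‖D x‖ₑ * (ENNReal.ofReal l⁻¹ * wt c l 18 x)) := by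
        apply lintegral_mono
        intro x
        have hb := bracket_pos (c := c) (x := x) hl
        have h20 : (bracket c l x ^ 20)⁻¹ ≤ (bracket c l x ^ 18)⁻¹ := by
          gcongr
          · exact one_le_bracket hl
          · norm_num
        have n1 : ‖primitive φ x‖ ≤ K * (4 * (bracket c l x ^ 18)⁻¹) := by
          have := norm_le_of_enorm_le (by have := wt_ne_top (c := c) (l := l) (x := x) (n := 18)
                                          finiteness) (hφ.enorm_primitive_le hK hl x)
          rwa [ENNReal.toReal_mul, ENNReal.toReal_ofReal hK, ENNReal.toReal_mul, wt,
            ENNReal.toReal_ofReal (by positivity)] at this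
        have n2 : ‖3 * φ x - (l : ℂ) * deriv φ x - (2 / l : ℂ) * primitive φ x‖ ≤
            K * (12 * (l⁻¹ * (bracket c l x ^ 18)⁻¹)) := by
          calc _ ≤ ‖3 * φ x‖ + ‖(l : ℂ) * deriv φ x‖ + ‖(2 / l : ℂ) * primitive φ x‖ := by
                refine (norm_sub_le _ _).trans ?_
                gcongr
                exact norm_sub_le _ _
            _ = 3 * ‖φ x‖ + l * ‖deriv φ x‖ + 2 / l * ‖primitive φ x‖ := by
                simp [abs_of_pos hl]
            _ ≤ 3 * (K * (l⁻¹ * (bracket c l x ^ 18)⁻¹)) +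
                l * (K * (l⁻¹ * (l⁻¹ * (bracket c l x ^ 18)⁻¹))) +
                2 / l * (K * (4 * (bracket c l x ^ 18)⁻¹)) := by
                gcongr
                · exact (hφ.norm_le x).trans (by gcongr)
                · exact (hφ.norm_deriv_le x).trans (by gcongr)
            _ = _ := by field_simp; ring
        simp only [enorm_mul]
        have n3 := enorm_le_of_norm_le n2
        rw [ENNReal.ofReal_mul hK, ENNReal.ofReal_mul (by norm_num),
          ENNReal.ofReal_mul (by positivity)] at n3
        have n4 : ‖(D x : ℂ)‖ₑ = ‖D x‖ₑ := by
          rw [← ofReal_norm, ← ofReal_norm, Complex.norm_real]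
        rw [n4]
        calc _ ≤ ‖D x‖ₑ * (ENNReal.ofReal K * (ENNReal.ofReal 12 *
            (ENNReal.ofReal l⁻¹ * ENNReal.ofReal (bracket c l x ^ 18)⁻¹))) := by gcongr
          _ = _ := by rw [wt]; norm_num; ring
    _ = _ := by
        rw [lintegral_const_mul' _ _ (by finiteness)]
        ring

end Molecule

/-! ### Continuous averaging at a variable scale -/

/-- The tent function. -/
noncomputable def tent (z : ℝ) : ℝ := max 0 (1 - |z|)

theorem tent_nonneg (z : ℝ) : 0 ≤ tent z := le_max_left _ _

theorem tent_le_one (z : ℝ) : tent z ≤ 1 := by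
  rw [tent, max_le_iff]
  exact ⟨zero_le_one, by linarith [abs_nonneg z]⟩

theorem tent_eq_zero {z : ℝ} (h : 1 ≤ |z|) : tent z = 0 := by
  rw [tent, max_eq_left]; linarith

@[fun_prop]
theorem continuous_tent : Continuous tent := by unfold tent; fun_prop

theorem integral_tent : ∫ z, tent z = 1 := by
  have h1 : ∫ z, tent z = 2 * ∫ z in Ioi (0 : ℝ), max 0 (1 - z) :=
    integral_comp_abs (f := fun z : ℝ => max 0 (1 - z))
  have h2 : ∫ z in Ioi (0 : ℝ), max 0 (1 - z) = ∫ z in Ioc (0 : ℝ) 1, (1 - z) := by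
    rw [← integral_indicator measurableSet_Ioi, ← integral_indicator measurableSet_Ioc]
    congr 1 with z
    simp only [indicator_apply, mem_Ioi, mem_Ioc]
    by_cases h0 : 0 < z
    · by_cases h3 : z ≤ 1
      · simp [h0, h3]
      · simp only [h0, h3, and_false, if_true, if_false]
        rw [max_eq_left]; linarith
    · simp [h0]
  rw [h1, h2, ← intervalIntegral.integral_of_le zero_le_one]
  rw [intervalIntegral.integral_sub (by simp) (by simp)]
  simp
  norm_num

/-- The mass one kernel of width `d x` at `x`. -/
noncomputable def smearKernel (d : ℝ → ℝ) (x y : ℝ) : ℝ := 4 / d x * tent (4 * (y - x) / d x)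

/-- The average of `g` at the variable scale `d`. -/
noncomputable def smear (d g : ℝ → ℝ) (y : ℝ) : ℝ := ∫ x, g x * smearKernel d x y

section Smear
variable {d g : ℝ → ℝ}

theorem smearKernel_nonneg (hd : ∀ x, 0 < d x) (x y : ℝ) : 0 ≤ smearKernel d x y := by
  have := hd x
  exact mul_nonneg (by positivity) (tent_nonneg _)

theorem smearKernel_le (hd : ∀ x, 0 < d x) (x y : ℝ) : smearKernel d x y ≤ 4 / d x := by
  have := hd x
  exact mul_le_of_le_one_right (by positivity) (tent_le_one _)

theorem smearKernel_eq_zero (hd : ∀ x, 0 < d x) {x y : ℝ} (h : d x / 4 ≤ |y - x|) :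
    smearKernel d x y = 0 := by
  have := hd x
  rw [smearKernel, tent_eq_zero, mul_zero]
  rw [abs_div, abs_mul, abs_of_pos this, le_div_iff₀ this]
  norm_num
  linarith

theorem continuous_smearKernel (x : ℝ) : Continuous (smearKernel d x) := by
  unfold smearKernel; fun_prop

theorem integral_smearKernel (hd : ∀ x, 0 < d x) (x : ℝ) : ∫ y, smearKernel d x y = 1 := by
  have hx := hd x
  unfold smearKernel
  rw [integral_const_mul]
  have : ∀ y, tent (4 * (y - x) / d x) = (fun z => tent (z / (d x / 4))) (y - x) := by
    intro y
    simp only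
    congr 1
    field_simp
  simp_rw [this]
  rw [integral_sub_right_eq_self (fun z => tent (z / (d x / 4))) x, Measure.integral_comp_div,
    integral_tent, abs_of_pos (by positivity)]
  simp only [smul_eq_mul, mul_one]
  field_simp

theorem integrable_smearKernel (hd : ∀ x, 0 < d x) (x : ℝ) : Integrable (smearKernel d x) := by
  by_contra h
  have := integral_smearKernel hd x
  rw [integral_undef h] at this
  norm_num at this

theorem measurable_of_lip (hLip : ∀ x y, d x ≤ d y + |x - y|) : Measurable d := by
  have : LipschitzWith 1 d := LipschitzWith.of_le_add fun x y => by
    rw [Real.dist_eq]; exact hLip x y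
  exact this.continuous.measurable

theorem measurable_smearKernel (hd : Measurable d) :
    Measurable fun p : ℝ × ℝ => smearKernel d p.1 p.2 := by
  unfold smearKernel
  apply (measurable_const.div (hd.comp measurable_fst)).mul
  apply continuous_tent.measurable.comp
  exact ((measurable_snd.sub measurable_fst).const_mul 4).div (hd.comp measurable_fst)

/-- A bounded measurable nonnegative function with support in a ball in which `d` is controlled. -/
structure SmearData (d g : ℝ → ℝ) (c R : ℝ) : Prop where
  pos : ∃ δ > 0, ∀ x, δ ≤ d x
  lip : ∀ x y, d x ≤ d y + |x - y|
  meas : Measurable g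
  nonneg : ∀ x, 0 ≤ g x
  bdd : ∃ B, ∀ x, g x ≤ B
  supp : ∀ x, g x ≠ 0 → |x - c| ≤ R ∧ d x ≤ R

variable {c R : ℝ}

theorem SmearData.d_pos (h : SmearData d g c R) (x : ℝ) : 0 < d x := by
  obtain ⟨δ, hδ, h⟩ := h.pos
  exact hδ.trans_le (h x)

theorem SmearData.integrable (h : SmearData d g c R) : Integrable g := by
  obtain ⟨B, hB⟩ := h.bdd
  have h1 : Integrable ((Icc (c - R) (c + R)).indicator fun _ => B) := by
    rw [integrable_indicator_iff measurableSet_Icc]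
    exact integrableOn_const (by simp)
  apply h1.mono' h.meas.aestronglyMeasurable
  refine Filter.Eventually.of_forall fun x => ?_
  rw [Real.norm_of_nonneg (h.nonneg x)]
  by_cases hx : g x = 0
  · rw [hx]
    exact indicator_nonneg (fun _ _ => (h.nonneg 0).trans (hB 0)) x
  · have := (h.supp x hx).1
    rw [abs_le] at this
    have hm : x ∈ Icc (c - R) (c + R) := ⟨by linarith, by linarith⟩
    rw [indicator_of_mem hm]
    exact hB x

theorem SmearData.smear_nonneg (h : SmearData d g c R) (y : ℝ) : 0 ≤ smear d g y :=
  integral_nonneg fun x => mul_nonneg (h.nonneg x) (smearKernel_nonneg h.d_pos x y)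

theorem SmearData.smear_eq_zero (h : SmearData d g c R) {y : ℝ} (hy : 2 * R ≤ |y - c|) :
    smear d g y = 0 := by
  rw [smear]
  have : ∀ x, g x * smearKernel d x y = 0 := by
    intro x
    by_cases hx : g x = 0
    · rw [hx, zero_mul]
    · have h1 := h.supp x hx
      rw [smearKernel_eq_zero h.d_pos, mul_zero]
      have : |y - c| ≤ |y - x| + |x - c| := abs_sub_le _ _ _
      linarith [h.d_pos x]
  simp [this]

theorem SmearData.integrable_mul_kernel (h : SmearData d g c R) (y : ℝ) :
    Integrable fun x => g x * smearKernel d x y := by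
  obtain ⟨δ, hδ, h2⟩ := h.pos
  have hm : Measurable fun x => smearKernel d x y :=
    (measurable_smearKernel (measurable_of_lip h.lip)).comp (measurable_id.prodMk measurable_const)
  apply h.integrable.mul_bdd (c := 4 / δ) hm.aestronglyMeasurable
  refine Filter.Eventually.of_forall fun x => ?_
  rw [Real.norm_of_nonneg (smearKernel_nonneg h.d_pos x y)]
  apply (smearKernel_le h.d_pos x y).trans
  have := h2 x
  gcongr

theorem SmearData.continuous_smear (h : SmearData d g c R) : Continuous (smear d g) := by
  obtain ⟨δ, hδ, h2⟩ := h.pos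
  unfold smear
  apply continuous_of_dominated (bound := fun x => g x * (4 / δ))
  · exact fun y => (h.integrable_mul_kernel y).aestronglyMeasurable
  · intro y
    refine Filter.Eventually.of_forall fun x => ?_
    rw [Real.norm_of_nonneg (mul_nonneg (h.nonneg x) (smearKernel_nonneg h.d_pos x y))]
    apply mul_le_mul_of_nonneg_left _ (h.nonneg x)
    apply (smearKernel_le h.d_pos x y).trans
    have := h2 x
    gcongr
  · exact h.integrable.mul_const _
  · refine Filter.Eventually.of_forall fun x => ?_
    exact continuous_const.mul (continuous_smearKernel x)

/-- Only points with `|y - x| < d x / 4` contribute, and there the kernel is at most `4 / d x ≤ 5 /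
d y`. Thus control of averages at scale `d` becomes a pointwise bound. -/
theorem SmearData.smear_le (h : SmearData d g c R) {β : ℝ} (hβ : 0 ≤ β)
    (hA : ∀ y, ∫⁻ x in Icc (y - d y / 2) (y + d y / 2), ENNReal.ofReal (g x) ≤
      ENNReal.ofReal β * ENNReal.ofReal (d y)) (y : ℝ) : smear d g y ≤ 5 * β := by
  have hy := h.d_pos y
  rw [smear, integral_eq_lintegral_of_nonneg_ae
    (Filter.Eventually.of_forall fun x => mul_nonneg (h.nonneg x) (smearKernel_nonneg h.d_pos x y))
    (h.integrable_mul_kernel y).aestronglyMeasurable]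
  apply ENNReal.toReal_le_of_le_ofReal (by positivity)
  calc ∫⁻ x, ENNReal.ofReal (g x * smearKernel d x y) ≤
      ∫⁻ x, ENNReal.ofReal (5 / d y) *
        (Icc (y - d y / 2) (y + d y / 2)).indicator (fun x => ENNReal.ofReal (g x)) x := by
        apply lintegral_mono
        intro x
        rcases le_or_gt (d x / 4) |y - x| with h0 | h0
        · simp [smearKernel_eq_zero h.d_pos h0]
        · have hb := ofReal_Lip_pos_bounds h.lip h0.le
          have hx : x ∈ Icc (y - d y / 2) (y + d y / 2) := by
            rw [abs_lt] at h0
            constructor <;> linarith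
          simp only [indicator_of_mem hx]
          rw [mul_comm (g x), ENNReal.ofReal_mul (smearKernel_nonneg h.d_pos x y)]
          gcongr
          apply (smearKernel_le h.d_pos x y).trans
          rw [div_le_div_iff₀ (h.d_pos x) hy]
          linarith
    _ = ENNReal.ofReal (5 / d y) *
        ∫⁻ x in Icc (y - d y / 2) (y + d y / 2), ENNReal.ofReal (g x) := by
        rw [lintegral_const_mul' _ _ ENNReal.ofReal_ne_top, lintegral_indicator measurableSet_Icc]
    _ ≤ ENNReal.ofReal (5 / d y) * (ENNReal.ofReal β * ENNReal.ofReal (d y)) := by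
        gcongr; exact hA y
    _ = ENNReal.ofReal (5 * β) := by
        rw [← ENNReal.ofReal_mul hβ, ← ENNReal.ofReal_mul (by positivity)]
        congr 1
        field_simp

theorem SmearData.admissible (h : SmearData d g c R) {β : ℝ} (hβ : ∀ y, smear d g y ≤ β) :
    Admissible (c - 2 * R) (smear d g) where
  cont := h.continuous_smear
  nonneg := h.smear_nonneg
  zero := by
    intro x hx
    apply h.smear_eq_zero
    rw [abs_sub_comm]
    exact le_trans (by linarith) (le_abs_self _)
  integrable := by
    apply h.continuous_smear.integrable_of_hasCompactSupport
    apply HasCompactSupport.intro (isCompact_Icc (a := c - 2 * R) (b := c + 2 * R))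
    intro x hx
    apply h.smear_eq_zero
    by_contra h0
    push Not at h0
    rw [abs_lt] at h0
    exact hx ⟨by linarith, by linarith⟩
  bdd := ⟨β, hβ⟩

theorem SmearData.integral_smear_le (h : SmearData d g c R) {β : ℝ} (hR : 0 ≤ R)
    (hβ : ∀ y, smear d g y ≤ β) : ∫ y, smear d g y ≤ β * (4 * R) := by
  have h1 : ∫ y, smear d g y = ∫ y in Icc (c - 2 * R) (c + 2 * R), smear d g y := by
    symm
    apply setIntegral_eq_integral_of_forall_compl_eq_zero
    intro x hx
    apply h.smear_eq_zero
    by_contra h0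
    push Not at h0
    rw [abs_lt] at h0
    exact hx ⟨by linarith, by linarith⟩
  rw [h1]
  calc _ ≤ ∫ y in Icc (c - 2 * R) (c + 2 * R), β := by
        apply setIntegral_mono_on (h.admissible hβ).integrable.integrableOn
          (integrableOn_const (by simp)) measurableSet_Icc
        exact fun x _ => hβ x
    _ = _ := by
        rw [setIntegral_const, smul_eq_mul, mul_comm, Measure.real, Real.volume_Icc,
          ENNReal.toReal_ofReal (by linarith)]
        ring

/-- Fubini moves the averaging onto `φ`. Since the kernel has mass one in `y`, it changes `φ` by no
more than its oscillation at scale `d`. -/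
theorem SmearData.integral_smear_mul (h : SmearData d g c R) {φ : ℝ → ℂ} (hφ : Integrable φ) :
    ∫ y, (smear d g y : ℂ) * φ y = ∫ x, (g x : ℂ) * ∫ y, (smearKernel d x y : ℂ) * φ y := by
  obtain ⟨δ, hδ, h2⟩ := h.pos
  have hm := measurable_smearKernel (measurable_of_lip h.lip)
  have hint : Integrable (fun p : ℝ × ℝ => ((g p.1 * smearKernel d p.1 p.2 : ℝ) : ℂ) * φ p.2)
      (volume.prod volume) := by
    have h3 : Integrable (fun p : ℝ × ℝ => (g p.1 : ℂ) * φ p.2) (volume.prod volume) :=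
      h.integrable.ofReal.mul_prod hφ
    have h4 := h3.bdd_mul (c := 4 / δ) (f := fun p : ℝ × ℝ => ((smearKernel d p.1 p.2 : ℝ) : ℂ))
      (Complex.measurable_ofReal.comp hm).aestronglyMeasurable
      (Filter.Eventually.of_forall fun p => by
        rw [Complex.norm_real, Real.norm_of_nonneg (smearKernel_nonneg h.d_pos _ _)]
        apply (smearKernel_le h.d_pos _ _).trans
        have := h2 p.1
        gcongr)
    apply h4.congr
    refine Filter.Eventually.of_forall fun p => ?_
    simp only
    push_cast
    ring
  calc ∫ y, (smear d g y : ℂ) * φ y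
      = ∫ y, ∫ x, ((g x * smearKernel d x y : ℝ) : ℂ) * φ y := by
        congr 1 with y
        rw [smear, ← integral_complex_ofReal, integral_mul_const]
    _ = ∫ x, ∫ y, ((g x * smearKernel d x y : ℝ) : ℂ) * φ y := (integral_integral_swap hint).symm
    _ = _ := by
        congr 1 with x
        rw [← integral_const_mul]
        congr 1 with y
        push_cast
        ring

theorem bracket_le_of_near {c l x z : ℝ} (hl : 0 < l) {r : ℝ} (hr : r ≤ l + |x - c|)
    (hz : |z - x| ≤ r / 4) : bracket c l x ≤ 4 / 3 * bracket c l z := by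
  have h1 := mul_bracket (c := c) (x := x) hl
  have h2 := mul_bracket (c := c) (x := z) hl
  have h3 : |x - c| ≤ |z - x| + |z - c| := by
    rw [abs_sub_comm z x]; exact abs_sub_le _ _ _
  have : l * bracket c l x ≤ l * (4 / 3 * bracket c l z) := by nlinarith
  exact le_of_mul_le_mul_left this hl

/-- Mean value inequality on a ball where the bracket changes by at most a factor `4/3`. As
`(4/3)^20 ≤ 400` and the radius is `r / 4`, the constant is `100`. -/
theorem IsMolecule.norm_sub_le {K c l : ℝ} {φ : ℝ → ℂ} (hφ : IsMolecule K c l φ) (hK : 0 ≤ K)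
    (hl : 0 < l) {x y r : ℝ} (hr : r ≤ l + |x - c|) (hy : |y - x| ≤ r / 4) :
    ‖φ y - φ x‖ ≤ 100 * K * (r / l * (l⁻¹ * (bracket c l x ^ 20)⁻¹)) := by
  have hb := bracket_pos (c := c) (x := x) hl
  have hder : ∀ z ∈ Icc (x - r / 4) (x + r / 4),
      ‖deriv φ z‖ ≤ 400 * K * (l⁻¹ * (l⁻¹ * (bracket c l x ^ 20)⁻¹)) := by
    intro z hz
    apply (hφ.norm_deriv_le z).trans
    have hz' : |z - x| ≤ r / 4 := by
      rw [abs_le]; constructor <;> linarith [hz.1, hz.2]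
    have hbz := bracket_pos (c := c) (x := z) hl
    have h1 := bracket_le_of_near (c := c) hl hr hz'
    have h2 : (bracket c l z ^ 20)⁻¹ ≤ 400 * (bracket c l x ^ 20)⁻¹ := by
      have h3 : bracket c l x ^ 20 ≤ (4 / 3) ^ 20 * bracket c l z ^ 20 := by
        rw [← mul_pow]; exact pow_le_pow_left₀ hb.le h1 20
      have h4 : bracket c l x ^ 20 ≤ 400 * bracket c l z ^ 20 :=
        h3.trans (mul_le_mul_of_nonneg_right (by norm_num) (by positivity))
      rw [inv_le_iff_one_le_mul₀ (by positivity), mul_comm, ← mul_assoc,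
        ← div_eq_mul_inv, le_div_iff₀ (by positivity)]
      linarith
    calc _ ≤ K * (l⁻¹ * (l⁻¹ * (400 * (bracket c l x ^ 20)⁻¹))) := by gcongr
      _ = _ := by ring
  have hr0 : 0 ≤ r / 4 := (abs_nonneg _).trans hy
  have hmv := (convex_Icc (x - r / 4) (x + r / 4)).norm_image_sub_le_of_norm_deriv_le
    (fun z _ => hφ.contDiff.differentiable one_ne_zero z) hder (x := x) (y := y)
    ⟨by linarith, by linarith⟩ (by rw [abs_le] at hy; exact ⟨by linarith, by linarith⟩)
  refine hmv.trans ?_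
  rw [Real.norm_eq_abs]
  calc _ ≤ 400 * K * (l⁻¹ * (l⁻¹ * (bracket c l x ^ 20)⁻¹)) * (r / 4) := by gcongr
    _ = _ := by field_simp; ring

/-- Replacing `g` by its average at the variable scale `d` in the pairing with a molecule. -/
theorem SmearData.enorm_integral_mul_sub_le (h : SmearData d g c R) {K c' l : ℝ} {φ : ℝ → ℂ}
    (hφ : IsMolecule K c' l φ) (hK : 0 ≤ K) (hl : 0 < l) (hdl : ∀ x, d x ≤ l + |x - c'|) :
    ‖∫ x, (g x : ℂ) * φ x‖ₑ ≤ ‖∫ y, (smear d g y : ℂ) * φ y‖ₑ +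
      ENNReal.ofReal (100 * K) * ∫⁻ x, ENNReal.ofReal (g x) *
        (ENNReal.ofReal (d x / l) * (ENNReal.ofReal l⁻¹ * wt c' l 20 x)) := by
  have hφi := hφ.integrable hK hl
  have hφc := hφ.contDiff.continuous
  have bnd : ∀ x, ‖φ x‖ ≤ K * (l⁻¹ * 1) := fun x =>
    (hφ.norm_le x).trans (by
      gcongr; exact inv_le_one_of_one_le₀ (one_le_pow₀ (one_le_bracket hl)))
  have ik : ∀ x, Integrable fun y => (smearKernel d x y : ℂ) * φ y := fun x =>
    integrable_ofReal_mul_of_bdd (integrable_smearKernel h.d_pos x) hφc bnd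
  have ik1 : ∀ x, ∫ y, (smearKernel d x y : ℂ) = 1 := fun x => by
    rw [integral_complex_ofReal, integral_smearKernel h.d_pos x]; simp
  have hdiff : ∀ x, ‖φ x - ∫ y, (smearKernel d x y : ℂ) * φ y‖ ≤
      100 * K * (d x / l * (l⁻¹ * (bracket c' l x ^ 20)⁻¹)) := by
    intro x
    have hb := bracket_pos (c := c') (x := x) hl
    have h1 : φ x - ∫ y, (smearKernel d x y : ℂ) * φ y =
        ∫ y, (smearKernel d x y : ℂ) * (φ x - φ y) := by
      have : ∫ y, (smearKernel d x y : ℂ) * (φ x - φ y) =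
          ∫ y, ((smearKernel d x y : ℂ) * φ x - (smearKernel d x y : ℂ) * φ y) := by
        congr 1 with y; ring
      have ic : Integrable fun y => (smearKernel d x y : ℂ) * φ x :=
        (integrable_smearKernel h.d_pos x).ofReal.mul_const _
      rw [this, integral_sub ic (ik x), integral_mul_const, ik1, one_mul]
    rw [h1]
    have hX : 0 ≤ 100 * K * (d x / l * (l⁻¹ * (bracket c' l x ^ 20)⁻¹)) := by
      have := h.d_pos x
      positivity
    calc _ ≤ ∫ y, smearKernel d x y * (100 * K * (d x / l * (l⁻¹ * (bracket c' l x ^ 20)⁻¹))) := by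
          apply norm_integral_le_of_norm_le ((integrable_smearKernel h.d_pos x).mul_const _)
          refine Filter.Eventually.of_forall fun y => ?_
          rw [norm_mul, Complex.norm_real, Real.norm_of_nonneg (smearKernel_nonneg h.d_pos x y)]
          rcases le_or_gt (d x / 4) |y - x| with h0 | h0
          · rw [smearKernel_eq_zero h.d_pos h0]; simp
          · gcongr
            · exact smearKernel_nonneg h.d_pos x y
            · rw [norm_sub_rev]
              exact hφ.norm_sub_le hK hl (hdl x) h0.le
      _ = _ := by rw [integral_mul_const, integral_smearKernel h.d_pos, one_mul]
  have ig := integrable_ofReal_mul_of_bdd h.integrable hφc bnd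
  have hI : Integrable fun x => (g x : ℂ) * ∫ y, (smearKernel d x y : ℂ) * φ y := by
    have hm := measurable_smearKernel (measurable_of_lip h.lip)
    apply h.integrable.ofReal.mul_bdd (c := K * (l⁻¹ * 1))
    · apply StronglyMeasurable.aestronglyMeasurable
      apply StronglyMeasurable.integral_prod_right (f := fun x y => (smearKernel d x y : ℂ) * φ y)
      exact ((Complex.measurable_ofReal.comp hm).mul
        (hφc.measurable.comp measurable_snd)).stronglyMeasurable
    · refine Filter.Eventually.of_forall fun x => ?_
      calc _ ≤ ∫ y, smearKernel d x y * (K * (l⁻¹ * 1)) := by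
            apply norm_integral_le_of_norm_le ((integrable_smearKernel h.d_pos x).mul_const _)
            refine Filter.Eventually.of_forall fun y => ?_
            rw [norm_mul, Complex.norm_real, Real.norm_of_nonneg (smearKernel_nonneg h.d_pos x y)]
            gcongr
            · exact smearKernel_nonneg h.d_pos x y
            · exact bnd y
        _ = _ := by rw [integral_mul_const, integral_smearKernel h.d_pos, one_mul]
  rw [h.integral_smear_mul hφi]
  have hsub : ∫ x, (g x : ℂ) * φ x = (∫ x, (g x : ℂ) * ∫ y, (smearKernel d x y : ℂ) * φ y) +
      ∫ x, (g x : ℂ) * (φ x - ∫ y, (smearKernel d x y : ℂ) * φ y) := by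
    have : ∀ x, (g x : ℂ) * (φ x - ∫ y, (smearKernel d x y : ℂ) * φ y) =
      (g x : ℂ) * φ x - (g x : ℂ) * ∫ y, (smearKernel d x y : ℂ) * φ y := fun x => by ring
    simp_rw [this]
    rw [integral_sub ig hI]
    ring
  rw [hsub]
  refine (enorm_add_le _ _).trans ?_
  gcongr
  refine (enorm_integral_le_lintegral_enorm _).trans ?_
  rw [← lintegral_const_mul' _ _ ENNReal.ofReal_ne_top]
  apply lintegral_mono
  intro x
  have h3 := enorm_le_of_norm_le (hdiff x)
  have hd' := h.d_pos x
  have hb := bracket_pos (c := c') (x := x) hl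
  rw [ENNReal.ofReal_mul (p := 100 * K) (by positivity),
    ENNReal.ofReal_mul (p := d x / l) (by positivity),
    ENNReal.ofReal_mul (p := l⁻¹) (by positivity)] at h3
  have h4 : ‖(g x : ℂ)‖ₑ = ENNReal.ofReal (g x) := by
    rw [← ofReal_norm, Complex.norm_real, Real.norm_of_nonneg (h.nonneg x)]
  simp only [enorm_mul]
  rw [h4]
  calc _ ≤ ENNReal.ofReal (g x) * _ := mul_le_mul_right h3 _
    _ = _ := by rw [wt]; ring

end Smear

/-! ### Wave packets -/

theorem one_le_japaneseBracket (x : ℝ) : 1 ≤ japaneseBracket x := by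
  rw [japaneseBracket, Real.one_le_sqrt]
  nlinarith [sq_nonneg |x|]

/-- The tenth power of `(1 + |x|)² ≤ 2 (1 + x²)`. -/
theorem pow_le_japaneseBracket_pow (x : ℝ) : (1 + |x|) ^ 20 ≤ 1024 * japaneseBracket x ^ 20 := by
  have h1 : japaneseBracket x ^ 20 = (1 + |x| ^ 2) ^ 10 := by
    rw [japaneseBracket, show 20 = 2 * 10 from rfl, pow_mul, Real.sq_sqrt (by positivity)]
  have h2 : (1 + |x|) ^ 2 ≤ 2 * (1 + |x| ^ 2) := by nlinarith [sq_nonneg (1 - |x|)]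
  calc (1 + |x|) ^ 20 = ((1 + |x|) ^ 2) ^ 10 := by ring
    _ ≤ (2 * (1 + |x| ^ 2)) ^ 10 := pow_le_pow_left₀ (by positivity) h2 10
    _ = _ := by rw [h1, mul_pow]; norm_num

theorem le_of_japaneseBracket_mul_le {M : ℕ} (hM : 20 ≤ M) {x r : ℝ} (hr : 0 ≤ r)
    (h : japaneseBracket x ^ M * r ≤ 1) : r ≤ 1024 * ((1 + |x|) ^ 20)⁻¹ := by
  have h1 : japaneseBracket x ^ 20 * r ≤ 1 :=
    (mul_le_mul_of_nonneg_right (pow_le_pow_right₀ (one_le_japaneseBracket x) hM) hr).trans h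
  have h2 := pow_le_japaneseBracket_pow x
  rw [← div_eq_mul_inv, le_div_iff₀ (by positivity)]
  nlinarith

section Theta
variable {M : ℕ} {θ : ℝ → ℂ}

theorem Theta.norm_le (hM : 20 ≤ M) (h : θ ∈ Theta M) (x : ℝ) :
    ‖θ x‖ ≤ 1024 * ((1 + |x|) ^ 20)⁻¹ := by
  have := h.2 0 (Nat.zero_le _) x
  rw [iteratedDeriv_zero] at this
  exact le_of_japaneseBracket_mul_le hM (norm_nonneg _) this

theorem Theta.norm_deriv_le (hM : 20 ≤ M) (h : θ ∈ Theta M) (x : ℝ) :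
    ‖deriv θ x‖ ≤ 1024 * ((1 + |x|) ^ 20)⁻¹ := by
  have := h.2 1 (by omega) x
  rw [iteratedDeriv_one] at this
  exact le_of_japaneseBracket_mul_le hM (norm_nonneg _) this

theorem Theta.contDiff (hM : 20 ≤ M) (h : θ ∈ Theta M) : ContDiff ℝ 1 θ :=
  h.1.of_le (by exact_mod_cast (by omega : 1 ≤ M))

end Theta

section Phi
variable {D D' : DyadicGrid} {P : Tile D D'} {M : ℕ} {φ : ℝ → ℂ}

theorem Tile.scl_pos (P : Tile D D') : 0 < P.scl := (D.isBoundedInterval _ P.space_mem).len_pos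

theorem Tile.len_freq (P : Tile D D') : len P.freq = P.scl⁻¹ := by
  have h := P.area
  have := P.scl_pos
  rw [Tile.scl] at *
  field_simp
  linarith

theorem Tile.abs_freq_sub_le (P : Tile D D') {ξ η : ℝ} (hξ : ξ ∈ D'.parent 1 P.freq)
    (hη : η ∈ D'.parent 1 P.freq) : |ξ - η| ≤ 2 * P.scl⁻¹ := by
  have hp := D'.parent_spec P.freq_mem
  have hi := D'.isBoundedInterval _ hp.1
  have h1 := hi.abs_sub_center_le hξ
  have h2 := hi.abs_sub_center_le hη
  rw [hp.2.1, P.len_freq] at h1 h2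
  have := abs_sub_le ξ (center (D'.parent 1 P.freq)) η
  rw [abs_sub_comm η] at h2
  linarith

theorem Phi.norm_le (hM : 20 ≤ M) (h : φ ∈ Phi M P) (x : ℝ) :
    ‖φ x‖ ≤ 1024 * (P.scl⁻¹ * (bracket (center P.space) P.scl x ^ 20)⁻¹) := by
  obtain ⟨⟨θ, hθ, rfl⟩, -⟩ := h
  have hl := P.scl_pos
  have h1 := Theta.norm_le hM hθ (P.scl⁻¹ * (x - center P.space))
  have h2 : ‖Mod (center P.freq) (Tr (center P.space) (Dil P.scl θ)) x‖ =
      P.scl⁻¹ * ‖θ (P.scl⁻¹ * (x - center P.space))‖ := by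
    simp only [Mod, Tr, Dil, norm_mul]
    have : ‖Complex.exp (Complex.I * (center P.freq : ℂ) * (x : ℂ))‖ = 1 := by
      rw [Complex.norm_exp]; simp
    rw [this, Complex.norm_real, Real.norm_of_nonneg (by positivity), one_mul]
  have h3 : bracket (center P.space) P.scl x = 1 + |P.scl⁻¹ * (x - center P.space)| := by
    rw [bracket, abs_mul, abs_of_pos (inv_pos.2 hl)]; ring
  rw [h2, h3]
  calc _ ≤ P.scl⁻¹ * (1024 * ((1 + |P.scl⁻¹ * (x - center P.space)|) ^ 20)⁻¹) := by gcongr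
    _ = _ := by ring

theorem Phi.enorm_le (hM : 20 ≤ M) (h : φ ∈ Phi M P) (x : ℝ) :
    ‖φ x‖ₑ ≤ 1024 * (ENNReal.ofReal P.scl⁻¹ * wt (center P.space) P.scl 20 x) := by
  have hl := P.scl_pos
  have := enorm_le_of_norm_le (Phi.norm_le hM h x)
  rw [ENNReal.ofReal_mul (by norm_num), ENNReal.ofReal_mul (by positivity)] at this
  simpa [wt] using this

/-- A wave packet, demodulated by a nearby frequency outside of its frequency interval. -/
theorem Phi.isMolecule (hM : 20 ≤ M) (h : φ ∈ Phi M P) {ξ : ℝ}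
    (hξ : ξ ∈ D'.parent 1 P.freq) (hn : ξ ∉ P.freq) :
    IsMolecule 4096 (center P.space) P.scl
      (fun x => conj (Complex.exp (-(Complex.I * (x : ℂ) * (ξ : ℂ))) * φ x)) := by
  have hφ := h
  obtain ⟨⟨θ, hθ, rfl⟩, hsupp⟩ := h
  set φ := Mod (center P.freq) (Tr (center P.space) (Dil P.scl θ)) with hφdef
  set c := center P.space
  set l := P.scl
  have hl : 0 < l := P.scl_pos
  have hm1 : ∀ x : ℝ, ‖Complex.exp (-(Complex.I * (x : ℂ) * (ξ : ℂ)))‖ = 1 := fun x => by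
    rw [Complex.norm_exp]; simp
  have hθd : ∀ z, HasDerivAt θ (deriv θ z) z := fun z =>
    ((Theta.contDiff hM hθ).differentiable one_ne_zero z).hasDerivAt
  -- The remaining modulation has frequency at most `2 / l`, so differentiating it costs no more
  -- than differentiating the profile: `2 · 1024 + 1024 ≤ 4096`.
  set η : ℝ := center P.freq - ξ with hη
  have hηle : |η| ≤ 2 * l⁻¹ := P.abs_freq_sub_le
    (D'.subset_parent P.freq_mem (D'.isBoundedInterval _ P.freq_mem).center_mem) hξ
  set χ : ℝ → ℂ := fun x => Complex.exp (Complex.I * (η : ℂ) * (x : ℂ)) *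
    (((l⁻¹ : ℝ) : ℂ) * θ (l⁻¹ * (x - c))) with hχ
  have hχe : (fun x : ℝ => Complex.exp (-(Complex.I * (x : ℂ) * (ξ : ℂ))) * φ x) = χ := by
    ext x
    simp only [hφdef, hχ, Mod, Tr, Dil, ← mul_assoc, ← Complex.exp_add]
    congr 3
    rw [hη]; push_cast; ring
  have hχd : ∀ x : ℝ, HasDerivAt χ (Complex.exp (Complex.I * (η : ℂ) * (x : ℂ)) *
      (Complex.I * (η : ℂ)) * (((l⁻¹ : ℝ) : ℂ) * θ (l⁻¹ * (x - c))) +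
      Complex.exp (Complex.I * (η : ℂ) * (x : ℂ)) * (((l⁻¹ : ℝ) : ℂ) *
        (((l⁻¹ : ℝ) : ℂ) * deriv θ (l⁻¹ * (x - c))))) x := by
    intro x
    have e1 : HasDerivAt (fun x : ℝ => Complex.exp (Complex.I * (η : ℂ) * (x : ℂ)))
        (Complex.exp (Complex.I * (η : ℂ) * (x : ℂ)) * (Complex.I * (η : ℂ))) x := by
      have := ((hasDerivAt_id x).ofReal_comp.const_mul (Complex.I * (η : ℂ))).cexp
      simpa using this
    have e2 : HasDerivAt (fun x : ℝ => θ (l⁻¹ * (x - c)))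
        (((l⁻¹ : ℝ) : ℂ) * deriv θ (l⁻¹ * (x - c))) x := by
      have h0 : HasDerivAt (fun x : ℝ => l⁻¹ * (x - c)) l⁻¹ x := by
        simpa using ((hasDerivAt_id x).sub_const c).const_mul l⁻¹
      have := HasDerivAt.scomp x (hθd _) h0
      simpa [Function.comp_def] using this
    exact e1.mul (e2.const_mul _)
  have hbr : ∀ x, bracket c l x = 1 + |l⁻¹ * (x - c)| := fun x => by
    rw [bracket, abs_mul, abs_of_pos (inv_pos.2 hl)]; ring
  refine ⟨?_, ?_, ?_, ?_⟩
  · have h1 : ContDiff ℝ 1 χ := by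
      have hθ1 := Theta.contDiff hM hθ
      have hofr : ContDiff ℝ 1 (fun x : ℝ => (x : ℂ)) := Complex.ofRealCLM.contDiff
      have hlin : ContDiff ℝ 1 (fun x : ℝ => l⁻¹ * (x - c)) := by fun_prop
      exact ((contDiff_const.mul hofr).cexp).mul (contDiff_const.mul (hθ1.comp hlin))
    rw [hχe.symm] at h1
    exact Complex.conjCLE.contDiff.comp h1
  · intro x
    rw [RCLike.norm_conj, norm_mul, hm1, one_mul]
    have hb := bracket_pos (c := c) (x := x) hl
    refine (Phi.norm_le hM hφ x).trans ?_
    gcongr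
    norm_num
  · intro x
    have hb := bracket_pos (c := c) (x := x) hl
    have hd : deriv (fun x : ℝ => conj (Complex.exp (-(Complex.I * (x : ℂ) * (ξ : ℂ))) * φ x)) x =
        conj (deriv χ x) := by
      have h2 : HasDerivAt (fun x => conj (χ x)) (conj (deriv χ x)) x := by
        have := (hχd x).differentiableAt.hasDerivAt
        exact (Complex.conjCLE.toContinuousLinearMap.hasFDerivAt.comp_hasDerivAt x this)
      rw [← hχe] at h2
      rw [h2.deriv, hχe]
    rw [hd, RCLike.norm_conj, (hχd x).deriv]
    have hm2 : ‖Complex.exp (Complex.I * (η : ℂ) * (x : ℂ))‖ = 1 := by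
      rw [Complex.norm_exp]; simp
    have b1 := Theta.norm_le hM hθ (l⁻¹ * (x - c))
    have b2 := Theta.norm_deriv_le hM hθ (l⁻¹ * (x - c))
    rw [← hbr] at b1 b2
    calc _ ≤ |η| * (l⁻¹ * ‖θ (l⁻¹ * (x - c))‖) + l⁻¹ * (l⁻¹ * ‖deriv θ (l⁻¹ * (x - c))‖) := by
          refine (norm_add_le _ _).trans (le_of_eq ?_)
          simp only [norm_mul, hm2, Complex.norm_I, Complex.norm_real, one_mul, Real.norm_eq_abs,
            abs_of_pos (inv_pos.2 hl)]
      _ ≤ (2 * l⁻¹) * (l⁻¹ * (1024 * (bracket c l x ^ 20)⁻¹)) +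
          l⁻¹ * (l⁻¹ * (1024 * (bracket c l x ^ 20)⁻¹)) := by gcongr
      _ = 3072 * (l⁻¹ * (l⁻¹ * (bracket c l x ^ 20)⁻¹)) := by ring
      _ ≤ _ := by gcongr; norm_num
  · rw [integral_conj]
    -- The mean of the demodulated packet is, up to a constant and conjugation, its Fourier
    -- transform at `ξ`, which lies outside the frequency support.
    have h0 : fourierT φ ξ = 0 := image_eq_zero_of_notMem_tsupport fun h' => hn (hsupp h')
    rw [fourierT, mul_eq_zero] at h0
    have h1 : ∫ x : ℝ, φ x * Complex.exp (-(Complex.I * (x : ℂ) * (ξ : ℂ))) = 0 := by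
      apply h0.resolve_left
      refine Complex.ofReal_ne_zero.2 ?_
      have := Real.pi_pos
      positivity
    simp_rw [mul_comm _ (φ _)]
    rw [h1, map_zero]

/-- Mean value inequality in `ν`. The normalization of `∂_ν ψ` makes the change smaller than the
packet itself by the dimensionless factor `|ν - ξ| ℓ_P`. -/
theorem Psi.norm_sub_le {ψ : ℝ → ℝ → ℂ} (hM : 20 ≤ M) (h : ψ ∈ Psi M P) (x ν ξ : ℝ) :
    ‖ψ x ν - ψ x ξ‖ ≤ 1024 * ((bracket (center P.space) P.scl x ^ 20)⁻¹ * |ν - ξ|) := by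
  have hl := P.scl_pos
  have hd : Differentiable ℝ (fun s => ψ x s) := by
    have h1 : ContDiff ℝ M (fun s : ℝ => ψ x s) :=
      h.1.comp (contDiff_const.prodMk contDiff_id)
    exact h1.differentiable (by exact_mod_cast (by omega : M ≠ 0))
  have hb := bracket_pos (c := center P.space) (x := x) hl
  have hder : ∀ s, ‖deriv (fun s => ψ x s) s‖ ≤
      1024 * (bracket (center P.space) P.scl x ^ 20)⁻¹ := by
    intro s
    have h2 := Phi.norm_le hM (h.2 s).2 x
    rw [norm_mul, Complex.norm_real, Real.norm_of_nonneg (by positivity)] at h2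
    have h3 : P.scl⁻¹ * ‖deriv (fun s => ψ x s) s‖ ≤
      P.scl⁻¹ * (1024 * (bracket (center P.space) P.scl x ^ 20)⁻¹) := by linarith
    exact le_of_mul_le_mul_left h3 (inv_pos.2 hl)
  have := convex_univ.norm_image_sub_le_of_norm_deriv_le (fun s _ => hd s) (fun s _ => hder s)
    (mem_univ ξ) (mem_univ ν)
  rw [Real.norm_eq_abs] at this
  linarith

theorem Psi.enorm_sub_le {ψ : ℝ → ℝ → ℂ} (hM : 20 ≤ M) (h : ψ ∈ Psi M P) (x ν ξ : ℝ) :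
    ‖ψ x ν - ψ x ξ‖ₑ ≤ 1024 * (ENNReal.ofReal P.scl⁻¹ *
      (ENNReal.ofReal (|ν - ξ| * P.scl) * wt (center P.space) P.scl 20 x)) := by
  have hl := P.scl_pos
  have hb := bracket_pos (c := center P.space) (x := x) hl
  have h1 := enorm_le_of_norm_le (Psi.norm_sub_le hM h x ν ξ)
  refine h1.trans (le_of_eq ?_)
  rw [wt, ← ENNReal.ofReal_mul (by positivity), ← ENNReal.ofReal_mul (by positivity),
    ← ENNReal.ofReal_ofNat, ← ENNReal.ofReal_mul (by norm_num)]
  congr 1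
  field_simp

/-- The trivial bound for the modified transform. -/
theorem modifiedTransform_le (hM : 20 ≤ M) (N : ℝ → ℝ) (f : ℝ → ℂ) :
    modifiedTransform M N f P ≤ 1024 * (ENNReal.ofReal P.scl⁻¹ *
      ∫⁻ x, (N ⁻¹' D'.sibling P.freq).indicator (fun x => ‖f x‖ₑ) x *
        wt (center P.space) P.scl 20 x) := by
  refine iSup₂_le fun ψ hψ => ?_
  refine (enorm_integral_le_lintegral_enorm _).trans ?_
  rw [← lintegral_const_mul' _ _ ENNReal.ofReal_ne_top, ← lintegral_const_mul' _ _ (by norm_num)]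
  apply lintegral_mono
  intro x
  by_cases hx : x ∈ N ⁻¹' D'.sibling P.freq
  · simp only [indicator_of_mem hx, enorm_mul, RCLike.enorm_conj]
    calc _ ≤ ‖f x‖ₑ * (1024 * (ENNReal.ofReal P.scl⁻¹ * wt (center P.space) P.scl 20 x)) := by
          gcongr; exact Phi.enorm_le hM (hψ.2 (N x)).1 x
      _ = _ := by ring
  · simp [indicator_of_notMem hx]

end Phi

/-! ### Density -/

theorem exists_nat_le_two_pow (r : ℝ) : ∃ k : ℕ, r ≤ 2 ^ k := by
  obtain ⟨k, hk⟩ := pow_unbounded_of_one_lt r (one_lt_two (α := ℝ))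
  exact ⟨k, hk.le⟩

theorem exists_two_pow_near {r : ℝ} (hr : 1 ≤ r) : ∃ k : ℕ, r ≤ 2 ^ k ∧ (2 : ℝ) ^ k ≤ 2 * r := by
  classical
  have hex := exists_nat_le_two_pow r
  refine ⟨Nat.find hex, Nat.find_spec hex, ?_⟩
  rcases Nat.eq_zero_or_pos (Nat.find hex) with h | h
  · rw [h]; linarith
  · obtain ⟨m, hm⟩ := Nat.exists_eq_succ_of_ne_zero h.ne'
    have := Nat.find_min hex (m := m) (by omega)
    push Not at this
    rw [hm, Nat.succ_eq_add_one, pow_succ]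
    linarith

/-- Decay of order `a + 1` against growth of order `a` leaves one summable factor `2^{-k}`. -/
theorem ENNReal_two_inv_pow_mul (a k : ℕ) :
    (2⁻¹ : ℝ≥0∞) ^ ((a + 1) * k) * 2 ^ (a * k) = 2⁻¹ ^ k := by
  have : (a + 1) * k = k + a * k := by ring
  rw [this, pow_add, mul_assoc, ← mul_pow, ENNReal.inv_mul_cancel (by norm_num) (by norm_num),
    one_pow, mul_one]

/-- Averages over dilates of an interval control the integral against a decaying weight. -/
theorem lintegral_mul_wt_le {h : ℝ → ℝ≥0∞} (hh : Measurable h) {c l : ℝ} (hl : 0 < l) {a : ℕ}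
    {lam : ℝ≥0∞} (hk : ∀ k : ℕ, ∫⁻ x in Icc (c - 2 ^ k * l) (c + 2 ^ k * l), h x ≤
      lam * 2 ^ (a * k) * ENNReal.ofReal l) :
    ∫⁻ x, h x * wt c l (a + 1) x ≤ 2 ^ (a + 2) * lam * ENNReal.ofReal l := by
  -- A single dilate suffices at each point: the one whose factor `2^k` is comparable to the
  -- bracket.
  have hpt : ∀ x, h x * wt c l (a + 1) x ≤ ∑' k : ℕ, (2 ^ (a + 1) * 2⁻¹ ^ ((a + 1) * k)) *
      (Icc (c - 2 ^ k * l) (c + 2 ^ k * l)).indicator h x := by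
    intro x
    obtain ⟨k, hk1, hk2⟩ := exists_two_pow_near (one_le_bracket (c := c) (x := x) hl)
    refine le_trans ?_ (ENNReal.le_tsum k)
    have hb := bracket_pos (c := c) (x := x) hl
    have hx : x ∈ Icc (c - 2 ^ k * l) (c + 2 ^ k * l) := by
      have : |x - c| ≤ 2 ^ k * l := by
        have h1 := mul_bracket (c := c) (x := x) hl
        nlinarith
      rw [abs_le] at this
      constructor <;> linarith
    rw [indicator_of_mem hx, mul_comm]
    gcongr
    rw [wt]
    have h1 : ((bracket c l x) ^ (a + 1))⁻¹ ≤ 2 ^ (a + 1) * (2⁻¹ : ℝ) ^ ((a + 1) * k) := by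
      rw [mul_comm (a + 1) k, pow_mul, ← mul_pow, ← inv_pow]
      apply pow_le_pow_left₀ (by positivity)
      rw [inv_le_iff_one_le_mul₀ hb, inv_pow]
      have : (0 : ℝ) < 2 ^ k := by positivity
      field_simp
      linarith
    refine (ENNReal.ofReal_le_ofReal h1).trans (le_of_eq ?_)
    rw [ENNReal.ofReal_mul (by positivity), ENNReal.ofReal_pow (by norm_num),
      ENNReal.ofReal_pow (by norm_num), ENNReal.ofReal_inv_of_pos (by norm_num)]
    simp
  calc _ ≤ ∫⁻ x, ∑' k : ℕ, (2 ^ (a + 1) * 2⁻¹ ^ ((a + 1) * k)) *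
      (Icc (c - 2 ^ k * l) (c + 2 ^ k * l)).indicator h x := lintegral_mono hpt
    _ = ∑' k : ℕ, (2 ^ (a + 1) * 2⁻¹ ^ ((a + 1) * k)) *
        ∫⁻ x in Icc (c - 2 ^ k * l) (c + 2 ^ k * l), h x := by
        rw [lintegral_tsum fun k => ((hh.indicator measurableSet_Icc).const_mul _).aemeasurable]
        congr 1 with k
        rw [lintegral_const_mul _ (hh.indicator measurableSet_Icc),
          lintegral_indicator measurableSet_Icc]
    _ ≤ ∑' k : ℕ, (2 ^ (a + 1) * lam * ENNReal.ofReal l) * 2⁻¹ ^ k := by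
        apply ENNReal.tsum_le_tsum
        intro k
        calc _ ≤ (2 ^ (a + 1) * 2⁻¹ ^ ((a + 1) * k)) * (lam * 2 ^ (a * k) * ENNReal.ofReal l) := by
              gcongr; exact hk k
          _ = (2 ^ (a + 1) * lam * ENNReal.ofReal l) * (2⁻¹ ^ ((a + 1) * k) * 2 ^ (a * k)) := by
              ring
          _ = _ := by rw [ENNReal_two_inv_pow_mul]
    _ = _ := by
        rw [ENNReal.tsum_mul_left, ENNReal.tsum_geometric, ENNReal.one_sub_inv_two, inv_inv]
        ring

/-- The density of `h` near the tile `P`, over all pairs of intervals above `P`, is at most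
`lam`. -/
def DensityLE {D D' : DyadicGrid} (J : Set ℝ) (N : ℝ → ℝ) (h : ℝ → ℝ≥0∞) (lam : ℝ≥0)
    (P : Tile D D') : Prop :=
  ∀ I ∈ D.intervals, ∀ Q ∈ D'.intervals, P.space ⊆ I → I ⊆ J → Q ⊆ D'.parent 1 P.freq →
    len I * len Q = 2 → ∀ k : ℕ,
      ∫⁻ x in Icc (center I - 2 ^ k * len I) (center I + 2 ^ k * len I) ∩ N ⁻¹' Q, h x ≤
        lam * 2 ^ (4 * k) * ENNReal.ofReal (len I)

/-! ### Finite families of tiles of one tree: distance function and star set -/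

section Family
variable {D D' : DyadicGrid}

/-- The distance function of a finite family of tiles. -/
noncomputable def tileDist (s : Finset (Tile D D')) (hs : s.Nonempty) (x : ℝ) : ℝ :=
  s.inf' hs fun P => P.scl + |x - center P.space|

section TileDist
variable {s : Finset (Tile D D')} {hs : s.Nonempty}

theorem tileDist_le {P : Tile D D'} (hP : P ∈ s) (x : ℝ) :
    tileDist s hs x ≤ P.scl + |x - center P.space| :=
  Finset.inf'_le _ hP

theorem tileDist_le_bracket {P : Tile D D'} (hP : P ∈ s) (x : ℝ) :
    tileDist s hs x ≤ P.scl * bracket (center P.space) P.scl x := by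
  rw [mul_bracket P.scl_pos]; exact tileDist_le hP x

theorem exists_tileDist_eq (x : ℝ) :
    ∃ P ∈ s, tileDist s hs x = P.scl + |x - center P.space| :=
  Finset.exists_mem_eq_inf' hs _

theorem tileDist_lip (x y : ℝ) : tileDist s hs x ≤ tileDist s hs y + |x - y| := by
  obtain ⟨P, hP, h⟩ := exists_tileDist_eq (hs := hs) y
  rw [h]
  have h1 := tileDist_le (hs := hs) hP x
  have h2 := abs_sub_le x y (center P.space)
  linarith

theorem exists_pos_le_tileDist : ∃ δ > 0, ∀ x, δ ≤ tileDist s hs x := by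
  refine ⟨s.inf' hs fun P => P.scl, ?_, ?_⟩
  · rw [gt_iff_lt, Finset.lt_inf'_iff]
    exact fun P _ => P.scl_pos
  · intro x
    obtain ⟨P, hP, h⟩ := exists_tileDist_eq (hs := hs) x
    rw [h]
    have := Finset.inf'_le (fun P : Tile D D' => P.scl) hP
    linarith [abs_nonneg (x - center P.space)]

theorem tileDist_pos (x : ℝ) : 0 < tileDist s hs x := by
  obtain ⟨δ, hδ, h⟩ := exists_pos_le_tileDist (hs := hs)
  exact hδ.trans_le (h x)

theorem measurable_tileDist : Measurable (tileDist s hs) := measurable_of_lip tileDist_lip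

end TileDist

/-- The set of the frequencies seen by the modified wave packets of `P`. -/
def freqSet (N : ℝ → ℝ) (P : Tile D D') : Set ℝ := N ⁻¹' D'.sibling P.freq

/-- The points seen by a tile of the family that is large at the point. -/
def starSet (N : ℝ → ℝ) (s : Finset (Tile D D')) (hs : s.Nonempty) : Set ℝ :=
  {x | ∃ P ∈ s, 4 * tileDist s hs x ≤ P.scl ∧ x ∈ freqSet N P}

/-- A finite family of tiles belonging to one tree, with at most one tile over each interval and
with controlled density. -/
structure IsFamily (J : Set ℝ) (N : ℝ → ℝ) (h : ℝ → ℝ≥0∞) (lam : ℝ≥0) (ξ c l : ℝ)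
    (s : Finset (Tile D D')) : Prop where
  dual : D.Dual D'
  mem_J : J ∈ D.intervals
  meas_N : Measurable N
  meas_h : Measurable h
  subset : ∀ P ∈ s, P.space ⊆ J
  scl_le : ∀ P ∈ s, P.scl ≤ l
  center_le : ∀ P ∈ s, |center P.space - c| ≤ l / 2
  freq : ∀ P ∈ s, ξ ∈ D'.parent 1 P.freq
  sep : ∀ P ∈ s, ∀ R ∈ s, P ≠ R → P.scl = R.scl → P.scl ≤ |center P.space - center R.space|
  dens : ∀ P ∈ s, DensityLE J N h lam P

variable {J : Set ℝ} {N : ℝ → ℝ} {h : ℝ → ℝ≥0∞} {lam : ℝ≥0} {ξ c l : ℝ} {s : Finset (Tile D D')}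

theorem measurableSet_freqSet (hN : Measurable N) (P : Tile D D') :
    MeasurableSet (freqSet N P) := hN (D'.measurableSet_sibling P.freq_mem)

theorem measurableSet_starSet (hN : Measurable N) (hs : s.Nonempty) :
    MeasurableSet (starSet N s hs) := by
  have : starSet N s hs = ⋃ P ∈ s, ({x | 4 * tileDist s hs x ≤ P.scl} ∩ freqSet N P) := by
    ext x; simp only [starSet, mem_iUnion, mem_inter_iff, mem_ofPred_eq, exists_prop]
  rw [this]
  apply Finset.measurableSet_biUnion
  intro P _
  exact (measurableSet_le (measurable_tileDist.const_mul 4) measurable_const).inter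
    (measurableSet_freqSet hN P)

/-- At a star point `4 d(x)` is at most the top length `l`, so `x` is within `l / 4` of the center
of some tile, itself within `l / 2` of `c`. -/
theorem starSet_dist_le (hF : IsFamily J N h lam ξ c l s) {hs : s.Nonempty} {x : ℝ}
    (hx : x ∈ starSet N s hs) : |x - c| ≤ l ∧ tileDist s hs x ≤ l := by
  obtain ⟨P, hP, h1, -⟩ := hx
  obtain ⟨R, hR, h2⟩ := exists_tileDist_eq (hs := hs) x
  have h3 := hF.center_le R hR
  have h4 := hF.scl_le P hP
  have h5 := R.scl_pos
  have h6 := abs_nonneg (x - center R.space)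
  have h7 := abs_sub_le x (center R.space) c
  constructor <;> linarith

theorem IsFamily.l_pos (hF : IsFamily J N h lam ξ c l s) (hs : s.Nonempty) : 0 < l := by
  obtain ⟨P, hP⟩ := hs
  exact P.scl_pos.trans_le (hF.scl_le P hP)

/-- The averages of `h` over the star set at the variable scale are controlled by the density. -/
theorem IsFamily.star_average_le (hF : IsFamily J N h lam ξ c l s) (hs : s.Nonempty) (y : ℝ) :
    ∫⁻ x in Icc (y - tileDist s hs y / 2) (y + tileDist s hs y / 2),
      (starSet N s hs).indicator h x ≤ (32 * lam : ℝ≥0) * ENNReal.ofReal (tileDist s hs y) := by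
  set d := tileDist s hs with hd
  have hm := measurableSet_starSet (N := N) hF.meas_N hs
  rw [setLIntegral_indicator hm]
  -- Within `d y / 2` of `y` one has `d y ≤ 2 d x`, so being large at `x` passes to `y` with half
  -- the constant.
  have hlarge : ∀ x ∈ starSet N s hs ∩ Icc (y - d y / 2) (y + d y / 2),
      ∃ P ∈ s, 2 * d y ≤ P.scl ∧ x ∈ freqSet N P := by
    rintro x ⟨⟨P, hP, h1, h2⟩, hx⟩
    refine ⟨P, hP, ?_, h2⟩
    have h3 := tileDist_lip (hs := hs) y x
    have h4 : |y - x| ≤ d y / 2 := by rw [abs_le]; constructor <;> linarith [hx.1, hx.2]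
    rw [← hd] at h1 h3
    linarith
  rcases (starSet N s hs ∩ Icc (y - d y / 2) (y + d y / 2)).eq_empty_or_nonempty with he | ⟨x₀, hx₀⟩
  · rw [he]; simp
  obtain ⟨P₁, hP₁, hl₁, -⟩ := hlarge x₀ hx₀
  obtain ⟨P₀, hP₀, hd₀⟩ := exists_tileDist_eq (hs := hs) y
  rw [← hd] at hd₀
  have hdy : 0 < d y := tileDist_pos y
  -- `I` is the ancestor of the nearest tile `P₀` whose length lies between `d y` and `2 d y`. `Q`
  -- is the ancestor of the parent frequency interval of a large tile with `|I| |Q| = 2`; duality of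
  -- the grids provides this length.
  obtain ⟨k, hk1, hk2⟩ := exists_mem_Ioc_zpow (div_pos hdy D.rho_pos) (one_lt_two (α := ℝ))
  rw [lt_div_iff₀ D.rho_pos] at hk1
  rw [div_le_iff₀ D.rho_pos, zpow_add₀ (by norm_num), zpow_one] at hk2
  have hscl₀ : P₀.scl ≤ d y := by rw [hd₀]; linarith [abs_nonneg (y - center P₀.space)]
  obtain ⟨I, hI, hIl, hIs⟩ := D.exists_ancestor P₀.space_mem (k + 1) (by
    rw [zpow_add₀ (by norm_num), zpow_one]
    calc len P₀.space ≤ d y := hscl₀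
      _ ≤ _ := by linarith)
  rw [zpow_add₀ (by norm_num), zpow_one] at hIl
  have hI1 : d y ≤ len I := by rw [hIl]; linarith
  have hI2 : len I ≤ 2 * d y := by rw [hIl]; linarith
  have hIb := D.isBoundedInterval I hI
  have hIpos := hIb.len_pos
  have hIJ : I ⊆ J := by
    obtain ⟨z, hz⟩ := (D.isBoundedInterval _ P₀.space_mem).nonempty
    apply D.subset_of_nonempty hI hF.mem_J ⟨z, hIs hz, hF.subset P₀ hP₀ hz⟩
    have := (D.isBoundedInterval _ P₁.space_mem).len_le (D.isBoundedInterval _ hF.mem_J)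
      (hF.subset P₁ hP₁)
    have h2 : P₁.scl = len P₁.space := rfl
    linarith
  have hQlen : ∀ P : Tile D D', len (D'.parent 1 P.freq) = 2 / P.scl := fun P => by
    rw [D'.len_parent P.freq_mem, P.len_freq]; ring
  obtain ⟨Q, hQ, hQl, hQs⟩ := D'.exists_ancestor (D'.parent_mem P₁.freq_mem) (-k) (by
    rw [hQlen]
    have hdual : D'.rho = D.rho⁻¹ := eq_inv_of_mul_eq_one_right hF.dual
    have hs1 := P₁.scl_pos
    have h2k : (0 : ℝ) < 2 ^ k := by positivity
    rw [hdual, zpow_neg, ← mul_inv, ← one_div, div_le_div_iff₀ hs1 (mul_pos D.rho_pos h2k)]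
    linarith)
  have hIQ : len I * len Q = 2 := by
    have hdual : D'.rho = D.rho⁻¹ := eq_inv_of_mul_eq_one_right hF.dual
    have h2k : (2 : ℝ) ^ k ≠ 0 := by positivity
    have := D.rho_pos.ne'
    rw [hIl, hQl, hdual, zpow_neg]
    field_simp
  have hQl' : len Q = 2 / len I := by field_simp; linarith
  have hξQ : ξ ∈ Q := hQs (hF.freq P₁ hP₁)
  have hQ0 : Q ⊆ D'.parent 1 P₀.freq := by
    apply D'.subset_of_nonempty hQ (D'.parent_mem P₀.freq_mem) ⟨ξ, hξQ, hF.freq P₀ hP₀⟩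
    rw [hQlen, hQl']
    have := P₀.scl_pos
    gcongr
    linarith
  -- All parent frequency intervals contain `ξ`, so those of the large tiles are nested inside `Q`.
  -- A single rectangle above `P₀` therefore captures every star point near `y`.
  have hQall : ∀ P ∈ s, 2 * d y ≤ P.scl → D'.sibling P.freq ⊆ Q := by
    intro P hP hPl
    refine D'.sibling_subset_parent.trans ?_
    apply D'.subset_of_nonempty (D'.parent_mem P.freq_mem) hQ ⟨ξ, hF.freq P hP, hξQ⟩
    rw [hQlen, hQl']
    gcongr
    linarith
  -- The dilate with `k = 1` suffices: `|x - y| ≤ d y / 2`, `|y - c_{P₀}| ≤ d y` and `|c_{P₀} - c_I|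
  -- ≤ |I| / 2` add up to at most `2 |I|`.
  have hdens := hF.dens P₀ hP₀ I hI Q hQ hIs hIJ hQ0 hIQ 1
  calc _ ≤ ∫⁻ x in Icc (center I - 2 ^ 1 * len I) (center I + 2 ^ 1 * len I) ∩ N ⁻¹' Q, h x := by
        apply lintegral_mono_set
        intro x hx
        obtain ⟨P, hP, hPl, hxP⟩ := hlarge x hx
        refine ⟨?_, hQall P hP hPl hxP⟩
        have h1 : |x - y| ≤ d y / 2 := by rw [abs_le]; constructor <;> linarith [hx.2.1, hx.2.2]
        have h2 := hIb.abs_sub_center_le (hIs (D.isBoundedInterval _ P₀.space_mem).center_mem)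
        have h3 := abs_sub_le x y (center I)
        have h4 := abs_sub_le y (center P₀.space) (center I)
        have h5 : |y - center P₀.space| ≤ d y := by rw [hd₀]; linarith [P₀.scl_pos]
        have h6 : |x - center I| ≤ 2 * len I := by linarith
        rw [abs_le] at h6
        constructor <;> linarith
    _ ≤ lam * 2 ^ (4 * 1) * ENNReal.ofReal (len I) := hdens
    _ ≤ lam * 2 ^ (4 * 1) * ENNReal.ofReal (2 * d y) := by gcongr
    _ = _ := by
        rw [ENNReal.ofReal_mul (by norm_num)]
        push_cast
        norm_num
        ring

end Family

/-! ### Weighted masses of a family of tiles -/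

section FamilyEstimates
variable {D D' : DyadicGrid}
variable {J : Set ℝ} {N : ℝ → ℝ} {h : ℝ → ℝ≥0∞} {lam : ℝ≥0} {ξ c l : ℝ} {s : Finset (Tile D D')}

/-- The weight attached to a tile. -/
noncomputable def Tile.wt (P : Tile D D') (n : ℕ) (x : ℝ) : ℝ≥0∞ :=
  WavePacket.wt (center P.space) P.scl n x

theorem Tile.measurable_wt (P : Tile D D') {n : ℕ} : Measurable (P.wt n) :=
  WavePacket.measurable_wt

/-- The space interval of `P` and the parent of its frequency interval form an admissible rectangle.
Five powers of decay absorb the growth `2^{4k}`, whence `64 = 2^{4+2}`. -/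
theorem DensityLE.lintegral_mul_wt_le {P : Tile D D'} (hP : DensityLE J N h lam P)
    (hJ : P.space ⊆ J) (hN : Measurable N) (hh : Measurable h) :
    ∫⁻ x, (N ⁻¹' D'.parent 1 P.freq).indicator h x * P.wt 5 x ≤
      64 * lam * ENNReal.ofReal P.scl := by
  have hp := D'.parent_spec P.freq_mem
  have hm : MeasurableSet (N ⁻¹' D'.parent 1 P.freq) :=
    hN (D'.isBoundedInterval _ hp.1).measurableSet
  have := WavePacket.lintegral_mul_wt_le (hh.indicator hm) (c := center P.space) P.scl_pos
    (a := 4) (lam := lam) (by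
      intro k
      rw [setLIntegral_indicator hm, inter_comm]
      refine hP P.space P.space_mem _ hp.1 subset_rfl hJ subset_rfl ?_ k
      have := P.area
      rw [hp.2.1]
      linarith)
  norm_num at this
  exact this

theorem IsFamily.bracket_top_le (hF : IsFamily J N h lam ξ c l s) {P : Tile D D'} (hP : P ∈ s)
    (x : ℝ) : bracket c l x ≤ 2 * bracket (center P.space) P.scl x := by
  have h1 := hF.scl_le P hP
  have h2 := hF.center_le P hP
  have h3 := P.scl_pos
  have h4 : 0 < l := by linarith
  have h5 := abs_sub_le x (center P.space) c
  have h6 : |x - c| / l ≤ |x - center P.space| / P.scl + 1 / 2 := by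
    calc |x - c| / l ≤ (|x - center P.space| + l / 2) / l := by gcongr; linarith
      _ = |x - center P.space| / l + 1 / 2 := by field_simp
      _ ≤ _ := by gcongr
  have h7 : 0 ≤ |x - center P.space| / P.scl := by positivity
  rw [bracket, bracket]
  linarith

theorem IsFamily.wt_two_le (hF : IsFamily J N h lam ξ c l s) {P : Tile D D'} (hP : P ∈ s)
    (x : ℝ) : P.wt 2 x ≤ 4 * wt c l 2 x := by
  have h4 : 0 < l := P.scl_pos.trans_le (hF.scl_le P hP)
  have := wt_le_mul P.scl_pos h4 (by norm_num) 2 (hF.bracket_top_le hP x)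
  norm_num at this
  exact this

/-- Two powers of each weight localize to the top interval; the other two sum the separated tiles
over all scales. -/
theorem IsFamily.sum_min_mul_wt_le (hF : IsFamily J N h lam ξ c l s) {r : ℝ} (hr : 0 < r)
    (x : ℝ) :
    ∑ P ∈ s, ENNReal.ofReal (min (r * P.scl) (r * P.scl)⁻¹) * P.wt 4 x ≤ 288 * wt c l 2 x := by
  calc _ ≤ ∑ P ∈ s, ENNReal.ofReal (min (r * P.scl) (r * P.scl)⁻¹) * P.wt 2 x *
        (4 * wt c l 2 x) := by
        apply Finset.sum_le_sum
        intro P hP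
        have : P.wt 4 x = P.wt 2 x * P.wt 2 x := wt_add P.scl_pos 2 2
        rw [this, ← mul_assoc]
        gcongr
        exact hF.wt_two_le hP x
    _ ≤ 72 * (4 * wt c l 2 x) := by
        rw [← Finset.sum_mul]
        gcongr
        exact WavePacket.sum_min_mul_wt_le s (fun P => center P.space) (fun P => P.scl) D.rho_pos
          (fun P _ => D.length_mem _ P.space_mem) hF.sep hr x
    _ = _ := by rw [← mul_assoc]; norm_num

/-- Because `d(x)` is at most `ℓ_P` times the bracket of `P`, two powers of the weight replace `d /
ℓ_P` by the minimum of `d / ℓ_P` and `ℓ_P / d`, so the scales sum geometrically around `d(x)`. -/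
theorem IsFamily.sum_div_mul_wt_le (hF : IsFamily J N h lam ξ c l s) (hs : s.Nonempty) (x : ℝ) :
    ∑ P ∈ s, ENNReal.ofReal (tileDist s hs x / P.scl) * P.wt 6 x ≤ 288 * wt c l 2 x := by
  refine le_trans ?_ (hF.sum_min_mul_wt_le (inv_pos.2 (tileDist_pos (hs := hs) x)) x)
  apply Finset.sum_le_sum
  intro P hP
  set d := tileDist s hs x with hd
  have hd0 : 0 < d := tileDist_pos x
  have hl := P.scl_pos
  have hb := bracket_pos (c := center P.space) (x := x) hl
  have hdb : d / P.scl ≤ bracket (center P.space) P.scl x := by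
    rw [div_le_iff₀ hl, mul_comm]; exact tileDist_le_bracket hP x
  rw [Tile.wt, Tile.wt, wt, wt, ← ENNReal.ofReal_mul (by positivity),
    ← ENNReal.ofReal_mul (by positivity)]
  apply ENNReal.ofReal_le_ofReal
  have e1 : (d⁻¹ * P.scl)⁻¹ = d / P.scl := by field_simp
  set b := bracket (center P.space) P.scl x
  have hb1 : 1 ≤ b := one_le_bracket hl
  have e2 : (b ^ 6)⁻¹ = (b ^ 2)⁻¹ * (b ^ 4)⁻¹ := by rw [← mul_inv, ← pow_add]
  have hb2 : (b ^ 2)⁻¹ ≤ 1 := inv_le_one_of_one_le₀ (one_le_pow₀ hb1)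
  have hq : 0 < d / P.scl := by positivity
  rw [e1, e2, ← mul_assoc]
  gcongr
  apply le_min
  · have : d⁻¹ * P.scl = (d / P.scl) * ((d / P.scl) ^ 2)⁻¹ := by field_simp
    rw [this]
    gcongr
  · exact mul_le_of_le_one_right hq.le hb2

theorem bracket_le_near {x y : ℝ} (hs : s.Nonempty) {P : Tile D D'} (hP : P ∈ s)
    (hxy : |y - x| ≤ tileDist s hs x / 4) :
    bracket (center P.space) P.scl y ≤ 5 / 4 * bracket (center P.space) P.scl x := by
  have hl := P.scl_pos
  have h1 := tileDist_le (hs := hs) hP x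
  have h2 := mul_bracket (c := center P.space) (x := x) hl
  have h3 := mul_bracket (c := center P.space) (x := y) hl
  have h4 := abs_sub_le y x (center P.space)
  have : P.scl * bracket (center P.space) P.scl y ≤
      P.scl * (5 / 4 * bracket (center P.space) P.scl x) := by nlinarith
  exact le_of_mul_le_mul_left this hl

/-- The required almost constancy at scale `d`: the distance changes by at most `4/3` and the
bracket by at most `5/4`, and `(4/3)(5/4)^20 ≤ 200`. -/
theorem tile_weight_near (hs : s.Nonempty) {P : Tile D D'} (hP : P ∈ s) (x y : ℝ)
    (hxy : |y - x| ≤ tileDist s hs x / 4) :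
    ENNReal.ofReal (tileDist s hs x / P.scl) * P.wt 20 x ≤
      (200 : ℝ≥0) * (ENNReal.ofReal (tileDist s hs y / P.scl) * P.wt 20 y) := by
  have hl := P.scl_pos
  have h1 := wt_le_mul hl hl (by norm_num) 20 (bracket_le_near hs hP hxy)
  have h2 := (ofReal_Lip_pos_bounds (tileDist_lip (hs := hs)) hxy).1
  have h3 := tileDist_pos (hs := hs) y
  calc _ ≤ ENNReal.ofReal (4 / 3 * (tileDist s hs y / P.scl)) *
        (ENNReal.ofReal ((5 / 4) ^ 20) * P.wt 20 y) := by
        gcongr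
        · rw [← mul_div_assoc]; gcongr
        · exact h1
    _ = ENNReal.ofReal (4 / 3 * (5 / 4) ^ 20) *
        (ENNReal.ofReal (tileDist s hs y / P.scl) * P.wt 20 y) := by
        rw [ENNReal.ofReal_mul (by norm_num), ENNReal.ofReal_mul (by norm_num)]; ring
    _ ≤ _ := by
        gcongr
        rw [← ENNReal.ofReal_coe_nnreal]
        apply ENNReal.ofReal_le_ofReal
        norm_num

/-- Any tile of the family bounds `d(x)` by `3 l / 2 + |x - c|`, so the bracket of the top changes
by at most `3/2` at scale `d / 4`. -/
theorem IsFamily.top_weight_near (hF : IsFamily J N h lam ξ c l s) (hs : s.Nonempty) (x y : ℝ)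
    (hxy : |y - x| ≤ tileDist s hs x / 4) : wt c l 2 x ≤ (3 : ℝ≥0) * wt c l 2 y := by
  obtain ⟨P, hP⟩ := hs
  have hl := hF.l_pos ⟨P, hP⟩
  have h1 := tileDist_le (hs := ⟨P, hP⟩) hP x
  have h2 := hF.scl_le P hP
  have h3 := hF.center_le P hP
  have h4 := mul_bracket (c := c) (x := x) hl
  have h5 := mul_bracket (c := c) (x := y) hl
  have h6 := abs_sub_le y x c
  have h7 := abs_sub_le x c (center P.space)
  rw [abs_sub_comm c] at h7
  have h8 := abs_nonneg (x - c)
  have hb : bracket c l y ≤ 3 / 2 * bracket c l x := by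
    have : l * bracket c l y ≤ l * (3 / 2 * bracket c l x) := by nlinarith
    exact le_of_mul_le_mul_left this hl
  refine (wt_le_mul hl hl (by norm_num) 2 hb).trans ?_
  gcongr
  rw [← ENNReal.ofReal_coe_nnreal]
  apply ENNReal.ofReal_le_ofReal
  norm_num

/-- The total mass on the star set. -/
theorem IsFamily.star_mass_le (hF : IsFamily J N h lam ξ c l s) (hs : s.Nonempty) :
    ∫⁻ x, (starSet N s hs).indicator h x * wt c l 2 x ≤ 1152 * lam * ENNReal.ofReal l := by
  have hl := hF.l_pos hs
  have := lintegral_mul_le_of_average tileDist_pos tileDist_lip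
    (hF.meas_h.indicator (measurableSet_starSet hF.meas_N hs)) measurable_wt
    (hF.top_weight_near hs) (hF.star_average_le hs)
  refine this.trans ?_
  rw [lintegral_const_mul _ measurable_wt]
  calc _ ≤ 3 * ((3 : ℝ≥0) : ℝ≥0∞) * (((32 * lam : ℝ≥0) : ℝ≥0∞) * ENNReal.ofReal (4 * l)) := by
        gcongr; exact lintegral_wt_two hl
    _ = _ := by
        rw [ENNReal.ofReal_mul (by norm_num)]
        push_cast
        norm_num
        ring

/-- The mass of the weight of a tile, damped on points close to the family. -/
noncomputable def tailMass (s : Finset (Tile D D')) (hs : s.Nonempty) (P : Tile D D') : ℝ≥0∞ :=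
  ∫⁻ x, ENNReal.ofReal (tileDist s hs x / P.scl) * P.wt 6 x

theorem measurable_div_mul_wt (hs : s.Nonempty) (P : Tile D D') (n : ℕ) :
    Measurable fun x => ENNReal.ofReal (tileDist s hs x / P.scl) * P.wt n x :=
  (measurable_tileDist.div_const _).ennreal_ofReal.mul P.measurable_wt

theorem IsFamily.sum_tailMass_le (hF : IsFamily J N h lam ξ c l s) (hs : s.Nonempty) :
    ∑ P ∈ s, tailMass s hs P ≤ 1152 * ENNReal.ofReal l := by
  unfold tailMass
  rw [← lintegral_finsetSum _ fun P _ => measurable_div_mul_wt hs P 6]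
  calc _ ≤ ∫⁻ x, 288 * wt c l 2 x := lintegral_mono fun x => hF.sum_div_mul_wt_le hs x
    _ = 288 * ∫⁻ x, wt c l 2 x := lintegral_const_mul _ measurable_wt
    _ ≤ 288 * ENNReal.ofReal (4 * l) := by gcongr; exact lintegral_wt_two (hF.l_pos hs)
    _ = _ := by
        rw [ENNReal.ofReal_mul (by norm_num), ← mul_assoc]; norm_num

/-- The factor `d / ℓ_P` costs one power of the bracket and leaves an integrable weight. -/
theorem tailMass_le (hs : s.Nonempty) {P : Tile D D'} (hP : P ∈ s) :
    tailMass s hs P ≤ 4 * ENNReal.ofReal P.scl := by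
  have hl := P.scl_pos
  calc tailMass s hs P ≤ ∫⁻ x, P.wt 5 x := by
        apply lintegral_mono
        intro x
        have hb := bracket_pos (c := center P.space) (x := x) hl
        have hd0 := tileDist_pos (hs := hs) x
        have hdb : tileDist s hs x / P.scl ≤ bracket (center P.space) P.scl x := by
          rw [div_le_iff₀ hl, mul_comm]; exact tileDist_le_bracket hP x
        simp only [Tile.wt, wt]
        rw [← ENNReal.ofReal_mul (by positivity)]
        apply ENNReal.ofReal_le_ofReal
        calc _ ≤ bracket (center P.space) P.scl x * (bracket (center P.space) P.scl x ^ 6)⁻¹ := by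
              gcongr
          _ = _ := by field_simp
    _ ≤ ENNReal.ofReal (4 * P.scl) := lintegral_wt hl (by norm_num)
    _ = _ := by rw [ENNReal.ofReal_mul (by norm_num)]; norm_num

/-- The factor `d / ℓ_P` is what smearing at scale `d` loses against a molecule of `P`; the total
over the family is summable through `tailMass`. -/
theorem IsFamily.star_tile_mass_le (hF : IsFamily J N h lam ξ c l s) (hs : s.Nonempty)
    {P : Tile D D'} (hP : P ∈ s) :
    ∫⁻ x, (starSet N s hs).indicator h x *
      (ENNReal.ofReal (tileDist s hs x / P.scl) * P.wt 20 x) ≤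
        19200 * lam * tailMass s hs P := by
  have := lintegral_mul_le_of_average tileDist_pos tileDist_lip
    (hF.meas_h.indicator (measurableSet_starSet hF.meas_N hs)) (measurable_div_mul_wt hs P 20)
    (tile_weight_near hs hP) (hF.star_average_le hs)
  refine this.trans ?_
  rw [lintegral_const_mul _ (measurable_div_mul_wt hs P 20)]
  calc _ ≤ 3 * ((200 : ℝ≥0) : ℝ≥0∞) * (((32 * lam : ℝ≥0) : ℝ≥0∞) * tailMass s hs P) := by
        gcongr
        apply lintegral_mono
        intro x
        dsimp only
        gcongr 1
        exact wt_anti P.scl_pos (by norm_num)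
    _ = _ := by
        push_cast
        norm_num
        ring

/-- The part of the frequency set of `P` where `P` is small. -/
def smallPart (N : ℝ → ℝ) (s : Finset (Tile D D')) (hs : s.Nonempty) (P : Tile D D') : Set ℝ :=
  freqSet N P ∩ {x | P.scl < 4 * tileDist s hs x}

/-- The part of the frequency set of `P` where `P` is large. -/
def largePart (N : ℝ → ℝ) (s : Finset (Tile D D')) (hs : s.Nonempty) (P : Tile D D') : Set ℝ :=
  freqSet N P ∩ {x | 4 * tileDist s hs x ≤ P.scl}

theorem measurableSet_smallPart (hN : Measurable N) (hs : s.Nonempty) (P : Tile D D') :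
    MeasurableSet (smallPart N s hs P) :=
  (measurableSet_freqSet hN P).inter
    (measurableSet_lt measurable_const (measurable_tileDist.const_mul 4))

theorem measurableSet_largePart (hN : Measurable N) (hs : s.Nonempty) (P : Tile D D') :
    MeasurableSet (largePart N s hs P) :=
  (measurableSet_freqSet hN P).inter
    (measurableSet_le (measurable_tileDist.const_mul 4) measurable_const)

theorem indicator_freqSet_le (hs : s.Nonempty) (P : Tile D D') (x : ℝ) :
    (freqSet N P).indicator h x ≤
      (smallPart N s hs P).indicator h x + (largePart N s hs P).indicator h x := by
  by_cases hx : x ∈ freqSet N P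
  · rcases lt_or_ge P.scl (4 * tileDist s hs x) with h1 | h1
    · have : x ∈ smallPart N s hs P := ⟨hx, h1⟩
      rw [indicator_of_mem hx, indicator_of_mem this]
      exact le_self_add
    · have : x ∈ largePart N s hs P := ⟨hx, h1⟩
      rw [indicator_of_mem hx, indicator_of_mem this]
      exact le_add_self
  · rw [indicator_of_notMem hx]; exact zero_le

theorem largePart_subset_starSet (hs : s.Nonempty) {P : Tile D D'} (hP : P ∈ s) :
    largePart N s hs P ⊆ starSet N s hs := fun _ hx => ⟨P, hP, hx.2, hx.1⟩

theorem freqSet_subset (P : Tile D D') : freqSet N P ⊆ N ⁻¹' D'.parent 1 P.freq :=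
  preimage_mono D'.sibling_subset_parent

/-- Here the density of `P` itself suffices: if its small part comes near `y`, then `ℓ_P ≤ 6 d(y)`,
so passing from averages at scale `ℓ_P` to scale `d(y)` loses only a constant and the dilation
factor. -/
theorem IsFamily.small_average_le (hF : IsFamily J N h lam ξ c l s) (hs : s.Nonempty)
    {P : Tile D D'} (hP : P ∈ s) (y : ℝ) :
    ∫⁻ x in Icc (y - tileDist s hs y / 2) (y + tileDist s hs y / 2),
      (smallPart N s hs P).indicator h x ≤
      (lam * ENNReal.ofReal (486 * bracket (center P.space) P.scl y ^ 4)) *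
        ENNReal.ofReal (tileDist s hs y) := by
  set d := tileDist s hs with hd
  have hl := P.scl_pos
  have hb := one_le_bracket (c := center P.space) (x := y) hl
  rw [setLIntegral_indicator (measurableSet_smallPart hF.meas_N hs P)]
  rcases (smallPart N s hs P ∩ Icc (y - d y / 2) (y + d y / 2)).eq_empty_or_nonempty with
    he | ⟨x₀, hx₀⟩
  · rw [he]; simp
  have hy6 : P.scl ≤ 6 * d y := by
    have h1 : P.scl < 4 * d x₀ := hx₀.1.2
    have h2 := tileDist_lip (hs := hs) x₀ y
    have h3 : |x₀ - y| ≤ d y / 2 := by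
      rw [abs_le]; constructor <;> linarith [hx₀.2.1, hx₀.2.2]
    rw [← hd] at h2
    linarith
  obtain ⟨k, hk1, hk2⟩ := exists_two_pow_near (r := 3 / 2 * bracket (center P.space) P.scl y)
    (by linarith)
  have hp := D'.parent_spec P.freq_mem
  have hdens := hF.dens P hP P.space P.space_mem _ hp.1 subset_rfl (hF.subset P hP) subset_rfl
    (by rw [hp.2.1]; linarith [P.area]) k
  calc _ ≤ ∫⁻ x in Icc (center P.space - 2 ^ k * len P.space)
          (center P.space + 2 ^ k * len P.space) ∩ N ⁻¹' D'.parent 1 P.freq, h x := by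
        apply lintegral_mono_set
        intro x hx
        refine ⟨?_, freqSet_subset P hx.1.1⟩
        have h1 : |x - y| ≤ d y / 2 := by rw [abs_le]; constructor <;> linarith [hx.2.1, hx.2.2]
        have h2 := abs_sub_le x y (center P.space)
        have h3 := tileDist_le (hs := hs) hP y
        have h4 := mul_bracket (c := center P.space) (x := y) hl
        rw [← hd] at h3
        have h5 : |x - center P.space| ≤ 2 ^ k * P.scl := by
          calc _ ≤ 3 / 2 * (P.scl * bracket (center P.space) P.scl y) := by linarith
            _ = 3 / 2 * bracket (center P.space) P.scl y * P.scl := by ring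
            _ ≤ _ := by gcongr
        rw [abs_le, Tile.scl] at h5
        constructor <;> linarith
    _ ≤ lam * 2 ^ (4 * k) * ENNReal.ofReal (len P.space) := hdens
    _ = lam * ENNReal.ofReal ((2 ^ k) ^ 4 * P.scl) := by
        rw [ENNReal.ofReal_mul (by positivity), ENNReal.ofReal_pow (by positivity),
          ENNReal.ofReal_pow (by norm_num), ← pow_mul, mul_comm k 4, mul_assoc]
        norm_num [Tile.scl]
    _ ≤ lam * ENNReal.ofReal (486 * bracket (center P.space) P.scl y ^ 4 * d y) := by
        refine mul_le_mul_right (ENNReal.ofReal_le_ofReal ?_) _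
        calc ((2 : ℝ) ^ k) ^ 4 * P.scl
            ≤ (2 * (3 / 2 * bracket (center P.space) P.scl y)) ^ 4 * (6 * d y) := by gcongr
          _ = _ := by ring
    _ = _ := by rw [ENNReal.ofReal_mul (by positivity), mul_assoc]

/-- On the small part `1 ≤ 4 d / ℓ_P`, so the damping factor of `tailMass` is available for free.
The fourth power of the bracket from the density is absorbed by the decay. -/
theorem IsFamily.small_mass_le (hF : IsFamily J N h lam ξ c l s) (hs : s.Nonempty)
    {P : Tile D D'} (hP : P ∈ s) :
    ∫⁻ x, (smallPart N s hs P).indicator h x * P.wt 20 x ≤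
      1166400 * lam * tailMass s hs P := by
  have hl := P.scl_pos
  have h1 := lintegral_mul_le_of_average tileDist_pos tileDist_lip
    (hF.meas_h.indicator (measurableSet_smallPart hF.meas_N hs P)) (measurable_div_mul_wt hs P 20)
    (tile_weight_near hs hP) (hF.small_average_le hs hP)
  calc _ ≤ ∫⁻ x, 4 * ((smallPart N s hs P).indicator h x *
        (ENNReal.ofReal (tileDist s hs x / P.scl) * P.wt 20 x)) := by
        apply lintegral_mono
        intro x
        by_cases hx : x ∈ smallPart N s hs P
        · simp only [indicator_of_mem hx]
          have h2 : P.scl < 4 * tileDist s hs x := hx.2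
          have h3 : 1 ≤ 4 * ENNReal.ofReal (tileDist s hs x / P.scl) := by
            rw [← ENNReal.ofReal_ofNat, ← ENNReal.ofReal_mul (by norm_num),
              ENNReal.one_le_ofReal, ← mul_div_assoc, le_div_iff₀ hl]
            linarith
          calc _ = 1 * (h x * P.wt 20 x) := by rw [one_mul]
            _ ≤ (4 * ENNReal.ofReal (tileDist s hs x / P.scl)) * (h x * P.wt 20 x) := by gcongr
            _ = _ := by ring
        · simp [indicator_of_notMem hx]
    _ = 4 * ∫⁻ x, ((smallPart N s hs P).indicator h x *
        (ENNReal.ofReal (tileDist s hs x / P.scl) * P.wt 20 x)) :=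
        lintegral_const_mul' _ _ (by norm_num)
    _ ≤ 4 * (3 * ((200 : ℝ≥0) : ℝ≥0∞) * ∫⁻ x, (486 * lam) *
        (ENNReal.ofReal (tileDist s hs x / P.scl) * P.wt 6 x)) := by
        refine mul_le_mul_right (h1.trans (mul_le_mul_right (lintegral_mono fun x => ?_) _)) _
        dsimp only
        have hb := bracket_pos (c := center P.space) (x := x) hl
        rw [ENNReal.ofReal_mul (by norm_num)]
        have e : ENNReal.ofReal (bracket (center P.space) P.scl x ^ 4) * P.wt 20 x ≤ P.wt 6 x := by
          rw [Tile.wt, Tile.wt, wt, wt, ← ENNReal.ofReal_mul (by positivity)]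
          apply ENNReal.ofReal_le_ofReal
          have hb1 := one_le_bracket (c := center P.space) (x := x) hl
          calc _ = (bracket (center P.space) P.scl x ^ 16)⁻¹ := by field_simp
            _ ≤ _ := by gcongr; norm_num
        calc _ = (ENNReal.ofReal 486 * lam) * (ENNReal.ofReal (tileDist s hs x / P.scl) *
              (ENNReal.ofReal (bracket (center P.space) P.scl x ^ 4) * P.wt 20 x)) := by ring
          _ ≤ _ := by
            gcongr
            norm_num
    _ = _ := by
        rw [lintegral_const_mul' _ _ (by finiteness), tailMass]
        push_cast
        norm_num
        ring

/-- Over the points where the tiles are large, the tiles that see a point have one scale. -/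
theorem IsFamily.sum_large_mass_le (hF : IsFamily J N h lam ξ c l s) (hs : s.Nonempty)
    (hdisj : ∀ P ∈ s, ∀ R ∈ s, P.scl ≠ R.scl → Disjoint (freqSet N P) (freqSet N R)) :
    ∑ P ∈ s, ∫⁻ x, (largePart N s hs P).indicator h x * P.wt 20 x ≤
      41472 * lam * ENNReal.ofReal l := by
  classical
  have hmw : ∀ P : Tile D D', Measurable fun x =>
      (largePart N s hs P).indicator h x * P.wt 20 x := fun P =>
    (hF.meas_h.indicator (measurableSet_largePart hF.meas_N hs P)).mul P.measurable_wt
  rw [← lintegral_finsetSum _ fun P _ => hmw P]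
  calc _ ≤ ∫⁻ x, 36 * ((starSet N s hs).indicator h x * wt c l 2 x) := by
        apply lintegral_mono
        intro x
        dsimp only
        rw [← Finset.sum_filter_add_sum_filter_not s (fun P => x ∈ largePart N s hs P)]
        have h0 : ∑ P ∈ s.filter (fun P => x ∉ largePart N s hs P),
            (largePart N s hs P).indicator h x * P.wt 20 x = 0 := by
          apply Finset.sum_eq_zero
          intro P hP
          rw [indicator_of_notMem (Finset.mem_filter.1 hP).2, zero_mul]
        rw [h0, add_zero]
        rcases (s.filter (fun P => x ∈ largePart N s hs P)).eq_empty_or_nonempty with he | ⟨R, hR⟩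
        · rw [he, Finset.sum_empty]; exact zero_le
        rw [Finset.mem_filter] at hR
        have hscl : ∀ P ∈ s.filter (fun P => x ∈ largePart N s hs P), P.scl = R.scl := by
          intro P hP
          rw [Finset.mem_filter] at hP
          by_contra hne
          exact Set.disjoint_left.1 (hdisj P hP.1 R hR.1 hne) hP.2.1 hR.2.1
        have hx := largePart_subset_starSet hs hR.1 hR.2
        rw [indicator_of_mem hx]
        calc _ ≤ ∑ P ∈ s.filter (fun P => x ∈ largePart N s hs P),
              (h x * (4 * wt c l 2 x)) * wt (center P.space) R.scl 2 x := by
              apply Finset.sum_le_sum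
              intro P hP
              have hPs := (Finset.mem_filter.1 hP).1
              rw [indicator_of_mem (Finset.mem_filter.1 hP).2, mul_assoc]
              gcongr
              have e : P.wt 4 x = P.wt 2 x * P.wt 2 x := wt_add P.scl_pos 2 2
              calc P.wt 20 x ≤ P.wt 4 x := wt_anti P.scl_pos (by norm_num)
                _ ≤ (4 * wt c l 2 x) * P.wt 2 x := by
                    rw [e]
                    gcongr
                    exact hF.wt_two_le hPs x
                _ = _ := by rw [Tile.wt, hscl P hP]
          _ ≤ (h x * (4 * wt c l 2 x)) * 9 := by
              rw [← Finset.mul_sum]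
              gcongr
              apply sum_wt_le _ _ R.scl_pos
              intro P hP P' hP' hne
              have := hF.sep P (Finset.mem_filter.1 hP).1 P' (Finset.mem_filter.1 hP').1 hne
                (by rw [hscl P hP, hscl P' hP'])
              rwa [hscl P hP] at this
          _ = 36 * (h x * wt c l 2 x) := by
              rw [show (36 : ℝ≥0∞) = 4 * 9 by norm_num]; ring
    _ = 36 * ∫⁻ x, ((starSet N s hs).indicator h x * wt c l 2 x) :=
        lintegral_const_mul' _ _ (by norm_num)
    _ ≤ 36 * (1152 * lam * ENNReal.ofReal l) := by gcongr; exact hF.star_mass_le hs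
    _ = _ := by
        rw [← mul_assoc, ← mul_assoc]; norm_num

/-- The error made by freezing the frequency. -/
noncomputable def freezeMass (N : ℝ → ℝ) (h : ℝ → ℝ≥0∞) (ξ : ℝ) (s : Finset (Tile D D'))
    (hs : s.Nonempty) (P : Tile D D') : ℝ≥0∞ :=
  ∫⁻ x, (largePart N s hs P).indicator h x * (ENNReal.ofReal (|N x - ξ| * P.scl) * P.wt 20 x)

theorem IsFamily.abs_sub_mul_le (hF : IsFamily J N h lam ξ c l s) {P : Tile D D'} (hP : P ∈ s)
    {x : ℝ} (hx : x ∈ freqSet N P) : |N x - ξ| * P.scl ≤ 2 := by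
  have h1 := P.abs_freq_sub_le (freqSet_subset P hx) (hF.freq P hP)
  have h2 := P.scl_pos
  calc _ ≤ 2 * P.scl⁻¹ * P.scl := by gcongr
    _ = 2 := by field_simp

/-- For a point seen by `P`, both `N x` and `ξ` lie in the parent of `ω_P`, so `|N x - ξ| ℓ_P ≤ 2`.
-/
theorem IsFamily.freezeMass_le (hF : IsFamily J N h lam ξ c l s) (hs : s.Nonempty)
    {P : Tile D D'} (hP : P ∈ s) :
    freezeMass N h ξ s hs P ≤ 128 * lam * ENNReal.ofReal P.scl := by
  calc _ ≤ ∫⁻ x, 2 * ((N ⁻¹' D'.parent 1 P.freq).indicator h x * P.wt 5 x) := by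
        apply lintegral_mono
        intro x
        by_cases hx : x ∈ largePart N s hs P
        · simp only [indicator_of_mem hx, indicator_of_mem (freqSet_subset P hx.1)]
          calc _ ≤ h x * (ENNReal.ofReal 2 * P.wt 5 x) := by
                gcongr
                · exact hF.abs_sub_mul_le hP hx.1
                · exact wt_anti P.scl_pos (by norm_num)
            _ = _ := by norm_num; ring
        · simp [indicator_of_notMem hx]
    _ = 2 * ∫⁻ x, ((N ⁻¹' D'.parent 1 P.freq).indicator h x * P.wt 5 x) :=
        lintegral_const_mul' _ _ (by norm_num)
    _ ≤ 2 * (64 * lam * ENNReal.ofReal P.scl) := by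
        gcongr
        exact (hF.dens P hP).lintegral_mul_wt_le (hF.subset P hP) hF.meas_N hF.meas_h
    _ = _ := by rw [← mul_assoc, ← mul_assoc]; norm_num

/-- At fixed `x`, put `r = |N x - ξ|`. Tiles seeing `x` have `r ℓ_P ≤ 2`, hence `r ℓ_P ≤ 4 min(r
ℓ_P, 1 / (r ℓ_P))`: the errors form a geometric series over scales. -/
theorem IsFamily.sum_freezeMass_le (hF : IsFamily J N h lam ξ c l s) (hs : s.Nonempty) :
    ∑ P ∈ s, freezeMass N h ξ s hs P ≤ 1327104 * lam * ENNReal.ofReal l := by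
  unfold freezeMass
  have hmw : ∀ P : Tile D D', Measurable fun x => (largePart N s hs P).indicator h x *
      (ENNReal.ofReal (|N x - ξ| * P.scl) * P.wt 20 x) := fun P =>
    (hF.meas_h.indicator (measurableSet_largePart hF.meas_N hs P)).mul
      ((((hF.meas_N.sub_const ξ).abs.mul_const _).ennreal_ofReal).mul P.measurable_wt)
  rw [← lintegral_finsetSum _ fun P _ => hmw P]
  calc _ ≤ ∫⁻ x, 1152 * ((starSet N s hs).indicator h x * wt c l 2 x) := by
        apply lintegral_mono
        intro x
        dsimp only
        rcases (abs_nonneg (N x - ξ)).eq_or_lt' with h0 | h0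
        · rw [h0]; simp
        calc _ ≤ ∑ P ∈ s, (4 * (starSet N s hs).indicator h x) *
              (ENNReal.ofReal (min (|N x - ξ| * P.scl) (|N x - ξ| * P.scl)⁻¹) * P.wt 4 x) := by
              apply Finset.sum_le_sum
              intro P hP
              by_cases hx : x ∈ largePart N s hs P
              · rw [indicator_of_mem hx, indicator_of_mem (largePart_subset_starSet hs hP hx)]
                have h1 := hF.abs_sub_mul_le hP hx.1
                have h2 : 0 < |N x - ξ| * P.scl := mul_pos h0 P.scl_pos
                have h3 : |N x - ξ| * P.scl ≤
                    4 * min (|N x - ξ| * P.scl) (|N x - ξ| * P.scl)⁻¹ := by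
                  rw [mul_min_of_nonneg _ _ (by norm_num)]
                  apply le_min
                  · linarith
                  · rw [← div_eq_mul_inv, le_div_iff₀ h2]
                    nlinarith
                calc _ ≤ h x * (ENNReal.ofReal (4 * min (|N x - ξ| * P.scl)
                      (|N x - ξ| * P.scl)⁻¹) * P.wt 4 x) := by
                      gcongr
                      exact wt_anti P.scl_pos (by norm_num)
                  _ = _ := by
                      rw [ENNReal.ofReal_mul (by norm_num)]
                      norm_num
                      ring
              · simp [indicator_of_notMem hx]
          _ ≤ (4 * (starSet N s hs).indicator h x) * (288 * wt c l 2 x) := by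
              rw [← Finset.mul_sum]
              gcongr
              exact hF.sum_min_mul_wt_le h0 x
          _ = _ := by
              rw [show (1152 : ℝ≥0∞) = 4 * 288 by norm_num]; ring
    _ = 1152 * ∫⁻ x, ((starSet N s hs).indicator h x * wt c l 2 x) :=
        lintegral_const_mul' _ _ (by norm_num)
    _ ≤ 1152 * (1152 * lam * ENNReal.ofReal l) := by gcongr; exact hF.star_mass_le hs
    _ = _ := by rw [← mul_assoc, ← mul_assoc]; norm_num

end FamilyEstimates

/-- Cauchy–Schwarz with respect to the measure `w dx`. -/
theorem sq_lintegral_mul_le {F w : ℝ → ℝ≥0∞} (hF : Measurable F) (hw : Measurable w) :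
    (∫⁻ x, F x * w x) ^ 2 ≤ (∫⁻ x, F x ^ 2 * w x) * ∫⁻ x, w x := by
  have h1 := ENNReal.lintegral_mul_le_Lp_mul_Lq volume Real.HolderConjugate.two_two
    (f := fun x => F x * w x ^ (1 / 2 : ℝ)) (g := fun x => w x ^ (1 / 2 : ℝ))
    (hF.mul (hw.pow_const _)).aemeasurable (hw.pow_const _).aemeasurable
  have e1 : ∀ x, w x ^ (1 / 2 : ℝ) * w x ^ (1 / 2 : ℝ) = w x := fun x => by
    rw [← ENNReal.rpow_add_of_nonneg _ _ (by norm_num) (by norm_num)]; norm_num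
  have e2 : ∀ r : ℝ≥0∞, (r ^ (1 / 2 : ℝ)) ^ 2 = r := fun r => by
    rw [← ENNReal.rpow_natCast, ← ENNReal.rpow_mul]; norm_num
  have e3 : ∀ x, (w x ^ (1 / 2 : ℝ)) ^ (2 : ℝ) = w x := fun x => by
    rw [← ENNReal.rpow_mul]; norm_num
  have e4 : ∀ x, (F x * w x ^ (1 / 2 : ℝ)) ^ (2 : ℝ) = F x ^ 2 * w x := fun x => by
    rw [ENNReal.mul_rpow_of_nonneg _ _ (by norm_num), e3]; norm_num
  simp only [Pi.mul_apply, mul_assoc, e1, e3, e4] at h1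
  calc _ ≤ ((∫⁻ x, F x ^ 2 * w x) ^ (1 / 2 : ℝ) * (∫⁻ x, w x) ^ (1 / 2 : ℝ)) ^ 2 := by gcongr
    _ = _ := by rw [mul_pow, e2, e2]

theorem ENNReal_add_sq_le (a b : ℝ≥0∞) : (a + b) ^ 2 ≤ 4 * (a ^ 2 + b ^ 2) := by
  have h2 : ∀ r : ℝ≥0∞, (r + r) ^ 2 = 4 * r ^ 2 := fun r => by
    rw [← two_mul, mul_pow]; norm_num
  rcases le_total a b with h | h
  · calc _ ≤ (b + b) ^ 2 := by gcongr
      _ = 4 * b ^ 2 := h2 b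
      _ ≤ _ := by gcongr; exact le_add_self
  · calc _ ≤ (a + a) ^ 2 := by gcongr
      _ = 4 * a ^ 2 := h2 a
      _ ≤ _ := by gcongr; exact le_self_add

section
variable {D D' : DyadicGrid}
variable {J : Set ℝ} {N : ℝ → ℝ} {h : ℝ → ℝ≥0∞} {lam : ℝ≥0} {ξ c l : ℝ} {s : Finset (Tile D D')}

/-! ### The overlapping part -/

theorem ofReal_scl_mul_inv (P : Tile D D') :
    ENNReal.ofReal P.scl * ENNReal.ofReal P.scl⁻¹ = 1 := by
  have := P.scl_pos
  rw [← ENNReal.ofReal_mul this.le, mul_inv_cancel₀ this.ne', ENNReal.ofReal_one]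

theorem modifiedTransform_le_of_density {M : ℕ} (hM : 20 ≤ M) {f : ℝ → ℂ} (hf : Measurable f)
    (hN : Measurable N) {P : Tile D D'} (hJ : P.space ⊆ J)
    (hP : DensityLE J N (fun x => ‖f x‖ₑ) lam P) :
    modifiedTransform M N f P ≤ 65536 * lam := by
  refine (modifiedTransform_le hM N f).trans ?_
  calc _ ≤ 1024 * (ENNReal.ofReal P.scl⁻¹ * (64 * lam * ENNReal.ofReal P.scl)) := by
        gcongr
        refine le_trans (lintegral_mono fun x => ?_)
          (hP.lintegral_mul_wt_le hJ hN hf.enorm)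
        dsimp only
        gcongr
        · exact D'.sibling_subset_parent
        · exact wt_anti P.scl_pos (by norm_num)
    _ = 1024 * 64 * lam * (ENNReal.ofReal P.scl * ENNReal.ofReal P.scl⁻¹) := by ring
    _ = _ := by rw [ofReal_scl_mul_inv]; norm_num

/-- No cancellation is needed. Small parts are summed by `tailMass`; on large parts disjointness
leaves one scale at each point. -/
theorem IsFamily.sum_scl_mul_modifiedTransform_le {M : ℕ} (hM : 20 ≤ M) {f : ℝ → ℂ}
    (hF : IsFamily J N (fun x => ‖f x‖ₑ) lam ξ c l s) (hs : s.Nonempty)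
    (hdisj : ∀ P ∈ s, ∀ R ∈ s, P.scl ≠ R.scl → Disjoint (freqSet N P) (freqSet N R)) :
    ∑ P ∈ s, ENNReal.ofReal P.scl * modifiedTransform M N f P ≤
      1375983894528 * lam * ENNReal.ofReal l := by
  set h : ℝ → ℝ≥0∞ := fun x => ‖f x‖ₑ with hh
  calc _ ≤ ∑ P ∈ s, 1024 * (1166400 * lam * tailMass s hs P +
        ∫⁻ x, (largePart N s hs P).indicator h x * P.wt 20 x) := by
        apply Finset.sum_le_sum
        intro P hP
        calc _ ≤ ENNReal.ofReal P.scl * (1024 * (ENNReal.ofReal P.scl⁻¹ *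
              ∫⁻ x, (freqSet N P).indicator h x * P.wt 20 x)) := by
              gcongr; exact modifiedTransform_le hM N f
          _ = (ENNReal.ofReal P.scl * ENNReal.ofReal P.scl⁻¹) *
              (1024 * ∫⁻ x, (freqSet N P).indicator h x * P.wt 20 x) := by ring
          _ = 1024 * ∫⁻ x, (freqSet N P).indicator h x * P.wt 20 x := by
              rw [ofReal_scl_mul_inv, one_mul]
          _ ≤ _ := by
              gcongr
              refine le_trans ?_ (add_le_add_left (hF.small_mass_le hs hP) _)
              have hm : Measurable fun x => (smallPart N s hs P).indicator h x * P.wt 20 x :=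
                (hF.meas_h.indicator (measurableSet_smallPart hF.meas_N hs P)).mul P.measurable_wt
              rw [← lintegral_add_left hm]
              apply lintegral_mono
              intro x
              dsimp only
              rw [← add_mul]
              gcongr
              exact indicator_freqSet_le hs P x
    _ = 1024 * (1166400 * lam * ∑ P ∈ s, tailMass s hs P +
        ∑ P ∈ s, ∫⁻ x, (largePart N s hs P).indicator h x * P.wt 20 x) := by
        rw [← Finset.mul_sum, Finset.sum_add_distrib, ← Finset.mul_sum]
    _ ≤ 1024 * (1166400 * lam * (1152 * ENNReal.ofReal l) + 41472 * lam * ENNReal.ofReal l) := by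
        gcongr
        · exact hF.sum_tailMass_le hs
        · exact hF.sum_large_mass_le hs hdisj
    _ = (1024 * (1166400 * 1152 + 41472)) * lam * ENNReal.ofReal l := by ring
    _ = _ := by norm_num

/-! ### The main term of the lacunary part -/

/-- Counting from the smallest scale indexes the tiles by natural numbers, as the telescoping sum
requires. -/
theorem Finset.exists_scales {D D' : DyadicGrid} (s : Finset (Tile D D')) (hs : s.Nonempty) :
    ∃ t : ℝ, 0 < t ∧ ∃ j : Tile D D' → ℕ, ∀ P ∈ s, P.scl = t * 2 ^ j P := by
  have hl : ∀ P : Tile D D', ∃ k : ℤ, P.scl = D.rho * 2 ^ k := fun P => D.length_mem _ P.space_mem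
  choose k hk using hl
  set k₀ := s.inf' hs k
  refine ⟨D.rho * 2 ^ k₀, mul_pos D.rho_pos (by positivity), fun P => (k P - k₀).toNat, ?_⟩
  intro P hP
  have h1 : k₀ ≤ k P := Finset.inf'_le _ hP
  rw [hk P, mul_assoc, ← zpow_natCast, ← zpow_add₀ (by norm_num), Int.toNat_of_nonneg (by omega)]
  congr 2
  omega

/-- The square function estimate. The nested cutoffs make the truncated functions decrease with the
scale; after smearing they are bounded by `160 λ`, so the telescoping energy bound gives `λ² l` up
to a constant. The second term on the right of the pairing bound is the smearing error. -/
theorem IsFamily.exists_main_bound (hF : IsFamily J N h lam ξ c l s) (hs : s.Nonempty)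
    (hnest : ∀ P ∈ s, ∀ R ∈ s, P.scl ≤ R.scl → freqSet N R ⊆ freqSet N P)
    {a : ℝ → ℝ} (ha : Measurable a) (ha0 : ∀ x, 0 ≤ a x) (hah : ∀ x, ENNReal.ofReal (a x) ≤ h x)
    (hbdd : ∃ B, ∀ x, a x ≤ B) :
    ∃ Y : Tile D D' → ℝ≥0∞,
      (∀ P ∈ s, ∀ (K : ℝ) (φ : ℝ → ℂ), 0 ≤ K → IsMolecule K (center P.space) P.scl φ →
        ‖∫ x, (((starSet N s hs ∩ freqSet N P).indicator a x : ℝ) : ℂ) * φ x‖ₑ ≤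
          ENNReal.ofReal K * (12 * Y P) + ENNReal.ofReal (100 * K) *
            (ENNReal.ofReal P.scl⁻¹ * (19200 * lam * tailMass s hs P))) ∧
      ∑ P ∈ s, ENNReal.ofReal P.scl * Y P ^ 2 ≤ 1440000 * lam ^ 2 * ENNReal.ofReal l := by
  classical
  obtain ⟨t, ht, j, hj⟩ := Finset.exists_scales s hs
  have hl := hF.l_pos hs
  set d := tileDist s hs with hd
  -- The union makes `E` decreasing for every `n`, including scales at which there is no tile.
  -- Nestedness makes it equal to the frequency set of `P` at the scale of `P`.
  set E : ℕ → Set ℝ := fun n => ⋃ P ∈ s.filter (fun P => n ≤ j P), freqSet N P with hE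
  have hEm : ∀ n, MeasurableSet (E n) := fun n =>
    Finset.measurableSet_biUnion _ fun P _ => measurableSet_freqSet hF.meas_N P
  have hEP : ∀ P ∈ s, E (j P) = freqSet N P := by
    intro P hP
    apply Subset.antisymm
    · intro x hx
      simp only [hE, mem_iUnion] at hx
      obtain ⟨R, hR, hx⟩ := hx
      rw [Finset.mem_filter] at hR
      refine hnest P hP R hR.1 ?_ hx
      rw [hj P hP, hj R hR.1]
      gcongr
      · norm_num
      · exact hR.2
    · intro x hx
      simp only [hE, mem_iUnion]
      exact ⟨P, Finset.mem_filter.2 ⟨hP, le_rfl⟩, hx⟩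
  have hEanti : ∀ n, E (n + 1) ⊆ E n := by
    intro n x hx
    simp only [hE, mem_iUnion] at hx ⊢
    obtain ⟨R, hR, hx⟩ := hx
    rw [Finset.mem_filter] at hR
    exact ⟨R, Finset.mem_filter.2 ⟨hR.1, by omega⟩, hx⟩
  have hSm := measurableSet_starSet (N := N) hF.meas_N hs
  set g : ℕ → ℝ → ℝ := fun n => (starSet N s hs ∩ E n).indicator a with hg
  have hgS : ∀ n x, ENNReal.ofReal (g n x) ≤ (starSet N s hs).indicator h x := by
    intro n x
    by_cases hx : x ∈ starSet N s hs ∩ E n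
    · simp only [hg, indicator_of_mem hx, indicator_of_mem hx.1]
      exact hah x
    · simp [hg, indicator_of_notMem hx]
  have hSD : ∀ n, SmearData d (g n) c l := fun n =>
    { pos := exists_pos_le_tileDist
      lip := tileDist_lip
      meas := ha.indicator (hSm.inter (hEm n))
      nonneg := indicator_nonneg fun x _ => ha0 x
      bdd := by
        obtain ⟨B, hB⟩ := hbdd
        exact ⟨B, fun x => indicator_apply_le' (fun _ => hB x) fun _ => (ha0 x).trans (hB x)⟩
      supp := by
        intro x hx
        have hx' : x ∈ starSet N s hs ∩ E n := by
          by_contra h'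
          exact hx (indicator_of_notMem h' _)
        exact starSet_dist_le hF hx'.1 }
  -- Density controls only averages of `a`, not its values; this is the reason for smearing. The
  -- distance `d` is the same for every `n`, so monotonicity in `n` survives.
  have hβ : ∀ n y, smear d (g n) y ≤ 5 * (32 * lam : ℝ) := by
    intro n y
    refine (hSD n).smear_le (by positivity) ?_ y
    intro y
    refine (lintegral_mono (hgS n)).trans ((hF.star_average_le hs y).trans (le_of_eq ?_))
    rw [← ENNReal.ofReal_coe_nnreal]
    simp [hd]
  have hAdm : ∀ n, Admissible (c - 2 * l) (smear d (g n)) := fun n => (hSD n).admissible (hβ n)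
  have hmono : ∀ n y, smear d (g (n + 1)) y ≤ smear d (g n) y := by
    intro n y
    apply integral_mono ((hSD _).integrable_mul_kernel y) ((hSD _).integrable_mul_kernel y)
    intro x
    apply mul_le_mul_of_nonneg_right _ (smearKernel_nonneg (hSD n).d_pos x y)
    exact indicator_le_indicator_of_subset (inter_subset_inter_right _ (hEanti n)) ha0 x
  set Dn : ℕ → ℝ → ℝ := fun n => expDiff (c - 2 * l) (t * 2 ^ n) (smear d (g n)) with hDn
  have htn : ∀ n : ℕ, 0 < t * 2 ^ n := fun n => by positivity
  have hDc : ∀ n, Continuous (Dn n) := fun n => continuous_expDiff (htn n) (hAdm n).cont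
  have hEn : ∀ m : ℕ, ∑ n ∈ Finset.range m, ∫⁻ x, ‖Dn n x‖ₑ ^ 2 ≤
      40000 * lam ^ 2 * ENNReal.ofReal l := by
    intro m
    have h1 := sum_integral_sq_expDiff_le ht hAdm hmono (hβ 0) m
    have h2 := (hSD 0).integral_smear_le hl.le (hβ 0)
    have h3 : ∀ n, ∫⁻ x, ‖Dn n x‖ₑ ^ 2 = ENNReal.ofReal (∫ x, Dn n x ^ 2) := by
      intro n
      rw [ofReal_integral_eq_lintegral_ofReal (integrable_sq_expDiff (htn n) (hAdm n))
        (Filter.Eventually.of_forall fun x => sq_nonneg _)]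
      congr 1 with x
      rw [← ofReal_norm, ← ENNReal.ofReal_pow (norm_nonneg _), Real.norm_eq_abs, sq_abs]
    simp_rw [h3]
    rw [← ENNReal.ofReal_sum_of_nonneg fun n _ => integral_nonneg fun x => sq_nonneg _]
    have h4 : ∑ n ∈ Finset.range m, ∫ x, Dn n x ^ 2 ≤ 40000 * (lam : ℝ) ^ 2 * l := by
      have h5 : 5 * (32 * lam : ℝ) * ∫ x, smear d (g 0) x ≤
          5 * (32 * lam : ℝ) * (5 * (32 * lam : ℝ) * (4 * l)) := by gcongr
      have h6 : 0 ≤ (lam : ℝ) ^ 2 * l := by positivity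
      nlinarith
    refine (ENNReal.ofReal_le_ofReal h4).trans (le_of_eq ?_)
    rw [ENNReal.ofReal_mul (by positivity), ENNReal.ofReal_mul (by norm_num),
      ENNReal.ofReal_pow (by positivity), ENNReal.ofReal_coe_nnreal]
    norm_num
  refine ⟨fun P => ∫⁻ x, ‖Dn (j P) x‖ₑ * (ENNReal.ofReal P.scl⁻¹ * P.wt 18 x), ?_, ?_⟩
  · intro P hP K φ hK hφ
    have e1 : (starSet N s hs ∩ freqSet N P).indicator a = g (j P) := by
      simp only [hg, hEP P hP]
    rw [e1]
    refine ((hSD (j P)).enorm_integral_mul_sub_le hφ hK P.scl_pos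
      fun x => tileDist_le hP x).trans ?_
    gcongr
    · have := hφ.enorm_integral_mul_le hK P.scl_pos (hAdm (j P))
      rw [hj P hP] at this
      simp only [Tile.wt, hDn, hj P hP]
      exact this
    · calc _ ≤ ∫⁻ x, ENNReal.ofReal P.scl⁻¹ * ((starSet N s hs).indicator h x *
            (ENNReal.ofReal (d x / P.scl) * P.wt 20 x)) := by
            apply lintegral_mono
            intro x
            calc _ ≤ (starSet N s hs).indicator h x * (ENNReal.ofReal (d x / P.scl) *
                  (ENNReal.ofReal P.scl⁻¹ * P.wt 20 x)) :=
                  mul_le_mul_left (hgS _ x) _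
              _ = _ := by ring
        _ ≤ _ := by
            rw [lintegral_const_mul' _ _ ENNReal.ofReal_ne_top]
            gcongr
            exact hF.star_tile_mass_le hs hP
  · have hDm : ∀ n, Measurable fun x => ‖Dn n x‖ₑ := fun n => (hDc n).measurable.enorm
    calc _ ≤ ∑ P ∈ s, 4 * ∫⁻ x, ‖Dn (j P) x‖ₑ ^ 2 * P.wt 18 x := by
          apply Finset.sum_le_sum
          intro P _
          have h1 := sq_lintegral_mul_le (hDm (j P)) (P.measurable_wt (n := 18)|>.const_mul
            (ENNReal.ofReal P.scl⁻¹))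
          have h2 := lintegral_inv_mul_wt (c := center P.space) P.scl_pos (n := 18) (by norm_num)
          calc _ ≤ ENNReal.ofReal P.scl * ((∫⁻ x, ‖Dn (j P) x‖ₑ ^ 2 *
                (ENNReal.ofReal P.scl⁻¹ * P.wt 18 x)) * 4) := by
                gcongr
                refine h1.trans ?_
                gcongr
                exact h2
            _ = ENNReal.ofReal P.scl * ((ENNReal.ofReal P.scl⁻¹ *
                ∫⁻ x, ‖Dn (j P) x‖ₑ ^ 2 * P.wt 18 x) * 4) := by
                rw [← lintegral_const_mul' _ _ ENNReal.ofReal_ne_top]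
                congr 3 with x
                ring
            _ = (ENNReal.ofReal P.scl * ENNReal.ofReal P.scl⁻¹) *
                (4 * ∫⁻ x, ‖Dn (j P) x‖ₑ ^ 2 * P.wt 18 x) := by ring
            _ = _ := by rw [ofReal_scl_mul_inv, one_mul]
      _ = 4 * ∑ n ∈ Finset.range (s.sup j + 1), ∑ P ∈ s.filter (fun P => j P = n),
          ∫⁻ x, ‖Dn (j P) x‖ₑ ^ 2 * P.wt 18 x := by
          rw [← Finset.mul_sum, Finset.sum_fiberwise_of_maps_to]
          intro P hP
          rw [Finset.mem_range, Nat.lt_succ_iff]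
          exact Finset.le_sup hP
      -- Tiles of one scale are separated, so their weights sum to at most `9` at every point.
      _ ≤ 4 * ∑ n ∈ Finset.range (s.sup j + 1), 9 * ∫⁻ x, ‖Dn n x‖ₑ ^ 2 := by
          gcongr with n hn
          have e : ∀ P ∈ s.filter (fun P => j P = n), ∫⁻ x, ‖Dn (j P) x‖ₑ ^ 2 * P.wt 18 x =
              ∫⁻ x, ‖Dn n x‖ₑ ^ 2 * P.wt 18 x := by
            intro P hP
            rw [(Finset.mem_filter.1 hP).2]
          have hm : ∀ P : Tile D D', Measurable fun x => ‖Dn n x‖ₑ ^ 2 * P.wt 18 x := fun P =>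
            ((hDm n).pow_const 2).mul P.measurable_wt
          rw [Finset.sum_congr rfl e, ← lintegral_finsetSum _ fun P _ => hm P,
            ← lintegral_const_mul' _ _ (by norm_num)]
          apply lintegral_mono
          intro x
          dsimp only
          rw [← Finset.mul_sum, mul_comm]
          gcongr
          calc _ ≤ ∑ P ∈ s.filter (fun P => j P = n), wt (center P.space) (t * 2 ^ n) 2 x := by
                apply Finset.sum_le_sum
                intro P hP
                rw [Finset.mem_filter] at hP
                have hscl : P.scl = t * 2 ^ n := by rw [hj P hP.1, hP.2]
                rw [Tile.wt, hscl]
                exact wt_anti (htn n) (by norm_num)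
            _ ≤ 9 := by
                apply sum_wt_le _ _ (htn n)
                intro P hP R hR hne
                rw [Finset.mem_filter] at hP hR
                have hscl : P.scl = t * 2 ^ n := by rw [hj P hP.1, hP.2]
                have hscl' : R.scl = t * 2 ^ n := by rw [hj R hR.1, hR.2]
                rw [← hscl]
                exact hF.sep P hP.1 R hR.1 hne (by rw [hscl, hscl'])
      _ ≤ 4 * (9 * (40000 * lam ^ 2 * ENNReal.ofReal l)) := by
          rw [← Finset.mul_sum]
          gcongr
          exact hEn _
      _ = (4 * 9 * 40000) * lam ^ 2 * ENNReal.ofReal l := by ring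
      _ = _ := by norm_num

end

section
variable {D D' : DyadicGrid}
variable {J : Set ℝ} {N : ℝ → ℝ} {lam : ℝ≥0} {ξ c l : ℝ} {s : Finset (Tile D D')}

/-! ### The lacunary part -/

/-- The four nonnegative parts of a complex number. -/
noncomputable def part (z : ℂ) (r : Fin 4) : ℝ :=
  max (![z.re, -z.re, z.im, -z.im] r) 0

/-- The coefficients of the four nonnegative parts. -/
noncomputable def partCoeff (r : Fin 4) : ℂ := ![1, -1, Complex.I, -Complex.I] r

theorem sum_part (z : ℂ) : ∑ r, partCoeff r * (part z r : ℂ) = z := by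
  have h : ∀ a : ℝ, max a 0 - max (-a) 0 = a := fun a => by
    rcases le_total a 0 with h | h
    · rw [max_eq_right h, max_eq_left (by linarith)]; ring
    · rw [max_eq_left h, max_eq_right (by linarith)]; ring
  have h1 := h z.re
  have h2 := h z.im
  simp only [Fin.sum_univ_four, part, partCoeff]
  apply Complex.ext
  · simp
    linarith
  · simp
    linarith

theorem enorm_partCoeff (r : Fin 4) : ‖partCoeff r‖ₑ = 1 := by
  fin_cases r <;> simp [partCoeff, ← ofReal_norm]

theorem part_nonneg (z : ℂ) (r : Fin 4) : 0 ≤ part z r := le_max_right _ _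

theorem part_le (z : ℂ) (r : Fin 4) : part z r ≤ ‖z‖ := by
  obtain ⟨h1, h2⟩ := abs_le.1 (Complex.abs_re_le_norm z)
  obtain ⟨h3, h4⟩ := abs_le.1 (Complex.abs_im_le_norm z)
  have h5 := norm_nonneg z
  fin_cases r <;> simp [part] <;> linarith

theorem measurable_part (r : Fin 4) : Measurable fun z => part z r := by
  have h1 := Complex.measurable_re
  have h2 := Complex.measurable_im
  fin_cases r <;> simp only [part] <;> apply Measurable.max _ measurable_const
  · exact h1
  · exact h1.neg
  · exact h2
  · exact h2.neg

theorem Psi.measurable_comp {M : ℕ} {P : Tile D D'} {ψ : ℝ → ℝ → ℂ} (h : ψ ∈ Psi M P)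
    (hN : Measurable N) : Measurable fun x => ψ x (N x) :=
  h.1.continuous.measurable.comp (measurable_id.prodMk hN)

/-- The pairing with a modified wave packet, up to error terms, is the pairing with a molecule over
the star set. -/
theorem IsFamily.enorm_pairing_le {M : ℕ} (hM : 20 ≤ M) {f : ℝ → ℂ} (hf : Measurable f)
    (hfi : Integrable f) (hF : IsFamily J N (fun x => ‖f x‖ₑ) lam ξ c l s) (hs : s.Nonempty)
    {P : Tile D D'} (hP : P ∈ s) (hn : ξ ∉ P.freq) {Y : Fin 4 → ℝ≥0∞} {V : ℝ≥0∞}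
    (hY : ∀ r, ∀ φ : ℝ → ℂ, IsMolecule 4096 (center P.space) P.scl φ →
        ‖∫ x, (((starSet N s hs ∩ freqSet N P).indicator (fun x => part
          (f x * Complex.exp (-(Complex.I * (x : ℂ) * (ξ : ℂ)))) r) x : ℝ) : ℂ) * φ x‖ₑ ≤
          Y r + V) :
    modifiedTransform M N f P ≤ (∑ r, Y r) + 4 * V + ENNReal.ofReal P.scl⁻¹ *
      (2048 * (1166400 * lam * tailMass s hs P) +
        1024 * freezeMass N (fun x => ‖f x‖ₑ) ξ s hs P) := by
  refine iSup₂_le fun ψ hψ => ?_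
  have hl := P.scl_pos
  have hEm := measurableSet_freqSet hF.meas_N P
  have hSm := measurableSet_starSet (N := N) hF.meas_N hs
  set e : ℝ → ℂ := fun x => Complex.exp (-(Complex.I * (x : ℂ) * (ξ : ℂ))) with he
  have hec : Continuous e := by
    simp only [he]
    fun_prop
  have he1 : ∀ x, ‖e x‖ = 1 := fun x => by rw [he, Complex.norm_exp]; simp
  set φ : ℝ → ℂ := fun x => conj (e x * ψ x ξ) with hφ
  have hmol : IsMolecule 4096 (center P.space) P.scl φ :=
    Phi.isMolecule hM (hψ.2 ξ).1 (hF.freq P hP) hn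
  have hφc := hmol.contDiff.continuous
  have bφ : ∀ x, ‖φ x‖ ≤ 4096 * (P.scl⁻¹ * 1) := fun x =>
    (hmol.norm_le x).trans (by
      gcongr; exact inv_le_one_of_one_le₀ (one_le_pow₀ (one_le_bracket hl)))
  set S := starSet N s hs ∩ freqSet N P with hS
  set a : Fin 4 → ℝ → ℝ := fun r x => part (f x * e x) r with ha
  have ham : ∀ r, Measurable (a r) := fun r =>
    (measurable_part r).comp (hf.mul hec.measurable)
  have hai : ∀ r, Integrable (S.indicator (a r)) := fun r => by
    apply Integrable.indicator _ (hSm.inter hEm)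
    apply hfi.norm.mono' (ham r).aestronglyMeasurable
    refine Filter.Eventually.of_forall fun x => ?_
    rw [Real.norm_of_nonneg (part_nonneg _ _)]
    refine (part_le _ r).trans (le_of_eq ?_)
    rw [norm_mul, he1, mul_one]
  have hri : ∀ r, Integrable fun x => ((S.indicator (a r) x : ℝ) : ℂ) * φ x := fun r =>
    integrable_ofReal_mul_of_bdd (hai r) hφc bφ
  set main : ℝ → ℂ := fun x => ∑ r, partCoeff r * (((S.indicator (a r) x : ℝ) : ℂ) * φ x)
    with hmain
  have hmi : Integrable main := integrable_finsetSum _ fun r _ => (hri r).const_mul _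
  have hmval : ∀ x, main x = S.indicator (fun x => f x * e x * φ x) x := by
    intro x
    by_cases hx : x ∈ S
    · simp only [hmain, indicator_of_mem hx, ha, ← mul_assoc]
      rw [← Finset.sum_mul, sum_part]
    · simp [hmain, indicator_of_notMem hx]
  set F : ℝ → ℂ := fun x => f x * conj ((freqSet N P).indicator (fun y => ψ y (N y)) x) with hFdef
  have hFi : Integrable F := by
    apply hfi.mul_bdd (c := 1024 * (P.scl⁻¹ * 1))
    · exact (Complex.continuous_conj.measurable.comp
        ((Psi.measurable_comp hψ hF.meas_N).indicator hEm)).aestronglyMeasurable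
    · refine Filter.Eventually.of_forall fun x => ?_
      rw [RCLike.norm_conj]
      refine (norm_indicator_le_norm_self _ x).trans ?_
      refine (Phi.norm_le hM (hψ.2 (N x)).1 x).trans ?_
      gcongr
      exact inv_le_one_of_one_le₀ (one_le_pow₀ (one_le_bracket hl))
  have hsplit : ∫ x, F x = (∫ x, main x) + ∫ x, (F x - main x) := by
    rw [integral_sub hFi hmi]; ring
  have hmb : ‖∫ x, main x‖ₑ ≤ (∑ r, Y r) + 4 * V := by
    rw [hmain, integral_finsetSum _ fun r _ => (hri r).const_mul _]
    refine (enorm_sum_le _ _).trans ?_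
    calc _ ≤ ∑ r : Fin 4, (Y r + V) := by
          apply Finset.sum_le_sum
          intro r _
          rw [integral_const_mul, enorm_mul, enorm_partCoeff, one_mul]
          exact hY r φ hmol
      _ = _ := by rw [Finset.sum_add_distrib]; simp
  have herr : ‖∫ x, (F x - main x)‖ₑ ≤ ENNReal.ofReal P.scl⁻¹ *
      (2048 * (1166400 * lam * tailMass s hs P) +
        1024 * freezeMass N (fun x => ‖f x‖ₑ) ξ s hs P) := by
    set h : ℝ → ℝ≥0∞ := fun x => ‖f x‖ₑ with hh
    refine (enorm_integral_le_lintegral_enorm _).trans ?_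
    have hm : Measurable fun x => (smallPart N s hs P).indicator h x * P.wt 20 x :=
      (hF.meas_h.indicator (measurableSet_smallPart hF.meas_N hs P)).mul P.measurable_wt
    calc _ ≤ ∫⁻ x, ENNReal.ofReal P.scl⁻¹ * (2048 * ((smallPart N s hs P).indicator h x * P.wt 20 x)
          + 1024 * ((largePart N s hs P).indicator h x *
            (ENNReal.ofReal (|N x - ξ| * P.scl) * P.wt 20 x))) := by
          apply lintegral_mono
          intro x
          dsimp only
          by_cases hxE : x ∈ freqSet N P
          · have hFx : F x = f x * conj (ψ x (N x)) := by
              simp only [hFdef, indicator_of_mem hxE]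
            by_cases hxS : x ∈ starSet N s hs
            · have hx : x ∈ S := ⟨hxS, hxE⟩
              have hdiff : F x - main x = f x * conj (ψ x (N x) - ψ x ξ) := by
                have hee : e x * conj (e x) = 1 := by
                  rw [Complex.mul_conj, Complex.normSq_eq_norm_sq, he1]; simp
                rw [hFx, hmval, indicator_of_mem hx]
                simp only [hφ, map_mul, map_sub]
                calc _ = f x * conj (ψ x (N x)) - f x * (e x * conj (e x)) * conj (ψ x ξ) := by
                      ring
                  _ = _ := by rw [hee]; ring
              have hb := Psi.enorm_sub_le hM hψ x (N x) ξ
              rw [hdiff, enorm_mul, RCLike.enorm_conj]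
              rcases lt_or_ge P.scl (4 * tileDist s hs x) with h1 | h1
              · have hx1 : x ∈ smallPart N s hs P := ⟨hxE, h1⟩
                rw [indicator_of_mem hx1]
                refine le_trans ?_ (mul_le_mul_right le_self_add _)
                calc _ ≤ ‖f x‖ₑ * (1024 * (ENNReal.ofReal P.scl⁻¹ *
                      (ENNReal.ofReal 2 * P.wt 20 x))) := by
                      refine mul_le_mul_right (hb.trans ?_) _
                      gcongr
                      · exact hF.abs_sub_mul_le hP hxE
                      · exact le_rfl
                  _ = _ := by
                      rw [show (2048 : ℝ≥0∞) = 1024 * 2 by norm_num]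
                      simp only [ENNReal.ofReal_ofNat, hh]
                      ring
              · have hx1 : x ∈ largePart N s hs P := ⟨hxE, h1⟩
                rw [indicator_of_mem hx1]
                refine le_trans ?_ (mul_le_mul_right le_add_self _)
                calc _ ≤ ‖f x‖ₑ * _ := mul_le_mul_right hb _
                  _ = _ := by
                      simp only [hh, Tile.wt]
                      ring
            · have hx : x ∉ S := fun hx => hxS hx.1
              -- If `P` were large at `x`, then `P` itself would place `x` in the star set.
              have hx1 : x ∈ smallPart N s hs P := by
                refine ⟨hxE, ?_⟩
                by_contra h1
                exact hxS ⟨P, hP, not_lt.1 h1, hxE⟩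
              rw [hmval, indicator_of_notMem hx, sub_zero, hFx, indicator_of_mem hx1, enorm_mul,
                RCLike.enorm_conj]
              refine le_trans ?_ (mul_le_mul_right le_self_add _)
              calc _ ≤ ‖f x‖ₑ * (2048 * (ENNReal.ofReal P.scl⁻¹ * P.wt 20 x)) := by
                    refine mul_le_mul_right ((Phi.enorm_le hM (hψ.2 (N x)).1 x).trans ?_) _
                    rw [Tile.wt]
                    gcongr
                    norm_num
                _ = _ := by
                    simp only [hh]
                    ring
          · have hx : x ∉ S := fun hx => hxE hx.2
            rw [hmval, indicator_of_notMem hx]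
            simp [hFdef, indicator_of_notMem hxE]
      _ = ENNReal.ofReal P.scl⁻¹ * (2048 * (∫⁻ x, (smallPart N s hs P).indicator h x * P.wt 20 x)
          + 1024 * freezeMass N h ξ s hs P) := by
          rw [lintegral_const_mul' _ _ ENNReal.ofReal_ne_top, lintegral_add_left (hm.const_mul _),
            lintegral_const_mul' _ _ (by norm_num), lintegral_const_mul' _ _ (by norm_num),
            freezeMass]
      _ ≤ _ := by
          gcongr
          exact hF.small_mass_le hs hP
  calc _ = ‖∫ x, F x‖ₑ := rfl
    _ ≤ _ := by
        rw [hsplit]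
        exact (enorm_add_le _ _).trans (add_le_add hmb herr)

/-- The pairing bound is a main term, handled by the square function estimate for each of the four
nonnegative parts, plus errors `Z P / ℓ_P` collecting the smearing, small-part and freezing losses.
-/
theorem IsFamily.sum_scl_mul_sq_modifiedTransform_le {M : ℕ} (hM : 20 ≤ M) {f : ℝ → ℂ}
    (hf : Measurable f) (hfi : Integrable f) (hfb : ∃ B, ∀ x, ‖f x‖ ≤ B)
    (hF : IsFamily J N (fun x => ‖f x‖ₑ) lam ξ c l s) (hs : s.Nonempty)
    (hnest : ∀ P ∈ s, ∀ R ∈ s, P.scl ≤ R.scl → freqSet N R ⊆ freqSet N P)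
    (hn : ∀ P ∈ s, ξ ∉ P.freq) :
    ∑ P ∈ s, ENNReal.ofReal P.scl * modifiedTransform M N f P ^ 2 ≤
      10 ^ 26 * lam ^ 2 * ENNReal.ofReal l := by
  have hec : Continuous fun x : ℝ => Complex.exp (-(Complex.I * (x : ℂ) * (ξ : ℂ))) := by
    fun_prop
  have he1 : ∀ x : ℝ, ‖Complex.exp (-(Complex.I * (x : ℂ) * (ξ : ℂ)))‖ = 1 := fun x => by
    rw [Complex.norm_exp]; simp
  have hpl : ∀ (r : Fin 4) (x : ℝ),
      part (f x * Complex.exp (-(Complex.I * (x : ℂ) * (ξ : ℂ)))) r ≤ ‖f x‖ := fun r x => by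
    refine (part_le _ r).trans (le_of_eq ?_)
    rw [norm_mul, he1, mul_one]
  have hex := fun r : Fin 4 => hF.exists_main_bound hs hnest
    (a := fun x => part (f x * Complex.exp (-(Complex.I * (x : ℂ) * (ξ : ℂ)))) r)
    ((measurable_part r).comp (hf.mul hec.measurable)) (fun x => part_nonneg _ r)
    (fun x => by
      rw [← ofReal_norm]
      exact ENNReal.ofReal_le_ofReal (hpl r x))
    (by
      obtain ⟨B, hB⟩ := hfb
      exact ⟨B, fun x => (hpl r x).trans (hB x)⟩)
  choose Y hY1 hY2 using hex
  set T := fun P => tailMass s hs P with hT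
  set Q := fun P => freezeMass N (fun x => ‖f x‖ₑ) ξ s hs P with hQ
  set Z : Tile D D' → ℝ≥0∞ := fun P => 40000000000 * (lam * T P) + 1024 * Q P with hZ
  have hpt : ∀ P ∈ s, modifiedTransform M N f P ≤
      49152 * (∑ r, Y r P) + ENNReal.ofReal P.scl⁻¹ * Z P := by
    intro P hP
    have h1 := hF.enorm_pairing_le hM hf hfi hs hP (hn P hP)
      (Y := fun r => 49152 * Y r P)
      (V := 409600 * (ENNReal.ofReal P.scl⁻¹ * (19200 * lam * T P))) (by
        intro r φ hφ
        refine (hY1 r P hP 4096 φ (by norm_num) hφ).trans (le_of_eq ?_)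
        norm_num
        rw [← mul_assoc]
        norm_num
        rfl)
    refine h1.trans ?_
    rw [← Finset.mul_sum, add_assoc]
    gcongr
    calc _ = ENNReal.ofReal P.scl⁻¹ * ((4 * 409600 * 19200 + 2048 * 1166400) * (lam * T P) +
          1024 * Q P) := by ring
      _ ≤ _ := by
        simp only [hZ]
        gcongr
        norm_num
  have hZ1 : ∀ P ∈ s, Z P ≤ 200000000000 * (lam * ENNReal.ofReal P.scl) := by
    intro P hP
    calc Z P ≤ 40000000000 * (lam * (4 * ENNReal.ofReal P.scl)) +
          1024 * (128 * lam * ENNReal.ofReal P.scl) := by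
          simp only [hZ]
          gcongr
          · exact tailMass_le hs hP
          · exact hF.freezeMass_le hs hP
      _ = (40000000000 * 4 + 1024 * 128) * (lam * ENNReal.ofReal P.scl) := by ring
      _ ≤ _ := by gcongr; norm_num
  have hZ2 : ∑ P ∈ s, Z P ≤ 50000000000000 * (lam * ENNReal.ofReal l) := by
    simp only [hZ]
    rw [Finset.sum_add_distrib, ← Finset.mul_sum, ← Finset.mul_sum, ← Finset.mul_sum]
    calc _ ≤ 40000000000 * (lam * (1152 * ENNReal.ofReal l)) +
          1024 * (1327104 * lam * ENNReal.ofReal l) := by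
          gcongr
          · exact hF.sum_tailMass_le hs
          · exact hF.sum_freezeMass_le hs
      _ = (40000000000 * 1152 + 1024 * 1327104) * (lam * ENNReal.ofReal l) := by ring
      _ ≤ _ := by gcongr; norm_num
  -- Interpolation between `ℓ^∞` and `ℓ^1`: one factor `Z P / ℓ_P` is bounded by a multiple of `λ`,
  -- and the remaining sum of `Z P` by a multiple of `λ l`.
  have hZ3 : ∑ P ∈ s, ENNReal.ofReal P.scl * (ENNReal.ofReal P.scl⁻¹ * Z P) ^ 2 ≤
      10 ^ 25 * lam ^ 2 * ENNReal.ofReal l := by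
    calc _ ≤ ∑ P ∈ s, 200000000000 * lam * Z P := by
          apply Finset.sum_le_sum
          intro P hP
          have hi := ofReal_scl_mul_inv P
          calc _ = (ENNReal.ofReal P.scl * ENNReal.ofReal P.scl⁻¹) *
                (ENNReal.ofReal P.scl⁻¹ * Z P * Z P) := by ring
            _ ≤ 1 * (ENNReal.ofReal P.scl⁻¹ * (200000000000 * (lam * ENNReal.ofReal P.scl)) *
                Z P) := by
                rw [hi]
                gcongr
                exact hZ1 P hP
            _ = (ENNReal.ofReal P.scl * ENNReal.ofReal P.scl⁻¹) * (200000000000 * lam * Z P) := by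
                ring
            _ = _ := by rw [hi, one_mul]
      _ ≤ 200000000000 * lam * (50000000000000 * (lam * ENNReal.ofReal l)) := by
          rw [← Finset.mul_sum]
          gcongr
      _ = (200000000000 * 50000000000000) * lam ^ 2 * ENNReal.ofReal l := by ring
      _ = _ := by norm_num
  have hY3 : ∑ P ∈ s, ENNReal.ofReal P.scl * (∑ r, Y r P) ^ 2 ≤
      16 * (4 * (1440000 * lam ^ 2 * ENNReal.ofReal l)) := by
    calc _ ≤ ∑ P ∈ s, 16 * ∑ r, ENNReal.ofReal P.scl * Y r P ^ 2 := by
          apply Finset.sum_le_sum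
          intro P _
          rw [Fin.sum_univ_four, Fin.sum_univ_four, add_assoc]
          calc _ ≤ ENNReal.ofReal P.scl * (4 * ((4 * (Y 0 P ^ 2 + Y 1 P ^ 2)) +
                4 * (Y 2 P ^ 2 + Y 3 P ^ 2))) := by
                gcongr
                refine (ENNReal_add_sq_le _ _).trans ?_
                gcongr
                · exact ENNReal_add_sq_le _ _
                · exact ENNReal_add_sq_le _ _
            _ = (4 * 4) * (ENNReal.ofReal P.scl * Y 0 P ^ 2 + ENNReal.ofReal P.scl * Y 1 P ^ 2 +
                ENNReal.ofReal P.scl * Y 2 P ^ 2 + ENNReal.ofReal P.scl * Y 3 P ^ 2) := by ring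
            _ = _ := by norm_num
      _ = 16 * ∑ r, ∑ P ∈ s, ENNReal.ofReal P.scl * Y r P ^ 2 := by
          rw [← Finset.mul_sum, Finset.sum_comm]
      _ ≤ 16 * ∑ r : Fin 4, 1440000 * lam ^ 2 * ENNReal.ofReal l := by
          gcongr with r
          exact hY2 r
      _ = _ := by simp
  calc _ ≤ ∑ P ∈ s, (4 * 49152 ^ 2 * (ENNReal.ofReal P.scl * (∑ r, Y r P) ^ 2) +
        4 * (ENNReal.ofReal P.scl * (ENNReal.ofReal P.scl⁻¹ * Z P) ^ 2)) := by
        apply Finset.sum_le_sum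
        intro P hP
        calc _ ≤ ENNReal.ofReal P.scl * (4 * ((49152 * (∑ r, Y r P)) ^ 2 +
              (ENNReal.ofReal P.scl⁻¹ * Z P) ^ 2)) := by
              gcongr
              refine le_trans ?_ (ENNReal_add_sq_le _ _)
              gcongr
              exact hpt P hP
          _ = _ := by ring
    _ ≤ 4 * 49152 ^ 2 * (16 * (4 * (1440000 * lam ^ 2 * ENNReal.ofReal l))) +
        4 * (10 ^ 25 * lam ^ 2 * ENNReal.ofReal l) := by
        rw [Finset.sum_add_distrib, ← Finset.mul_sum, ← Finset.mul_sum]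
        gcongr
    _ = (4 * 49152 ^ 2 * (16 * (4 * 1440000)) + 4 * 10 ^ 25) * (lam ^ 2 * ENNReal.ofReal l) := by
        ring
    _ ≤ 10 ^ 26 * (lam ^ 2 * ENNReal.ofReal l) := by gcongr; norm_num
    _ = _ := by ring

end

/-! ### The size of a tree -/

section Size
variable {D D' : DyadicGrid} {J : Set ℝ} {N : ℝ → ℝ} {h : ℝ → ℝ≥0∞} {lam : ℝ≥0} {P R : Tile D D'}
  {s : Finset (Tile D D')} {T : Tree D D' 1}

theorem Tile.eq_of_space_freq (h1 : P.space = R.space) (h2 : P.freq = R.freq) : P = R := by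
  cases P; cases R; simp_all

theorem Tile.volume_space (P : Tile D D') : volume P.space = ENNReal.ofReal P.scl :=
  (D.isBoundedInterval _ P.space_mem).volume_eq

theorem Tile.len_freq_eq_iff : len P.freq = len R.freq ↔ P.scl = R.scl := by
  rw [P.len_freq, R.len_freq, inv_inj]

theorem Tile.len_freq_lt (h : P.scl < R.scl) : len R.freq < len P.freq := by
  rw [P.len_freq, R.len_freq]
  exact inv_strictAnti₀ P.scl_pos h

theorem Tile.disjoint_space (hne : P ≠ R) (hfr : P.freq = R.freq) :
    Disjoint P.space R.space :=
  D.disjoint_of_ne P.space_mem R.space_mem (fun hsp => hne (Tile.eq_of_space_freq hsp hfr))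
    (Tile.len_freq_eq_iff.1 (by rw [hfr]))

theorem Tile.scl_le_abs_center_sub (hne : P ≠ R) (hfr : P.freq = R.freq) :
    P.scl ≤ |center P.space - center R.space| :=
  (D.isBoundedInterval _ P.space_mem).len_le_abs_center_sub (D.isBoundedInterval _ R.space_mem)
    (Tile.disjoint_space hne hfr) (Tile.len_freq_eq_iff.1 (by rw [hfr]))

/-- Distinct tiles with one frequency interval have equal scale, hence disjoint space intervals. -/
theorem sum_scl_le_of_freq_eq {I : Set ℝ} (hI : IsBoundedInterval I)
    (hs : ∀ P ∈ s, ∀ R ∈ s, P.freq = R.freq) (hsI : ∀ P ∈ s, P.space ⊆ I) :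
    ∑ P ∈ s, ENNReal.ofReal P.scl ≤ ENNReal.ofReal (len I) := by
  calc _ = ∑ P ∈ s, volume P.space := Finset.sum_congr rfl fun P _ => P.volume_space.symm
    _ = volume (⋃ P ∈ s, P.space) := by
        rw [measure_biUnion_finset]
        · intro P hP R hR hne
          exact Tile.disjoint_space hne (hs P hP R hR)
        · exact fun P _ => (D.isBoundedInterval _ P.space_mem).measurableSet
    _ ≤ volume I := measure_mono (iUnion₂_subset hsI)
    _ = _ := hI.volume_eq

/-- A finite set of tiles of a tree, with one frequency interval for each scale, is a family. -/
theorem isFamily_of_tree (hdual : D.Dual D') (hJ : J ∈ D.intervals) (hN : Measurable N)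
    (hh : Measurable h) (hT : T ∈ localTrees D D' 1 J) (hs : ∀ P ∈ s, P ∈ T.tiles)
    (hd : ∀ P ∈ s, DensityLE J N h lam P)
    (hfr : ∀ P ∈ s, ∀ R ∈ s, P.scl = R.scl → P.freq = R.freq) :
    IsFamily J N h lam T.topFreq (center T.top) (len T.top) s where
  dual := hdual
  mem_J := hJ
  meas_N := hN
  meas_h := hh
  subset P hP := hT (hs P hP)
  scl_le P hP := (D.isBoundedInterval _ P.space_mem).len_le (D.isBoundedInterval _ T.top_mem)
    (T.space_subset P (hs P hP))
  center_le P hP := by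
    have h1 := (D.isBoundedInterval _ P.space_mem).abs_center_sub_le
      (D.isBoundedInterval _ T.top_mem) (T.space_subset P (hs P hP))
    linarith [(D.isBoundedInterval _ P.space_mem).len_pos]
  freq P hP := T.topFreq_mem P (hs P hP)
  sep P hP R hR hne hl := Tile.scl_le_abs_center_sub hne (hfr P hP R hR hl)
  dens := hd

variable {M : ℕ} {f : ℝ → ℂ}

theorem sum_ov_le (hM : 20 ≤ M) (hdual : D.Dual D') (hJ : J ∈ D.intervals) (hN : Measurable N)
    (hf : Measurable f) (hT : T ∈ localTrees D D' 1 J) (hs : ∀ P ∈ s, P ∈ T.tiles)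
    (hd : ∀ P ∈ s, DensityLE J N (fun x => ‖f x‖ₑ) lam P) (hξ : ∀ P ∈ s, T.topFreq ∈ P.freq) :
    ∑ P ∈ s, ENNReal.ofReal P.scl * modifiedTransform M N f P ≤
      10 ^ 14 * lam * ENNReal.ofReal (len T.top) := by
  rcases s.eq_empty_or_nonempty with rfl | hne
  · simp
  have hF := isFamily_of_tree hdual hJ hN hf.enorm hT hs hd fun P hP R hR hl =>
    D'.eq_of_nonempty P.freq_mem R.freq_mem ⟨_, hξ P hP, hξ R hR⟩ (Tile.len_freq_eq_iff.2 hl)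
  -- Both frequency intervals contain the top frequency, so the parent of the shorter one lies
  -- inside `ω_P`, away from the sibling of `ω_P`.
  have key : ∀ P ∈ s, ∀ R ∈ s, P.scl < R.scl → Disjoint (freqSet N P) (freqSet N R) := by
    intro P hP R hR hl
    have h1 := D'.parent_subset_of_mem P.freq_mem R.freq_mem (hξ P hP) (hF.freq R hR)
      (Tile.len_freq_lt hl)
    exact ((D'.disjoint_sibling P.freq_mem).symm.mono_right
      (D'.sibling_subset_parent.trans h1)).preimage N
  refine (hF.sum_scl_mul_modifiedTransform_le hM hne ?_).trans ?_
  · intro P hP R hR hl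
    rcases lt_or_gt_of_ne hl with h1 | h1
    · exact key P hP R hR h1
    · exact (key R hR P hP h1).symm
  · gcongr
    norm_num

theorem sum_sq_lac_le (hM : 20 ≤ M) (hdual : D.Dual D') (hJ : J ∈ D.intervals) (hN : Measurable N)
    (hf : Measurable f) (hfi : Integrable f) (hfb : ∃ B, ∀ x, ‖f x‖ ≤ B)
    (hT : T ∈ localTrees D D' 1 J) (hs : ∀ P ∈ s, P ∈ T.tiles)
    (hd : ∀ P ∈ s, DensityLE J N (fun x => ‖f x‖ₑ) lam P)
    (hξ : ∀ P ∈ s, T.topFreq ∈ D'.sibling P.freq) :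
    ∑ P ∈ s, ENNReal.ofReal P.scl * modifiedTransform M N f P ^ 2 ≤
      10 ^ 26 * lam ^ 2 * ENNReal.ofReal (len T.top) := by
  rcases s.eq_empty_or_nonempty with rfl | hne
  · simp
  have hn : ∀ P ∈ s, T.topFreq ∉ P.freq := fun P hP hmem =>
    Set.disjoint_left.1 (D'.disjoint_sibling P.freq_mem) hmem (hξ P hP)
  -- At a given scale the sibling is the interval containing the top frequency. It determines the
  -- parent, and the frequency interval is the other half.
  have hfr : ∀ P ∈ s, ∀ R ∈ s, P.scl = R.scl → P.freq = R.freq := by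
    intro P hP R hR hl
    have hl' := Tile.len_freq_eq_iff.2 hl
    obtain ⟨A, hA, hAn, hAl, hAs, hAξ⟩ := D'.mem_sibling_iff.1 (hξ P hP)
    obtain ⟨B, hB, hBn, hBl, hBs, hBξ⟩ := D'.mem_sibling_iff.1 (hξ R hR)
    have hAB : A = B := D'.eq_of_nonempty hA hB ⟨_, hAξ, hBξ⟩ (by rw [hAl, hBl, hl'])
    have hp : D'.parent 1 P.freq = D'.parent 1 R.freq :=
      D'.eq_of_nonempty (D'.parent_mem P.freq_mem) (D'.parent_mem R.freq_mem)
        ⟨_, hAs hAξ, hBs hBξ⟩ (by rw [D'.len_parent P.freq_mem, D'.len_parent R.freq_mem, hl'])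
    have h2 := D'.len_parent P.freq_mem
    rcases D'.eq_or_eq_of_subset (D'.parent_mem P.freq_mem) P.freq_mem hA R.freq_mem
      (D'.subset_parent P.freq_mem) hAs (hp ▸ D'.subset_parent R.freq_mem) h2
      (by rw [hAl, h2]) (by rw [← hl', h2]) hAn.symm with h3 | h3
    · exact h3.symm
    · exact absurd (h3.trans hAB).symm hBn
  refine (isFamily_of_tree hdual hJ hN hf.enorm hT hs hd hfr).sum_scl_mul_sq_modifiedTransform_le
    hM hf hfi hfb hne ?_ hn
  intro P hP R hR hl
  rcases hl.eq_or_lt with hl | hl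
  · rw [freqSet, freqSet, hfr P hP R hR hl]
  -- This is the nestedness of the lacunary part: the tile of larger scale sees only frequencies in
  -- the sibling of the frequency interval of the other.
  · have h1 := D'.parent_subset_sibling P.freq_mem R.freq_mem (T.topFreq_mem P (hs P hP))
      (T.topFreq_mem R (hs R hR)) (hn P hP) (Tile.len_freq_lt hl)
    exact preimage_mono (D'.sibling_subset_parent.trans h1)

/-- The tiles whose frequency interval and its sibling both miss the top frequency, which is then a
common endpoint, have one scale. -/
theorem sum_sq_endpoint_le (hM : 20 ≤ M) (hN : Measurable N)
    (hf : Measurable f) (hT : T ∈ localTrees D D' 1 J) (hs : ∀ P ∈ s, P ∈ T.tiles)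
    (hd : ∀ P ∈ s, DensityLE J N (fun x => ‖f x‖ₑ) lam P)
    (hn : ∀ P ∈ s, T.topFreq ∉ P.freq) (hξ : ∀ P ∈ s, T.topFreq ∉ D'.sibling P.freq) :
    ∑ P ∈ s, ENNReal.ofReal P.scl * modifiedTransform M N f P ^ 2 ≤
      10 ^ 26 * lam ^ 2 * ENNReal.ofReal (len T.top) := by
  classical
  rcases s.eq_empty_or_nonempty with rfl | ⟨R, hR⟩
  · simp
  -- With two different scales, the shorter parent frequency interval would lie in the sibling of
  -- the longer frequency interval and carry the top frequency into it.
  have hscl : ∀ P ∈ s, ∀ R ∈ s, ¬ P.scl < R.scl := fun P hP R hR hl =>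
    hξ P hP (D'.parent_subset_sibling P.freq_mem R.freq_mem (T.topFreq_mem P (hs P hP))
      (T.topFreq_mem R (hs R hR)) (hn P hP) (Tile.len_freq_lt hl) (T.topFreq_mem R (hs R hR)))
  have hlen : ∀ P ∈ s, len P.freq = len R.freq := fun P hP =>
    Tile.len_freq_eq_iff.2 (le_antisymm (not_lt.1 (hscl R hR P hP)) (not_lt.1 (hscl P hP R hR)))
  have h2 := D'.len_parent R.freq_mem
  have hp : ∀ P ∈ s, P.freq ⊆ D'.parent 1 R.freq := fun P hP => by
    have : D'.parent 1 P.freq = D'.parent 1 R.freq :=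
      D'.eq_of_nonempty (D'.parent_mem P.freq_mem) (D'.parent_mem R.freq_mem)
        ⟨_, T.topFreq_mem P (hs P hP), T.topFreq_mem R (hs R hR)⟩
        (by rw [D'.len_parent P.freq_mem, h2, hlen P hP])
    rw [← this]
    exact D'.subset_parent P.freq_mem
  have htop := D.isBoundedInterval _ T.top_mem
  -- All frequency intervals are halves of one parent, and for each half the space intervals are
  -- disjoint.
  have hsum : ∑ P ∈ s, ENNReal.ofReal P.scl ≤ 2 * ENNReal.ofReal (len T.top) := by
    rw [← Finset.sum_filter_add_sum_filter_not s fun P => P.freq = R.freq, two_mul]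
    refine add_le_add (sum_scl_le_of_freq_eq htop ?_ ?_) (sum_scl_le_of_freq_eq htop ?_ ?_)
    · intro P hP Q hQ
      rw [(Finset.mem_filter.1 hP).2, (Finset.mem_filter.1 hQ).2]
    · exact fun P hP => T.space_subset P (hs P (Finset.mem_filter.1 hP).1)
    · intro P hP Q hQ
      obtain ⟨hP, hP'⟩ := Finset.mem_filter.1 hP
      obtain ⟨hQ, hQ'⟩ := Finset.mem_filter.1 hQ
      rcases D'.eq_or_eq_of_subset (D'.parent_mem R.freq_mem) R.freq_mem Q.freq_mem P.freq_mem
        (D'.subset_parent R.freq_mem) (hp Q hQ) (hp P hP) h2 (by rw [hlen Q hQ, h2])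
        (by rw [hlen P hP, h2]) (Ne.symm hQ') with h3 | h3
      · exact absurd h3 hP'
      · exact h3
    · exact fun P hP => T.space_subset P (hs P (Finset.mem_filter.1 hP).1)
  calc _ ≤ ∑ P ∈ s, ENNReal.ofReal P.scl * (65536 * lam) ^ 2 := by
        apply Finset.sum_le_sum
        intro P hP
        gcongr
        exact modifiedTransform_le_of_density hM hf hN (hT (hs P hP)) (hd P hP)
    _ = (∑ P ∈ s, ENNReal.ofReal P.scl) * (65536 * lam) ^ 2 := by rw [Finset.sum_mul]
    _ ≤ 2 * ENNReal.ofReal (len T.top) * (65536 * lam) ^ 2 := by gcongr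
    _ = 8589934592 * lam ^ 2 * ENNReal.ofReal (len T.top) := by ring
    _ ≤ _ := by
        gcongr
        norm_num

theorem tsum_indicator_tiles (S : Set (Tile D D')) (G : Tile D D' → ℝ≥0∞) {p : ℝ} (hp : 0 < p)
    [DecidablePred (· ∈ S)] :
    ∑' P : S, volume (P : Tile D D').space * (s : Set (Tile D D')).indicator G P ^ p =
      ∑ P ∈ s.filter (· ∈ S), ENNReal.ofReal P.scl * G P ^ p := by
  rw [tsum_subtype S fun P => volume P.space * (s : Set (Tile D D')).indicator G P ^ p,
    tsum_eq_sum (s := s.filter (· ∈ S))]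
  · apply Finset.sum_congr rfl
    intro P hP
    obtain ⟨h1, h2⟩ := Finset.mem_filter.1 hP
    rw [indicator_of_mem h2, indicator_of_mem (by exact_mod_cast h1), P.volume_space]
  · intro P hP
    by_cases h2 : P ∈ S
    · have h1 : P ∉ (s : Set (Tile D D')) := fun h1 =>
        hP (Finset.mem_filter.2 ⟨by exact_mod_cast h1, h2⟩)
      rw [indicator_of_mem h2, indicator_of_notMem h1, ENNReal.zero_rpow_of_pos hp, mul_zero]
    · rw [indicator_of_notMem h2]

/-- The size is controlled by the density. -/
theorem sizeC_le (hM : 20 ≤ M) (hdual : D.Dual D') (hJ : J ∈ D.intervals) (hN : Measurable N)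
    (hf : Measurable f) (hfi : Integrable f) (hfb : ∃ B, ∀ x, ‖f x‖ ≤ B)
    (hd : ∀ P ∈ s, DensityLE J N (fun x => ‖f x‖ₑ) lam P) (hT : T ∈ localTrees D D' 1 J) :
    sizeC ((s : Set (Tile D D')).indicator (modifiedTransform M N f)) T ≤ 10 ^ 15 * lam := by
  classical
  have htop := D.isBoundedInterval _ T.top_mem
  have hv0 : ENNReal.ofReal (len T.top) ≠ 0 := by
    rw [Ne, ENNReal.ofReal_eq_zero, not_le]; exact htop.len_pos
  have hov : sizeP 1 ((s : Set (Tile D D')).indicator (modifiedTransform M N f)) T.ov ≤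
      10 ^ 14 * lam := by
    rw [sizeP, tsum_indicator_tiles _ _ one_pos]
    have hvol : volume T.ov.top = ENNReal.ofReal (len T.top) := htop.volume_eq
    simp only [div_one, ENNReal.rpow_one, hvol]
    apply ENNReal.div_le_of_le_mul
    apply sum_ov_le hM hdual hJ hN hf hT
    · exact fun P hP => (Finset.mem_filter.1 hP).2.1
    · exact fun P hP => hd P (Finset.mem_filter.1 hP).1
    · exact fun P hP => (Finset.mem_filter.1 hP).2.2
  have hlac : sizeP 2 ((s : Set (Tile D D')).indicator (modifiedTransform M N f)) T.lac ≤
      10 ^ 14 * lam := by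
    rw [sizeP, tsum_indicator_tiles _ _ two_pos]
    have hvol : volume T.lac.top = ENNReal.ofReal (len T.top) := htop.volume_eq
    rw [hvol, ← ENNReal.div_rpow_of_nonneg _ _ (by norm_num), one_div,
      ENNReal.rpow_inv_le_iff two_pos]
    apply ENNReal.div_le_of_le_mul
    simp only [ENNReal.rpow_two]
    -- The two halves may omit points of their parent, such as the common endpoint, so missing `ω_P`
    -- does not place the top frequency in the sibling. The exceptional tiles are treated apart.
    rw [← Finset.sum_filter_add_sum_filter_not _ fun P => T.topFreq ∈ D'.sibling P.freq]
    have h1 := sum_sq_lac_le (T := T) (lam := lam)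
      (s := (s.filter (· ∈ T.lac.tiles)).filter fun P => T.topFreq ∈ D'.sibling P.freq)
      hM hdual hJ hN hf hfi hfb hT
      (fun P hP => (Finset.mem_filter.1 (Finset.mem_filter.1 hP).1).2.1)
      (fun P hP => hd P (Finset.mem_filter.1 (Finset.mem_filter.1 hP).1).1)
      (fun P hP => (Finset.mem_filter.1 hP).2)
    have h2 := sum_sq_endpoint_le (T := T) (lam := lam)
      (s := (s.filter (· ∈ T.lac.tiles)).filter fun P => ¬ T.topFreq ∈ D'.sibling P.freq)
      hM hN hf hT
      (fun P hP => (Finset.mem_filter.1 (Finset.mem_filter.1 hP).1).2.1)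
      (fun P hP => hd P (Finset.mem_filter.1 (Finset.mem_filter.1 hP).1).1)
      (fun P hP => (Finset.mem_filter.1 (Finset.mem_filter.1 hP).1).2.2)
      (fun P hP => (Finset.mem_filter.1 hP).2)
    calc _ ≤ _ := add_le_add h1 h2
      _ = 2 * 10 ^ 26 * lam ^ 2 * ENNReal.ofReal (len T.top) := by ring
      _ ≤ 10 ^ 28 * lam ^ 2 * ENNReal.ofReal (len T.top) := by gcongr; norm_num
      _ = _ := by rw [mul_pow, ← pow_mul]
  calc _ ≤ 10 ^ 14 * (lam : ℝ≥0∞) + 10 ^ 14 * lam := add_le_add hlac hov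
    _ = (2 * 10 ^ 14) * lam := by ring
    _ ≤ _ := by gcongr; norm_num

end Size

/-! ### Selecting trees of large density -/

section Selection
variable {D D' : DyadicGrid} {J : Set ℝ} {N : ℝ → ℝ} {h : ℝ → ℝ≥0∞} {lam : ℝ≥0}

/-- A rectangle of area two of the two grids, inside `J` in space. -/
structure IsRect (D D' : DyadicGrid) (J : Set ℝ) (p : Set ℝ × Set ℝ) : Prop where
  space_mem : p.1 ∈ D.intervals
  freq_mem : p.2 ∈ D'.intervals
  subset : p.1 ⊆ J
  area : len p.1 * len p.2 = 2

theorem IsRect.freq_len_le {p q : Set ℝ × Set ℝ} (hp : IsRect D D' J p) (hq : IsRect D D' J q)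
    (hl : len p.1 ≤ len q.1) : len q.2 ≤ len p.2 := by
  have h1 := hp.area
  have h2 := hq.area
  have h3 := (D.isBoundedInterval _ hp.space_mem).len_pos
  have h4 := (D'.isBoundedInterval _ hq.freq_mem).len_pos
  by_contra hcon
  push Not at hcon
  nlinarith

/-- The part of a dilate of a rectangle that lies on the graph of `N`. -/
def rectSet (N : ℝ → ℝ) (k : ℕ) (p : Set ℝ × Set ℝ) : Set ℝ :=
  Icc (center p.1 - 2 ^ k * len p.1) (center p.1 + 2 ^ k * len p.1) ∩ N ⁻¹' p.2

/-- Disjoint dilated rectangles meet the graph of `N` over disjoint sets. All of these lie where the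
bracket of `J` is at most `4 · 2^k`, which gives the factor `16 · 4^k`. -/
theorem sum_setLIntegral_rectSet_le (hJ : J ∈ D.intervals) (hN : Measurable N)
    {k : ℕ} {s : Finset (Set ℝ × Set ℝ)} (hs : ∀ p ∈ s, IsRect D D' J p)
    (hd : (s : Set (Set ℝ × Set ℝ)).PairwiseDisjoint fun p =>
      Icc (center p.1 - 2 ^ k * len p.1) (center p.1 + 2 ^ k * len p.1) ×ˢ p.2) :
    ∑ p ∈ s, ∫⁻ x in rectSet N k p, h x ≤
      16 * 4 ^ k * ∫⁻ x, h x * wt (center J) (len J) 2 x := by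
  have hJb := D.isBoundedInterval J hJ
  have hJl := hJb.len_pos
  have hm : ∀ p ∈ s, MeasurableSet (rectSet N k p) := fun p hp =>
    measurableSet_Icc.inter (hN (D'.isBoundedInterval _ (hs p hp).freq_mem).measurableSet)
  rw [← lintegral_biUnion_finset (t := rectSet N k) _ hm]
  · have hm2 : MeasurableSet (⋃ p ∈ s, rectSet N k p) := Finset.measurableSet_biUnion _ hm
    rw [← lintegral_indicator hm2, ← lintegral_const_mul' _ _ (by finiteness)]
    apply lintegral_mono
    intro x
    by_cases hx : x ∈ ⋃ p ∈ s, rectSet N k p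
    · rw [indicator_of_mem hx]
      obtain ⟨p, hp, hx⟩ := mem_iUnion₂.1 hx
      have hpb := D.isBoundedInterval _ (hs p hp).space_mem
      have h1 := hpb.len_le hJb (hs p hp).subset
      have h2 := hpb.abs_center_sub_le hJb (hs p hp).subset
      have h3 : |x - center p.1| ≤ 2 ^ k * len p.1 := by
        rw [abs_le]; constructor <;> linarith [hx.1.1, hx.1.2]
      have h4 := abs_sub_le x (center p.1) (center J)
      have h5 := hpb.len_pos
      have h6 : (1 : ℝ) ≤ 2 ^ k := one_le_pow₀ (by norm_num)
      have h7 : (2 : ℝ) ^ k * len p.1 ≤ 2 ^ k * len J := by gcongr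
      have hb : bracket (center J) (len J) x ≤ 4 * 2 ^ k := by
        have := mul_bracket (c := center J) (x := x) hJl
        nlinarith
      have hb0 := bracket_pos (c := center J) (x := x) hJl
      have h8 : (1 : ℝ≥0∞) ≤ 16 * 4 ^ k * wt (center J) (len J) 2 x := by
        have h9 : (1 : ℝ) ≤ 16 * 4 ^ k * (bracket (center J) (len J) x ^ 2)⁻¹ := by
          rw [← div_eq_mul_inv, le_div_iff₀ (by positivity)]
          calc _ ≤ (4 * 2 ^ k : ℝ) ^ 2 := by rw [one_mul]; gcongr
            _ = _ := by rw [mul_pow, ← pow_mul, mul_comm k 2, pow_mul]; norm_num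
        have h10 := ENNReal.ofReal_le_ofReal h9
        rw [ENNReal.ofReal_mul (by positivity), ENNReal.ofReal_mul (by positivity),
          ENNReal.ofReal_pow (by positivity)] at h10
        simpa [wt] using h10
      calc h x = 1 * h x := (one_mul _).symm
        _ ≤ 16 * 4 ^ k * wt (center J) (len J) 2 x * h x := by gcongr
        _ = _ := by ring
    · rw [indicator_of_notMem hx]; exact zero_le
  · intro p hp q hq hne
    refine Set.disjoint_left.2 fun x hx hx' => ?_
    exact Set.disjoint_left.1 (hd hp hq hne) (show (x, N x) ∈ _ from ⟨hx.1, hx.2⟩) ⟨hx'.1, hx'.2⟩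

/-- A Vitali covering argument bounds the lengths of disjoint rectangles of large density. -/
theorem sum_len_le_of_density (hJ : J ∈ D.intervals) (hN : Measurable N)
    {k : ℕ} {s : Finset (Set ℝ × Set ℝ)} (hs : ∀ p ∈ s, IsRect D D' J p)
    (hd : ∀ p ∈ s, ∀ q ∈ s, p ≠ q → Disjoint (p.1 ×ˢ p.2) (q.1 ×ˢ q.2))
    (hlam : ∀ p ∈ s, lam * 2 ^ (4 * k) * ENNReal.ofReal (len p.1) ≤ ∫⁻ x in rectSet N k p, h x) :
    lam * ∑ p ∈ s, ENNReal.ofReal (len p.1) ≤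
      128 * 2⁻¹ ^ k * ∫⁻ x, h x * wt (center J) (len J) 2 x := by
  classical
  have hb : ∀ p ∈ s, IsBoundedInterval p.1 := fun p hp =>
    D.isBoundedInterval _ (hs p hp).space_mem
  have h2k : (1 : ℝ) ≤ 2 ^ k := one_le_pow₀ (by norm_num)
  -- The selection compares space lengths only. Any enlargement factor strictly between `1` and `2`
  -- works, since for dyadic lengths it then amounts to the factor `1`.
  obtain ⟨u, hus, hud, hcov⟩ := Vitali.exists_disjoint_subfamily_covering_enlargement
    (fun p : Set ℝ × Set ℝ =>
      Icc (center p.1 - 2 ^ k * len p.1) (center p.1 + 2 ^ k * len p.1) ×ˢ p.2)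
    (s : Set (Set ℝ × Set ℝ)) (fun p => len p.1) (3 / 2) (by norm_num)
    (fun p hp => (hb p hp).len_pos.le) (len J)
    (fun p hp => (hb p hp).len_le (D.isBoundedInterval J hJ) (hs p hp).subset)
    (fun p hp => by
      refine (nonempty_Icc.2 ?_).prod (D'.isBoundedInterval _ (hs p hp).freq_mem).nonempty
      have := (hb p hp).len_pos
      have : 0 ≤ 2 ^ k * len p.1 := by positivity
      linarith)
  choose! b hbu hbn hbl using hcov
  have hcov2 : ∀ p ∈ s, len p.1 ≤ len (b p).1 ∧ (b p).2 ⊆ p.2 ∧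
      |center p.1 - center (b p).1| ≤ 2 * 2 ^ k * len (b p).1 := by
    intro p hp
    have hz : b p ∈ s := hus (hbu p hp)
    have hzl := (hb _ hz).len_pos
    have h1 : len p.1 ≤ len (b p).1 := D.len_le_of_lt_two_mul (hs p hp).space_mem
      (hs _ hz).space_mem (by linarith [hbl p hp])
    obtain ⟨⟨x, y⟩, hx1, hx2⟩ := hbn p hp
    refine ⟨h1, D'.subset_of_nonempty (hs _ hz).freq_mem (hs p hp).freq_mem ⟨y, hx2.2, hx1.2⟩
      ((hs p hp).freq_len_le (hs _ hz) h1), ?_⟩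
    have h2 := hx1.1
    have h3 := hx2.1
    have h4 : (2 : ℝ) ^ k * len p.1 ≤ 2 ^ k * len (b p).1 := by gcongr
    simp only [mem_Icc] at h2 h3
    rw [abs_le]
    constructor <;> linarith
  set U := s.filter (· ∈ u) with hU
  -- Rectangles assigned to one selected `z` all contain the frequency interval of `z`. Being
  -- disjoint, they have disjoint space intervals, and these lie in the `2^(k+2)`-dilate of the
  -- space interval of `z`.
  have hsum : ∑ p ∈ s, ENNReal.ofReal (len p.1) ≤
      ∑ z ∈ U, 2 ^ (k + 3) * ENNReal.ofReal (len z.1) := by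
    rw [← Finset.sum_fiberwise_of_maps_to (t := U) (g := b)
      (fun p hp => Finset.mem_filter.2 ⟨hus (hbu p hp), hbu p hp⟩)]
    apply Finset.sum_le_sum
    intro z hz
    have hzs : z ∈ s := (Finset.mem_filter.1 hz).1
    have hzl := (hb z hzs).len_pos
    calc _ = ∑ p ∈ s.filter (b · = z), volume p.1 := by
          apply Finset.sum_congr rfl
          exact fun p hp => (hb p (Finset.mem_filter.1 hp).1).volume_eq.symm
      _ = volume (⋃ p ∈ s.filter (b · = z), p.1) := by
          rw [measure_biUnion_finset]
          · intro p hp q hq hne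
            obtain ⟨hp, hpz⟩ := Finset.mem_filter.1 hp
            obtain ⟨hq, hqz⟩ := Finset.mem_filter.1 hq
            obtain ⟨y, hy⟩ := (D'.isBoundedInterval _ (hs z hzs).freq_mem).nonempty
            refine Set.disjoint_left.2 fun x hx hx' => ?_
            exact Set.disjoint_left.1 (hd p hp q hq hne)
              (show (x, y) ∈ _ from ⟨hx, (hcov2 p hp).2.1 (hpz ▸ hy)⟩) ⟨hx', (hcov2 q hq).2.1 (hqz ▸ hy)⟩
          · exact fun p hp => (hb p (Finset.mem_filter.1 hp).1).measurableSet
      _ ≤ volume (Icc (center z.1 - 2 ^ (k + 2) * len z.1)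
            (center z.1 + 2 ^ (k + 2) * len z.1)) := by
          apply measure_mono
          refine iUnion₂_subset fun p hp x hx => ?_
          obtain ⟨hp, hpz⟩ := Finset.mem_filter.1 hp
          obtain ⟨h1, -, h2⟩ := hcov2 p hp
          rw [hpz] at h1 h2
          have h3 := (hb p hp).abs_sub_center_le hx
          have h4 := abs_sub_le x (center p.1) (center z.1)
          have h5 : |x - center z.1| ≤ 2 ^ (k + 2) * len z.1 := by
            rw [pow_add]
            nlinarith
          rw [abs_le] at h5
          constructor <;> linarith
      _ = _ := by
          rw [Real.volume_Icc, show center z.1 + 2 ^ (k + 2) * len z.1 -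
            (center z.1 - 2 ^ (k + 2) * len z.1) = 2 ^ (k + 3) * len z.1 by ring,
            ENNReal.ofReal_mul (by positivity), ENNReal.ofReal_pow (by norm_num)]
          simp
  have hUs : ∀ p ∈ U, p ∈ s := fun p hp => (Finset.mem_filter.1 hp).1
  have hint := sum_setLIntegral_rectSet_le (h := h) (k := k) hJ hN
    (fun p hp => hs p (hUs p hp)) (hud.subset fun p hp => (Finset.mem_filter.1 hp).2)
  set m := ∫⁻ x, h x * wt (center J) (len J) 2 x with hm
  calc _ ≤ (lam : ℝ≥0∞) * ∑ z ∈ U, 2 ^ (k + 3) * ENNReal.ofReal (len z.1) := by gcongr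
    -- The gain `2^{-4k}` pays for `2^k` from the covering and `4^k` from the tail of the weight of
    -- `J`, leaving `2^{-k}`.
    _ = 2⁻¹ ^ ((3 + 1) * k) * 2 ^ (4 * k) *
        (lam * ∑ z ∈ U, 2 ^ (k + 3) * ENNReal.ofReal (len z.1)) := by
        rw [show (3 + 1) * k = 4 * k by ring, ← mul_pow,
          ENNReal.inv_mul_cancel (by norm_num) (by norm_num), one_pow, one_mul]
    _ = 2⁻¹ ^ ((3 + 1) * k) * 2 ^ (k + 3) *
        ∑ z ∈ U, lam * 2 ^ (4 * k) * ENNReal.ofReal (len z.1) := by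
        rw [← Finset.mul_sum, ← Finset.mul_sum]; ring
    _ ≤ 2⁻¹ ^ ((3 + 1) * k) * 2 ^ (k + 3) * (16 * 4 ^ k * m) := by
        gcongr
        exact (Finset.sum_le_sum fun p hp => hlam p (hUs p hp)).trans hint
    _ = 128 * (2⁻¹ ^ ((3 + 1) * k) * 2 ^ (3 * k)) * m := by
        rw [show (4 : ℝ≥0∞) = 2 ^ 2 by norm_num, ← pow_mul,
          show 3 * k = k + 2 * k by ring, pow_add _ k, pow_add _ k (2 * k)]
        ring
    _ = _ := by rw [ENNReal_two_inv_pow_mul]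

/-- The tree of the tiles of `A` below a rectangle. -/
noncomputable def IsRect.tree {p : Set ℝ × Set ℝ} (hp : IsRect D D' J p) (A : Set (Tile D D')) :
    Tree D D' 1 where
  tiles := {P ∈ A | P.space ⊆ p.1 ∧ p.2 ⊆ D'.parent 1 P.freq}
  top := p.1
  top_mem := hp.space_mem
  topFreq := center p.2
  space_subset := fun _ hP => hP.2.1
  topFreq_mem := fun _ hP => hP.2.2 (D'.isBoundedInterval _ hp.freq_mem).center_mem

/-- The tiles of large density are covered by few trees. -/
theorem outerMu_le_of_density (hJ : J ∈ D.intervals) (hN : Measurable N)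
    {A : Set (Tile D D')} (hA : A.Finite) (hAJ : A ⊆ localTiles D D' J)
    (hd : ∀ P ∈ A, ¬ DensityLE J N h lam P) :
    lam * (outerMu 1 J A * ENNReal.ofReal (len J)) ≤
      256 * ∫⁻ x, h x * wt (center J) (len J) 2 x := by
  classical
  set m := ∫⁻ x, h x * wt (center J) (len J) 2 x with hm
  have hJb := D.isBoundedInterval J hJ
  -- With the frequency order reversed, the product order becomes the order of rectangles: wider in
  -- space and narrower in frequency is larger.
  have hex : ∀ P ∈ A, ∃ p : Set ℝ × (Set ℝ)ᵒᵈ, IsRect D D' J (p.1, OrderDual.ofDual p.2) ∧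
      P.space ⊆ p.1 ∧ OrderDual.ofDual p.2 ⊆ D'.parent 1 P.freq ∧
      ∃ k : ℕ, lam * 2 ^ (4 * k) * ENNReal.ofReal (len p.1) ≤
        ∫⁻ x in rectSet N k (p.1, OrderDual.ofDual p.2), h x := by
    intro P hP
    have := hd P hP
    simp only [DensityLE] at this
    push Not at this
    obtain ⟨I, hI, Q, hQ, h1, h2, h3, h4, k, h5⟩ := this
    exact ⟨(I, OrderDual.toDual Q), ⟨hI, hQ, h2, h4⟩, h1, h3, k, h5.le⟩
  choose! r hr1 hr2 hr3 hr4 using hex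
  set X : Set (Set ℝ × (Set ℝ)ᵒᵈ) := r '' A with hX
  have hXf : X.Finite := hA.image r
  have hYf : {p | Maximal (· ∈ X) p}.Finite := hXf.subset fun p hp => hp.prop
  set Y := hYf.toFinset with hY
  have hYm : ∀ p ∈ Y, Maximal (· ∈ X) p := fun p hp => by
    rw [hY, Set.Finite.mem_toFinset] at hp
    exact hp
  have hYX : ∀ p ∈ Y, ∃ P ∈ A, r P = p := fun p hp => (hYm p hp).prop
  have hYr : ∀ p ∈ Y, IsRect D D' J (p.1, OrderDual.ofDual p.2) := fun p hp => by
    obtain ⟨P, hP, rfl⟩ := hYX p hp; exact hr1 P hP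
  have hYk : ∀ p ∈ Y, ∃ k : ℕ, lam * 2 ^ (4 * k) * ENNReal.ofReal (len p.1) ≤
        ∫⁻ x in rectSet N k (p.1, OrderDual.ofDual p.2), h x := fun p hp => by
    obtain ⟨P, hP, rfl⟩ := hYX p hp; exact hr4 P hP
  -- Intersecting rectangles of equal area are comparable by the grid property, so two maximal ones
  -- that intersect coincide.
  have key : ∀ p ∈ Y, ∀ q ∈ Y, ((p.1 ×ˢ OrderDual.ofDual p.2) ∩
      (q.1 ×ˢ OrderDual.ofDual q.2)).Nonempty → len p.1 ≤ len q.1 → p = q := by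
    rintro p hp q hq ⟨⟨x, y⟩, h1, h2⟩ hl
    have h3 : p.1 ⊆ q.1 := D.subset_of_nonempty (hYr p hp).space_mem (hYr q hq).space_mem
      ⟨x, h1.1, h2.1⟩ hl
    have h4 : OrderDual.ofDual q.2 ⊆ OrderDual.ofDual p.2 :=
      D'.subset_of_nonempty (hYr q hq).freq_mem (hYr p hp).freq_mem
      ⟨y, h2.2, h1.2⟩ ((hYr p hp).freq_len_le (hYr q hq) hl)
    have h5 : p ≤ q := ⟨h3, h4⟩
    exact le_antisymm h5 ((hYm p hp).le_of_ge (hYm q hq).prop h5)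
  have hYd : ∀ p ∈ Y, ∀ q ∈ Y, p ≠ q →
      Disjoint (p.1 ×ˢ OrderDual.ofDual p.2) (q.1 ×ˢ OrderDual.ofDual q.2) := by
    intro p hp q hq hne
    by_contra hcon
    rw [Set.not_disjoint_iff_nonempty_inter] at hcon
    rcases le_total (len p.1) (len q.1) with hl | hl
    · exact hne (key p hp q hq hcon hl)
    · exact hne (key q hq p hp (by rwa [inter_comm]) hl).symm
  choose! κ hκ using hYk
  -- The maximal rectangles are grouped by the dilation at which they witness the large density; the
  -- bounds `128 · 2^{-k}` sum to `256`.
  have hsum : lam * ∑ p ∈ Y, ENNReal.ofReal (len p.1) ≤ 256 * m := by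
    calc _ = ∑ k ∈ Y.image κ, lam * ∑ p ∈ Y.filter (κ · = k), ENNReal.ofReal (len p.1) := by
          rw [← Finset.mul_sum, Finset.sum_fiberwise_of_maps_to]
          exact fun p hp => Finset.mem_image_of_mem κ hp
      _ ≤ ∑ k ∈ Y.image κ, 128 * m * 2⁻¹ ^ k := by
          apply Finset.sum_le_sum
          intro k _
          have he : Function.Injective
              fun p : Set ℝ × (Set ℝ)ᵒᵈ => (p.1, OrderDual.ofDual p.2) := fun p q hpq => hpq
          have h1 := sum_len_le_of_density (N := N) (h := h) (lam := lam) (k := k)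
            (s := (Y.filter (κ · = k)).image fun p => (p.1, OrderDual.ofDual p.2))
            (D := D) (D' := D') hJ hN ?_ ?_ ?_
          · rwa [Finset.sum_image he.injOn, mul_right_comm] at h1
          · simp only [Finset.forall_mem_image]
            exact fun p hp => hYr p (Finset.mem_filter.1 hp).1
          · simp only [Finset.forall_mem_image]
            exact fun p hp q hq hne =>
              hYd p (Finset.mem_filter.1 hp).1 q (Finset.mem_filter.1 hq).1 fun heq =>
                hne (by rw [heq])
          · simp only [Finset.forall_mem_image]
            intro p hp
            have hp' := Finset.mem_filter.1 hp
            rw [← hp'.2]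
            exact hκ p hp'.1
      _ ≤ ∑' k : ℕ, 128 * m * 2⁻¹ ^ k := ENNReal.sum_le_tsum _
      _ = _ := by
          rw [ENNReal.tsum_mul_left, ENNReal.tsum_geometric, ENNReal.one_sub_inv_two, inv_inv]
          ring
  refine le_trans ?_ hsum
  gcongr
  rw [← hJb.volume_eq]
  apply ENNReal.mul_le_of_le_div
  set 𝒯 : Set (Tree D D' 1) := range fun p : Y => (hYr p.1 p.2).tree A with h𝒯
  refine (iInf₂_le 𝒯 ?_).trans ((iInf_le _ ?_).trans ?_)
  · rintro _ ⟨p, rfl⟩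
    exact fun P hP => hAJ hP.1
  · intro P hP
    obtain ⟨q, hq1, hq2⟩ := hXf.exists_le_maximal (mem_image_of_mem r hP)
    have hqY : q ∈ Y := by rw [hY, Set.Finite.mem_toFinset]; exact hq2
    refine mem_iUnion₂.2 ⟨_, ⟨⟨q, hqY⟩, rfl⟩, hP, (hr2 P hP).trans hq1.1, ?_⟩
    exact Subset.trans hq1.2 (hr3 P hP)
  · gcongr
    -- The collection is a set of trees, so summing over the rectangles can only count more.
    refine (ENNReal.tsum_le_tsum_comp_of_surjective
      (f := rangeFactorization fun p : Y => (hYr p.1 p.2).tree A) rangeFactorization_surjective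
      (fun T : 𝒯 => volume (T : Tree D D' 1).top)).trans ?_
    rw [← Finset.tsum_subtype Y]
    apply ENNReal.tsum_le_tsum
    intro p
    exact ((D.isBoundedInterval _ (hYr p.1 p.2).space_mem).volume_eq).le

end Selection

/-! ### The weak bounds -/

section Weak
variable {D D' : DyadicGrid} {J : Set ℝ} {N : ℝ → ℝ} {f g : ℝ → ℂ} {ℙ : Set (Tile D D')} {M : ℕ}
  {κ : ℝ≥0}

theorem modifiedTransform_congr_ae (h : f =ᵐ[volume] g) :
    modifiedTransform (D := D) (D' := D') M N f = modifiedTransform M N g := by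
  funext P
  simp only [modifiedTransform]
  refine iSup_congr fun ψ => iSup_congr fun _ => ?_
  congr 1
  apply integral_congr_ae
  filter_upwards [h] with x hx
  rw [hx]

theorem tileNorm_congr_ae (h : f =ᵐ[volume] g) : tileNorm f ℙ = tileNorm g ℙ := by
  have h1 : localAverage f = localAverage g := by
    funext I
    rw [localAverage, localAverage]
    congr 1
    apply lintegral_congr_ae
    filter_upwards [ae_restrict_of_ae h] with x hx
    rw [hx]
  simp only [tileNorm, maximalFunction, h1]

theorem MemLinftyZero.exists_representative (h : MemLinftyZero f) :
    ∃ g : ℝ → ℂ, f =ᵐ[volume] g ∧ Measurable g ∧ Integrable g ∧ ∃ B, ∀ x, ‖g x‖ ≤ B := by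
  obtain ⟨hf, R, hR⟩ := h
  obtain ⟨f₀, hf₀, hff₀⟩ := hf.aestronglyMeasurable
  set B := (eLpNorm f ∞ volume).toReal with hB
  have hbd : ∀ᵐ x, ‖f x‖ ≤ B := by
    filter_upwards [ae_le_eLpNormEssSup (f := f) (μ := volume)] with x hx
    rw [hB, eLpNorm_exponent_top, ← toReal_enorm]
    refine ENNReal.toReal_mono ?_ hx
    rw [← eLpNorm_exponent_top]
    exact hf.eLpNorm_ne_top
  have hS : MeasurableSet {x : ℝ | ‖f₀ x‖ ≤ B ∧ |x| ≤ R} :=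
    (measurableSet_le hf₀.measurable.norm measurable_const).inter
      (measurableSet_le measurable_abs measurable_const)
  have hm := hf₀.measurable.indicator hS
  have hb : ∀ x, ‖({x : ℝ | ‖f₀ x‖ ≤ B ∧ |x| ≤ R}.indicator f₀) x‖ ≤ B := fun x => by
    by_cases hx : x ∈ {x : ℝ | ‖f₀ x‖ ≤ B ∧ |x| ≤ R}
    · rw [indicator_of_mem hx]; exact hx.1
    · rw [indicator_of_notMem hx, norm_zero]; exact ENNReal.toReal_nonneg
  refine ⟨_, ?_, hm, ?_, B, hb⟩
  · filter_upwards [hff₀, hbd, hR] with x h1 h2 h3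
    by_cases hx : |x| ≤ R
    · rw [indicator_of_mem (by exact ⟨h1 ▸ h2, hx⟩), h1]
    · rw [indicator_of_notMem (fun h => hx h.2), h3 (not_le.1 hx)]
  · refine IntegrableOn.integrable_of_forall_notMem_eq_zero (s := Icc (-R) R) ?_ ?_
    · exact Measure.integrableOn_of_bounded (by simp) hm.aestronglyMeasurable
        (ae_of_all _ hb)
    · intro x hx
      exact indicator_of_notMem (fun h => hx (abs_le.1 h.2)) _

/-- An interval containing `I_P` competes in the maximal function at every point of `I_P`, hence in
its infimum. -/
theorem setLIntegral_Icc_le_tileNorm {P : Tile D D'} (hP : P ∈ ℙ) {a b : ℝ} (hab : a < b)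
    (hs : P.space ⊆ Icc a b) :
    ∫⁻ x in Icc a b, ‖f x‖ₑ ≤ tileNorm f ℙ * ENNReal.ofReal (b - a) := by
  have hI : IsBoundedInterval (Icc a b) := ⟨a, b, hab, Ioo_subset_Icc_self, Subset.rfl⟩
  have h1 : localAverage f (Icc a b) ≤ tileNorm f ℙ :=
    (le_iInf₂ fun x hx => le_iSup₂_of_le (Icc a b) hI
      (le_iSup (fun _ : x ∈ Icc a b => localAverage f (Icc a b)) (hs hx))).trans
      (le_iSup₂ (f := fun P (_ : P ∈ ℙ) => ⨅ x ∈ P.space, maximalFunction f x) P hP)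
  rwa [localAverage, Real.volume_Icc, ENNReal.div_le_iff (by simp [hab]) (by simp)] at h1

theorem setLIntegral_dilate_le (hκ : tileNorm f ℙ = κ) {P : Tile D D'} (hP : P ∈ ℙ) {I : Set ℝ}
    (hI : IsBoundedInterval I) (hs : P.space ⊆ I) (k : ℕ) :
    ∫⁻ x in Icc (center I - 2 ^ k * len I) (center I + 2 ^ k * len I), ‖f x‖ₑ ≤
      (2 * κ : ℝ≥0) * 2 ^ k * ENNReal.ofReal (len I) := by
  have hl := hI.len_pos
  have h2 : (1 : ℝ) ≤ 2 ^ k := one_le_pow₀ (by norm_num)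
  refine (setLIntegral_Icc_le_tileNorm (f := f) hP (by nlinarith) ?_).trans (le_of_eq ?_)
  · exact hs.trans (hI.subset_Icc.trans (Icc_subset_Icc (by nlinarith) (by nlinarith)))
  · rw [hκ, show center I + 2 ^ k * len I - (center I - 2 ^ k * len I) = 2 * 2 ^ k * len I by ring,
      ENNReal.ofReal_mul (by positivity), ENNReal.ofReal_mul (by positivity),
      ENNReal.ofReal_pow (by norm_num)]
    push_cast
    simp only [ENNReal.ofReal_ofNat]
    ring

/-- The frequency restriction is dropped. The dilate has length `2 · 2^k |I|` and contains `I_P`;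
the allowed `2^{4k}` is more than the `2^k` needed. -/
theorem densityLE_of_tileNorm (hκ : tileNorm f ℙ = κ) {P : Tile D D'} (hP : P ∈ ℙ) :
    DensityLE J N (fun x => ‖f x‖ₑ) (2 * κ) P := by
  intro I hI Q _ hPI _ _ _ k
  calc _ ≤ ∫⁻ x in Icc (center I - 2 ^ k * len I) (center I + 2 ^ k * len I), ‖f x‖ₑ :=
        lintegral_mono_set inter_subset_left
    _ ≤ _ := setLIntegral_dilate_le hκ hP (D.isBoundedInterval I hI) hPI k
    _ ≤ _ := by
        gcongr
        · norm_num
        · omega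

theorem outSup_le_of_density (hM : 20 ≤ M) (hdual : D.Dual D') (hJ : J ∈ D.intervals)
    (hN : Measurable N) (hf : Measurable f) (hfi : Integrable f) (hfb : ∃ B, ∀ x, ‖f x‖ ≤ B)
    (hℙ : ℙ.Finite) {lam : ℝ≥0} (hd : ∀ P ∈ ℙ, DensityLE J N (fun x => ‖f x‖ₑ) lam P) :
    outSup 1 J sizeC (ℙ.indicator (modifiedTransform M N f)) ≤ 10 ^ 15 * lam := by
  refine iSup₂_le fun T hT => ?_
  rw [← hℙ.coe_toFinset]
  exact sizeC_le hM hdual hJ hN hf hfi hfb (fun P hP => hd P (hℙ.mem_toFinset.1 hP)) hT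

theorem outerMu_empty : outerMu (D := D) (D' := D') 1 J ∅ = 0 := by
  refine le_antisymm ?_ zero_le
  rw [outerMu]
  refine iInf₂_le_of_le ∅ (empty_subset _) (iInf_le_of_le (empty_subset _) ?_)
  simp

theorem rearrangement_le {F : Tile D D' → ℝ≥0∞} {t τ : ℝ≥0} {A : Set (Tile D D')}
    (hA : A ⊆ localTiles D D' J)
    (hτ : outSup 1 J sizeC ((localTiles D D' J \ A).indicator F) ≤ τ) (ht : outerMu 1 J A ≤ t) :
    rearrangement 1 J sizeC F t ≤ τ := by
  have h1 : superLevel 1 J sizeC F τ ≤ t := by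
    rw [superLevel]
    exact iInf₂_le_of_le A hA (iInf_le_of_le hτ ht)
  rw [rearrangement]
  exact iInf₂_le_of_le τ h1 le_rfl

/-- The tiles whose density exceeds `lam` have outer measure at most `4096 κ / lam`. -/
theorem outerMu_density_le (hJ : J ∈ D.intervals) (hN : Measurable N) (hf : Measurable f)
    (hκ : tileNorm f ℙ = κ) {A : Set (Tile D D')} (hA : A.Finite) (hAℙ : A ⊆ ℙ)
    (hAJ : A ⊆ localTiles D D' J) {lam : ℝ≥0}
    (hd : ∀ P ∈ A, ¬ DensityLE J N (fun x => ‖f x‖ₑ) lam P) :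
    lam * outerMu 1 J A ≤ 4096 * κ := by
  rcases A.eq_empty_or_nonempty with rfl | ⟨P, hP⟩
  · rw [outerMu_empty]; simp
  have hJb := D.isBoundedInterval J hJ
  -- One tile of `A` inside `J` controls the averages over all dilates of `J`, which grow like
  -- `2^k`. The constant is `4096 = 256 · 2^3 · 2`.
  have h1 := lintegral_mul_wt_le (a := 1) hf.enorm hJb.len_pos (c := center J)
    (lam := (2 * κ : ℝ≥0)) fun k => by
      rw [one_mul]; exact setLIntegral_dilate_le hκ (hAℙ hP) hJb (hAJ hP) k
  have h2 := outerMu_le_of_density hJ hN hA hAJ hd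
  have h3 : lam * outerMu 1 J A * ENNReal.ofReal (len J) ≤
      4096 * κ * ENNReal.ofReal (len J) := by
    calc _ = _ := mul_assoc _ _ _
      _ ≤ _ := h2
      _ ≤ 256 * (2 ^ (1 + 2) * (2 * κ : ℝ≥0) * ENNReal.ofReal (len J)) := by gcongr
      _ = _ := by push_cast; ring
  exact (ENNReal.mul_le_mul_iff_left (by simp [hJb.len_pos]) (by simp)).1 h3

theorem outSup_le (hM : 20 ≤ M) (hdual : D.Dual D') (hJ : J ∈ D.intervals)
    (hN : Measurable N) (hf : Measurable f) (hfi : Integrable f) (hfb : ∃ B, ∀ x, ‖f x‖ ≤ B)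
    (hℙ : ℙ.Finite) (hκ : tileNorm f ℙ = κ) :
    outSup 1 J sizeC (ℙ.indicator (modifiedTransform M N f)) ≤ 10 ^ 19 * κ := by
  refine (outSup_le_of_density hM hdual hJ hN hf hfi hfb hℙ
    fun P hP => densityLE_of_tileNorm hκ hP).trans ?_
  push_cast
  rw [← mul_assoc]
  gcongr
  norm_num

theorem outSup_indicator_le (hM : 20 ≤ M) (hdual : D.Dual D') (hJ : J ∈ D.intervals)
    (hN : Measurable N) (hf : Measurable f) (hfi : Integrable f) (hfb : ∃ B, ∀ x, ‖f x‖ ≤ B)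
    (hℙ : ℙ.Finite) {lam : ℝ≥0} {S : Set (Tile D D')}
    (hd : ∀ P ∈ S ∩ ℙ, DensityLE J N (fun x => ‖f x‖ₑ) lam P) :
    outSup 1 J sizeC (S.indicator (ℙ.indicator (modifiedTransform M N f))) ≤ 10 ^ 15 * lam := by
  rw [indicator_indicator]
  exact outSup_le_of_density hM hdual hJ hN hf hfi hfb (hℙ.subset inter_subset_right) hd

/-- For `t ≤ 1` removing nothing is enough. For `t > 1` the tiles of density above `4096 κ / t` are
removed, and `t^r ≤ t` reduces every exponent to the endpoint `r = 1`. -/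
theorem rpow_mul_rearrangement_le (hM : 20 ≤ M) (hdual : D.Dual D') (hJ : J ∈ D.intervals)
    (hN : Measurable N) (hf : Measurable f) (hfi : Integrable f) (hfb : ∃ B, ∀ x, ‖f x‖ ≤ B)
    (hℙ : ℙ.Finite) (hκ : tileNorm f ℙ = κ) {r : ℝ} (hr0 : 0 ≤ r) (hr1 : r ≤ 1) (t : ℝ≥0) :
    (t : ℝ≥0∞) ^ r * rearrangement 1 J sizeC (ℙ.indicator (modifiedTransform M N f)) t ≤
      10 ^ 19 * κ := by
  have hsmall : rearrangement 1 J sizeC (ℙ.indicator (modifiedTransform M N f)) t ≤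
      (10 ^ 15 * (2 * κ) : ℝ≥0) := by
    refine rearrangement_le (A := ∅) (empty_subset _) ?_ (by rw [outerMu_empty]; exact zero_le)
    refine (outSup_indicator_le hM hdual hJ hN hf hfi hfb hℙ fun P hP =>
      densityLE_of_tileNorm hκ hP.2).trans (le_of_eq ?_)
    push_cast
    rfl
  rcases le_or_gt t 1 with ht | ht
  · calc _ ≤ 1 * ((10 ^ 15 * (2 * κ) : ℝ≥0) : ℝ≥0∞) := by
          gcongr
          exact ENNReal.rpow_le_one (by exact_mod_cast ht) hr0
      _ = 2 * 10 ^ 15 * κ := by push_cast; ring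
      _ ≤ _ := by gcongr; norm_num
  -- For `κ = 0` the threshold below would vanish and could not be cancelled; the unconditional
  -- bound already gives zero.
  rcases eq_or_ne κ 0 with rfl | hκ0
  · have : rearrangement 1 J sizeC (ℙ.indicator (modifiedTransform M N f)) t = 0 :=
      le_antisymm (hsmall.trans (by simp)) zero_le
    rw [this, mul_zero]
    exact zero_le
  have ht0 : t ≠ 0 := (zero_lt_one.trans ht).ne'
  -- The threshold that makes the bound for the outer measure of the removed tiles exactly `t`.
  set lam : ℝ≥0 := 4096 * κ / t with hlam
  have hlt : lam * t = 4096 * κ := by rw [hlam]; field_simp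
  have hlam0 : lam ≠ 0 := by
    intro h0
    rw [h0, zero_mul] at hlt
    exact hκ0 (by simpa using hlt.symm)
  set A : Set (Tile D D') :=
    {P ∈ ℙ | P.space ⊆ J ∧ ¬ DensityLE J N (fun x => ‖f x‖ₑ) lam P} with hA
  have hmu : outerMu 1 J A ≤ t := by
    have h1 := outerMu_density_le hJ hN hf hκ (A := A) (hℙ.subset fun P hP => hP.1)
      (fun P hP => hP.1) (fun P hP => hP.2.1) (lam := lam) fun P hP => hP.2.2
    have h2 : (4096 * κ : ℝ≥0∞) = lam * t := by
      rw [← ENNReal.coe_mul, hlt]; push_cast; rfl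
    rw [h2] at h1
    exact (ENNReal.mul_le_mul_iff_right (by simpa using hlam0) (by simp)).1 h1
  have hre : rearrangement 1 J sizeC (ℙ.indicator (modifiedTransform M N f)) t ≤
      (10 ^ 15 * lam : ℝ≥0) := by
    refine rearrangement_le (A := A) (fun P hP => hP.2.1) ?_ hmu
    refine (outSup_indicator_le (lam := lam) hM hdual hJ hN hf hfi hfb hℙ
      fun P hP => ?_).trans (le_of_eq ?_)
    · by_contra hcon
      exact hP.1.2 ⟨hP.2, hP.1.1, hcon⟩
    · push_cast
      rfl
  calc _ ≤ (t : ℝ≥0∞) * (10 ^ 15 * lam : ℝ≥0) := by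
        gcongr
        calc (t : ℝ≥0∞) ^ r ≤ (t : ℝ≥0∞) ^ (1 : ℝ) :=
              ENNReal.rpow_le_rpow_of_exponent_le (by exact_mod_cast ht.le) hr1
          _ = t := ENNReal.rpow_one _
    _ = 10 ^ 15 * ((lam * t : ℝ≥0) : ℝ≥0∞) := by push_cast; ring
    _ = 4096 * 10 ^ 15 * κ := by rw [hlt]; push_cast; ring
    _ ≤ _ := by gcongr; norm_num

theorem outerWeakNorm_le (hM : 20 ≤ M) (hdual : D.Dual D') (hJ : J ∈ D.intervals)
    (hN : Measurable N) (hf : Measurable f) (hfi : Integrable f) (hfb : ∃ B, ∀ x, ‖f x‖ ≤ B)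
    (hℙ : ℙ.Finite) (hκ : tileNorm f ℙ = κ) {p : ℝ≥0∞} (hp : 1 ≤ p) :
    outerWeakNorm 1 J sizeC p (ℙ.indicator (modifiedTransform M N f)) ≤ 10 ^ 19 * κ := by
  rw [outerWeakNorm]
  split_ifs with hpt
  · exact outSup_le hM hdual hJ hN hf hfi hfb hℙ hκ
  · have h1 : 1 ≤ p.toReal := by
      rw [← ENNReal.toReal_one]
      exact ENNReal.toReal_mono hpt hp
    refine iSup₂_le fun t _ => rpow_mul_rearrangement_le hM hdual hJ hN hf hfi hfb hℙ hκ
      (by positivity) ?_ t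
    rw [div_le_one (by linarith)]
    exact h1

end Weak

end WavePacket

/-! ### The proposition -/

open WavePacket in
theorem proposition4p1 :
    ∃ C : NNReal, ∀ M : ℕ, 10 * 2 ^ 9 ≤ M →
      ∀ D D' : DyadicGrid, D.Dual D' →
      ∀ N : ℝ → ℝ, Measurable N →
      ∀ f : ℝ → ℂ, MemLinftyZero f →
      ∀ ℙ : Set (Tile D D'), ℙ.Finite →
      ∀ J ∈ D.intervals, ∀ p : ENNReal, 1 ≤ p →
        outerWeakNorm 1 J sizeC p (ℙ.indicator (modifiedTransform M N f)) ≤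
            (C : ENNReal) * tileNorm f ℙ ∧
          outerYNorm 1 J sizeC p (ℙ.indicator (modifiedTransform M N f)) ≤
            (C : ENNReal) * tileNorm f ℙ := by
  refine ⟨10 ^ 19, fun M hM D D' hdual N hN f hf ℙ hℙ J hJ p hp => ?_⟩
  obtain ⟨g, hfg, hg, hgi, hgb⟩ := hf.exists_representative
  rw [modifiedTransform_congr_ae hfg, tileNorm_congr_ae hfg]
  have hM' : 20 ≤ M := le_trans (by norm_num) hM
  have hC : ((10 ^ 19 : NNReal) : ENNReal) = 10 ^ 19 := by push_cast; rfl
  rw [hC]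
  -- The bounds above take `κ` finite; an infinite right-hand side is trivial because the constant
  -- is nonzero.
  by_cases hκ : tileNorm g ℙ = ⊤
  · rw [hκ, ENNReal.mul_top (by norm_num)]
    exact ⟨le_top, le_top⟩
  · have hκ' := ENNReal.coe_toNNReal hκ
    have h1 := outerWeakNorm_le hM' hdual hJ hN hg hgi hgb hℙ hκ'.symm hp
    have h2 := outSup_le hM' hdual hJ hN hg hgi hgb hℙ hκ'.symm
    rw [← hκ']
    exact ⟨h1, max_le h1 h2⟩
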